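/- Let $X\subset\mathbb R^q$ ($q\ge1$) be a compact connected set with $X=\overline{\operatorname{Int}X}$ and let $E$ be a countable (finite or infinite) alphabet. Let $\theta:\Lambda\to\Lambda$ be an invertible ergodic measure-preserving transformation of a complete probability space $(\Lambda,\mathcal F,m)$. For $e\in E$, $\lambda\in\Lambda$ let $\varphi_e^\lambda:X\to X$ be injective conformal contractions with Lipschitz constants at most a common $s\in(0,1)$, which extend to injective conformal maps $W\to W$ for a common bounded open connected set $W\supset X$ (conformal: $C^1$, with derivative at every point of $W$ a nonzero multiple of a linear isometry), and such that $\lambda\mapsto\varphi_e^\lambda(x)$ is measurable for all $e\in E$, $x\in X$. Assume the bounded distortion property: there is $K:[0,1)\to[1,\infty)$ with $\lim_{t\downarrow0}K(t)=K(0)=1$ and $|(\varphi_e^\lambda)'(y)|\le K(t)\,|(\varphi_e^\lambda)'(x)|$ whenever $t\in[0,1)$, $e\in E$, $\lambda\in\Lambda$, $x\in X$ and $\|y-x\|\le t\operatorname{dist}(x,\mathbb R^q\setminus W)$. No separation condition is assumed. Call this system $\mathcal S$. For $\lambda\in\Lambda$ and $\omega=(\omega_1,\omega_2,\dots)\in E^\infty$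 let $\pi_\lambda(\omega)$ be the unique point of $\bigcap_{n\ge1}\varphi^\lambda_{\omega_1}\circ\varphi^{\theta(\lambda)}_{\omega_2}\circ\cdots\circ\varphi^{\theta^{n-1}(\lambda)}_{\omega_n}(X)$, let $\sigma$ be the shift on $E^\infty$, and let $\pi_\Lambda(\lambda,\omega)=\lambda$, $\pi_{E^\infty}(\lambda,\omega)=\omega$ and $\pi_{\mathbb R^q}(\lambda,\omega)=\pi_\lambda(\omega)$. Let $\xi$ be the partition of $E^\infty$ according to the first letter, and put $\tilde\xi=\pi_{E^\infty}^{-1}(\xi)$. Let $\mu$ be a probability measure on $\Lambda\times E^\infty$ that is invariant and ergodic under $\theta\times\sigma$, with $\mu\circ\pi_\Lambda^{-1}=m$, and let $(\mu_\lambda)_{\lambda\in\Lambda}$ be its disintegration over $m$. For a sub-$\sigma$-algebra $\mathcal A$ write $H_\mu(\tilde\xi\mid\mathcal A)=-\int\sum_{A\in\tilde\xi}1_A\log E_\mu(1_A\mid\mathcal A)\,d\mu$. With $\mathcal A_\Lambda=\pi_\Lambda^{-1}(\mathcal F)$ and $\mathcal B$ the Borel $\sigma$-algebra of $\mathbb R^q$,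 define the random projectional entropy $$h_\mu(\mathcal S)=H_\mu\big(\tilde\xi\mid\mathcal A_\Lambda\vee(\theta\times\sigma)^{-1}\pi_{\mathbb R^q}^{-1}(\mathcal B)\big)-H_\mu\big(\tilde\xi\mid\mathcal A_\Lambda\vee\pi_{\mathbb R^q}^{-1}(\mathcal B)\big)$$ and the Lyapunov exponent $$\chi_\mu=\int_{\Lambda\times E^\infty}-\log\big|(\varphi^\lambda_{\omega_1})'(\pi_{\theta(\lambda)}(\sigma(\omega)))\big|\,d\mu(\lambda,\omega)\in(0,\infty].$$ If $H_\mu(\tilde\xi\mid\mathcal A_\Lambda)<\infty$, then for $\mu$-a.e. $(\lambda,\omega)\in\Lambda\times E^\infty$ $$\lim_{r\to0}\frac{\log\big(\mu_\lambda\circ\pi_\lambda^{-1}(B(\pi_\lambda(\omega),r))\big)}{\log r}=\frac{h_\mu(\mathcal S)}{\chi_\mu},$$ where the right-hand side is a finite number, read as $0$ if $\chi_\mu=\infty$. In particular, for $m$-a.e. $\lambda$ the measure $\mu_\lambda\circ\pi_\lambda^{-1}$ is exact dimensional, with pointwise dimension $h_\mu(\mathcal S)/\chi_\mu$ almost everywhere.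 -/

import Mathlib

open MeasureTheory ProbabilityTheory Set Filter Topology
open scoped NNReal ENNReal

/-- A random countable conformal iterated function system on a compact set `X ⊆ ℝ^q`, with
alphabet `E`, driven by the invertible ergodic transformation `θ` of `(Λ, m)`.
The function `φ e lam` is defined on all of `ℝ^q`, but only its values on `W` (where it is the
conformal extension of the contraction `X → X`) are relevant. -/
structure RandomCIFS (q : ℕ) {Λ : Type*} [MeasurableSpace Λ] (m : Measure Λ) (E : Type*) where
  /-- the compact set on which the system acts -/
  X : Set (EuclideanSpace ℝ (Fin q))
  isCompact_X : IsCompact X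
  isConnected_X : IsConnected X
  closure_interior_X : closure (interior X) = X
  /-- the driving transformation -/
  θ : Λ ≃ᵐ Λ
  ergodic_θ : Ergodic θ m
  /-- the generators of the system -/
  φ : E → Λ → EuclideanSpace ℝ (Fin q) → EuclideanSpace ℝ (Fin q)
  mapsTo_X : ∀ e lam, MapsTo (φ e lam) X X
  /-- the common contraction ratio -/
  s : ℝ≥0
  s_pos : 0 < s
  s_lt_one : s < 1
  lipschitz_X : ∀ e lam, LipschitzOnWith s (φ e lam) X
  /-- the domain of the conformal extensions -/
  W : Set (EuclideanSpace ℝ (Fin q))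
  isOpen_W : IsOpen W
  isConnected_W : IsConnected W
  isBounded_W : Bornology.IsBounded W
  X_subset_W : X ⊆ W
  mapsTo_W : ∀ e lam, MapsTo (φ e lam) W W
  injOn_W : ∀ e lam, InjOn (φ e lam) W
  contDiffOn_W : ∀ e lam, ContDiffOn ℝ 1 (φ e lam) W
  conformalAt_W : ∀ e lam, ∀ x ∈ W, ConformalAt (φ e lam) x
  measurable_φ : ∀ e, ∀ x ∈ X, Measurable fun lam => φ e lam x

/-- The one-sided shift on `E^∞`; the letter `ω_{i+1}` of the sequence is `ω i`. -/
def shift {E : Type*} (ω : ℕ → E) : ℕ → E := fun n => ω (n + 1)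

namespace RandomCIFS

variable {q : ℕ} {Λ : Type*} [MeasurableSpace Λ] {m : Measure Λ} {E : Type*}

/-- The Bounded Distortion Property. -/
def BoundedDistortion (S : RandomCIFS q m E) : Prop :=
  ∃ K : ℝ → ℝ, (∀ t ∈ Ico (0 : ℝ) 1, 1 ≤ K t) ∧ K 0 = 1 ∧ Tendsto K (𝓝[>] 0) (𝓝 1) ∧
    ∀ t ∈ Ico (0 : ℝ) 1, ∀ e lam, ∀ x ∈ S.X, ∀ y,
      ‖y - x‖ ≤ t * Metric.infDist x S.Wᶜ →
        ‖fderiv ℝ (S.φ e lam) y‖ / ‖fderiv ℝ (S.φ e lam) x‖ ≤ K t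

/-- The random composition
`φ_{ω_1}^λ ∘ φ_{ω_2}^{θ λ} ∘ ⋯ ∘ φ_{ω_n}^{θ^{n-1} λ}`. -/
def iter (S : RandomCIFS q m E) (lam : Λ) (ω : ℕ → E) :
    ℕ → EuclideanSpace ℝ (Fin q) → EuclideanSpace ℝ (Fin q)
  | 0 => id
  | n + 1 => S.iter lam ω n ∘ S.φ (ω n) (S.θ^[n] lam)

theorem iter_lipschitz (S : RandomCIFS q m E) (lam : Λ) (ω : ℕ → E) (n : ℕ) :
    LipschitzOnWith (S.s ^ n) (S.iter lam ω n) S.X := by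
  induction n with
  | zero => simpa [iter] using LipschitzWith.id.lipschitzOnWith
  | succ n ih =>
    rw [pow_succ]
    exact ih.comp (S.lipschitz_X _ _) (S.mapsTo_X _ _)

theorem exists_coding (S : RandomCIFS q m E) (lam : Λ) (ω : ℕ → E) :
    ∃ x, ⋂ n : ℕ, S.iter lam ω (n + 1) '' S.X = {x} := by
  have hc : ∀ n, IsCompact (S.iter lam ω (n + 1) '' S.X) := fun n =>
    S.isCompact_X.image_of_continuousOn (S.iter_lipschitz lam ω (n + 1)).continuousOn
  obtain ⟨x, hx⟩ := IsCompact.nonempty_iInter_of_sequence_nonempty_isCompact_isClosed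
    (fun n : ℕ => S.iter lam ω (n + 1) '' S.X)
    (fun n => by
      change (S.iter lam ω (n + 1) ∘ S.φ (ω (n + 1)) (S.θ^[n + 1] lam)) '' S.X ⊆ _
      rw [image_comp]
      exact image_mono (S.mapsTo_X _ _).image_subset)
    (fun n => S.isConnected_X.nonempty.image _) (hc 0) (fun n => (hc n).isClosed)
  refine ⟨x, subset_antisymm (fun y hy => ?_) (singleton_subset_iff.2 hx)⟩
  rw [mem_iInter] at hx hy
  have hle : ∀ n : ℕ, dist y x ≤ (S.s : ℝ) ^ (n + 1) * Metric.diam S.X := by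
    intro n
    obtain ⟨a, ha, rfl⟩ := hy n
    obtain ⟨b, hb, hbx⟩ := hx n
    rw [← hbx]
    refine ((S.iter_lipschitz lam ω (n + 1)).dist_le_mul a ha b hb).trans ?_
    push_cast
    exact mul_le_mul_of_nonneg_left (Metric.dist_le_diam_of_mem S.isCompact_X.isBounded ha hb)
      (by positivity)
  have hlim : Tendsto (fun n : ℕ => (S.s : ℝ) ^ (n + 1) * Metric.diam S.X) atTop (𝓝 0) := by
    have h := ((tendsto_pow_atTop_nhds_zero_of_lt_one S.s.coe_nonneg
      (by exact_mod_cast S.s_lt_one)).comp (tendsto_add_atTop_nat 1)).mul_const (Metric.diam S.X)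
    simpa using h
  exact dist_le_zero.1 (ge_of_tendsto' hlim hle)

/-- The coding map `π_λ`: the unique point of `⋂_{n ≥ 1} φ_{ω|_n}^λ (X)`. -/
noncomputable def coding (S : RandomCIFS q m E) (lam : Λ) (ω : ℕ → E) :
    EuclideanSpace ℝ (Fin q) :=
  (S.exists_coding lam ω).choose

theorem iInter_eq_coding (S : RandomCIFS q m E) (lam : Λ) (ω : ℕ → E) :
    ⋂ n : ℕ, S.iter lam ω (n + 1) '' S.X = {S.coding lam ω} :=
  (S.exists_coding lam ω).choose_spec

/-- The skew product `θ × σ` on `Λ × E^∞`. -/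
def skew (S : RandomCIFS q m E) : Λ × (ℕ → E) → Λ × (ℕ → E) := Prod.map S.θ shift

/-- The map `π_{ℝ^q}(λ, ω) = π_λ(ω)`. -/
noncomputable def proj (S : RandomCIFS q m E) (p : Λ × (ℕ → E)) : EuclideanSpace ℝ (Fin q) :=
  S.coding p.1 p.2

end RandomCIFS

/-- The conditional entropy `H_μ(ξ | 𝒜)` of the partition `ξ` into the level sets of `f`, given
the σ-algebra `𝒜`: the integral of the information function
`-∑_{A ∈ ξ} 1_A log E_μ(1_A | 𝒜)`. -/
noncomputable def condEntropy {Ω E : Type*} [MeasurableSpace Ω] (μ : Measure Ω) (f : Ω → E)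
    (𝒜 : MeasurableSpace Ω) : ℝ≥0∞ :=
  ∫⁻ p, ENNReal.ofReal (-Real.log ((μ[(f ⁻¹' {f p}).indicator (fun _ => (1 : ℝ)) | 𝒜]) p)) ∂μ

/-- The first-letter map on `Λ × E^∞`; its level sets form the partition `π_{E^∞}⁻¹(ξ)`. -/
def firstLetter {Λ E : Type*} (p : Λ × (ℕ → E)) : E := p.2 0

/-- The σ-algebra on `Λ × E^∞` induced by the first coordinate. -/
abbrev baseAlgebra (Λ E : Type*) [MeasurableSpace Λ] : MeasurableSpace (Λ × (ℕ → E)) :=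
  MeasurableSpace.comap Prod.fst inferInstance

namespace RandomCIFS

variable {q : ℕ} {Λ : Type*} [MeasurableSpace Λ] {m : Measure Λ} {E : Type*} [MeasurableSpace E]

/-- The random projectional entropy `h_μ(S)`. -/
noncomputable def projEntropy (S : RandomCIFS q m E) (μ : Measure (Λ × (ℕ → E))) : EReal :=
  (condEntropy μ firstLetter
      (baseAlgebra Λ E ⊔ MeasurableSpace.comap (S.proj ∘ S.skew) inferInstance) : EReal) -
    (condEntropy μ firstLetter
      (baseAlgebra Λ E ⊔ MeasurableSpace.comap S.proj inferInstance) : EReal)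

/-- The Lyapunov exponent `χ_μ`, possibly infinite. As `|(φ_e^λ)'| ≤ s < 1` on `X`, the integrand
is positive. -/
noncomputable def lyapunov (S : RandomCIFS q m E) (μ : Measure (Λ × (ℕ → E))) : ℝ≥0∞ :=
  ∫⁻ p, ENNReal.ofReal
    (-Real.log ‖fderiv ℝ (S.φ (p.2 0) p.1) (S.coding (S.θ p.1) (shift p.2))‖) ∂μ

end RandomCIFS

/-- The pointwise (local) dimension of `ν` at `x` exists and is equal to `d`. -/
def HasPointwiseDim {Y : Type*} [PseudoMetricSpace Y] [MeasurableSpace Y] (ν : Measure Y)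
    (x : Y) (d : ℝ) : Prop :=
  Tendsto (fun r : ℝ => Real.log (ν.real (Metric.ball x r)) / Real.log r) (𝓝[>] 0) (𝓝 d)

/-- The measure `ν` is exact dimensional, with dimension `d`. -/
def IsExactDimensional {Y : Type*} [PseudoMetricSpace Y] [MeasurableSpace Y] (ν : Measure Y)
    (d : ℝ) : Prop :=
  ∀ᵐ x ∂ν, HasPointwiseDim ν x d

/-!
Write `T` for the skew product, `D p` for the scaling factor of the first generator of `p` at the
coding point of `T p`, `L r p` for the information `-log` of the closed ball of radius `r` about the
coding point of `p`, with respect to the projected conditional measure, and `h` and `χ` for the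
projectional entropy and the Lyapunov exponent. The generator sends the ball of radius `r` about the
coding point of `T p` approximately to the ball of radius `D p * r` about that of `p`. Since the
conditional measures are equivariant under the shift (`RandomCIFS.ae_map_shift_eq`), splitting both
balls by the first letter gives, up to factors `e^{±ε}` in the radii,

`L (D p * r) p ≈ L r (T p) + I' r p - I (D p * r) p`,

where `I` and `I'` are the informations of the first letter given a ball for the coding map and
for the coding map composed with `T` (`ballInfo`). Iterating (`le_add_sum_orbitRadius`) expresses
`L` at the radius `r₀ ∏_{k<n} D (T^k p)` as a sum of `n` increments of information along the orbit.
As the radii go to `0` the informations converge to the conditional ones defining `h`, so the sum is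
`n h + o(n)`, while the logarithm of the radius is `-n χ + o(n)`; the quotient is the local dimension.

The ingredients are the following.
* Two ergodic theorems: Birkhoff's (`ae_tendsto_birkhoffSum_div`) for the radii and Maker's
  (`ae_tendsto_sum_iterate_div`) for the informations, whose radii vary along the orbit.
* Convergence of `ballInfo` by the differentiation of measures, and its domination by an integrable
  function, by a maximal inequality from the Besicovitch covering theorem
  (`exists_ballInfo_limit`). This is where the finiteness of the fibre entropy enters.
* The bounds for the distortion of balls. That a generator increases distances by at most
  `e^ε D` is the mean value inequality (`RandomCIFS.exists_radius_dist_le`). The opposite bound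
  (`RandomCIFS.exists_radius_dist_le_of_dist_le`) needs more: segments between image points
  may leave the image of `W`. In dimension at least two it follows from an estimate of volumes
  (`measure_ball_diff_image_ball_le`): the image of a small ball almost fills a ball, so the images
  of two disjoint balls, being disjoint, cannot have close centres. On the line `X` is an interval.

If `χ = ∞`, the radii decrease superexponentially, which is seen on truncations of `-log D`, and the
local dimension is `0`.
-/

/-! ### The pointwise ergodic theorem -/

section Ergodic

variable {Ω : Type*} {T : Ω → Ω}

/-- The running maximum `max (0, S_1 f, …, S_n f)` of the Birkhoff sums of `f`, given by its
recursion. -/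
noncomputable def maxBirkhoff (T : Ω → Ω) (f : Ω → ℝ) : ℕ → Ω → ℝ
  | 0 => fun _ => 0
  | n + 1 => fun p => max 0 (f p + maxBirkhoff T f n (T p))

theorem maxBirkhoff_nonneg (f : Ω → ℝ) (n : ℕ) (p : Ω) : 0 ≤ maxBirkhoff T f n p := by
  cases n with
  | zero => exact le_rfl
  | succ n => exact le_max_left _ _

theorem maxBirkhoff_le_succ (f : Ω → ℝ) (n : ℕ) :
    ∀ p, maxBirkhoff T f n p ≤ maxBirkhoff T f (n + 1) p := by
  induction n with
  | zero => exact fun p => maxBirkhoff_nonneg f 1 p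
  | succ n ih =>
    intro p
    change max 0 (f p + maxBirkhoff T f n (T p)) ≤ max 0 (f p + maxBirkhoff T f (n + 1) (T p))
    gcongr
    exact ih _

theorem birkhoffSum_le_maxBirkhoff (f : Ω → ℝ) (n : ℕ) :
    ∀ p, birkhoffSum T f n p ≤ maxBirkhoff T f n p := by
  induction n with
  | zero => intro p; simp [maxBirkhoff]
  | succ n ih =>
    intro p
    rw [birkhoffSum_succ']
    exact le_max_of_le_right (by gcongr; exact ih _)

variable [MeasurableSpace Ω] {μ : Measure Ω}

theorem measurable_maxBirkhoff (hT : Measurable T) {f : Ω → ℝ} (hf : Measurable f) (n : ℕ) :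
    Measurable (maxBirkhoff T f n) := by
  induction n with
  | zero => exact measurable_const
  | succ n ih => exact measurable_const.max (hf.add (ih.comp hT))

theorem integrable_maxBirkhoff (hT : MeasurePreserving T μ μ) {f : Ω → ℝ}
    (hfi : Integrable f μ) (n : ℕ) : Integrable (maxBirkhoff T f n) μ := by
  induction n with
  | zero => exact integrable_zero _ _ _
  | succ n ih =>
    exact (integrable_zero _ _ _).sup (hfi.add (hT.integrable_comp_of_integrable ih))

/-- A negative mean keeps the Birkhoff sums bounded above: otherwise the sums would be unbounded
above almost everywhere by ergodicity, and the integrals of the nonnegative increments of the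
running maximum would converge to the mean of `f`. -/
theorem ae_bddAbove_birkhoffSum [IsProbabilityMeasure μ] (hT : Ergodic T μ) {f : Ω → ℝ}
    (hf : Measurable f) (hfi : Integrable f μ) (hneg : ∫ p, f p ∂μ < 0) :
    ∀ᵐ p ∂μ, BddAbove (range fun n => birkhoffSum T f n p) := by
  set M := maxBirkhoff T f with hM
  have hTm := hT.toMeasurePreserving
  have hmono : ∀ p, Monotone fun n => M n p := fun p =>
    monotone_nat_of_le_succ fun n => maxBirkhoff_le_succ f n p
  set A : Set Ω := {p | BddAbove (range fun n => M n p)} with hA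
  have hAm : MeasurableSet A :=
    measurableSet_bddAbove_range fun n => measurable_maxBirkhoff hTm.measurable hf n
  have hAinv : T ⁻¹' A = A := by
    ext p
    constructor
    · rintro ⟨C, hC⟩
      refine ⟨max 0 (f p + C), ?_⟩
      rintro _ ⟨n, rfl⟩
      refine (maxBirkhoff_le_succ f n p).trans ?_
      exact max_le_max le_rfl (by simpa using hC (mem_range_self n))
    · rintro ⟨C, hC⟩
      refine ⟨C - f p, ?_⟩
      rintro _ ⟨n, rfl⟩
      have h1 : M (n + 1) p ≤ C := hC (mem_range_self (n + 1))
      have h2 : f p + M n (T p) ≤ M (n + 1) p := le_max_right _ _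
      change M n (T p) ≤ C - f p
      linarith
  rcases hT.toPreErgodic.ae_mem_or_ae_notMem hAm hAinv with h | h
  · filter_upwards [h] with p ⟨C, hC⟩
    refine ⟨C, ?_⟩
    rintro _ ⟨n, rfl⟩
    exact (birkhoffSum_le_maxBirkhoff f n p).trans (hC (mem_range_self n))
  · exfalso
    have hlim : Tendsto (fun n => ∫ p, (M (n + 1) p - M n (T p)) ∂μ) atTop (𝓝 (∫ p, f p ∂μ)) := by
      refine tendsto_integral_of_dominated_convergence (fun p => |f p|)
        (fun n => ((measurable_maxBirkhoff hTm.measurable hf _).sub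
          ((measurable_maxBirkhoff hTm.measurable hf _).comp hTm.measurable)).aestronglyMeasurable)
        hfi.abs (fun n => Eventually.of_forall fun p => ?_) ?_
      · have h0 := maxBirkhoff_nonneg (T := T) f n (T p)
        change |max 0 (f p + M n (T p)) - M n (T p)| ≤ |f p|
        rcases max_cases 0 (f p + M n (T p)) with ⟨h1, h2⟩ | ⟨h1, h2⟩
        · rw [h1, zero_sub, abs_neg, abs_of_nonneg h0, abs_of_nonpos (by linarith)]
          linarith
        · rw [h1]; simp
      · filter_upwards [h] with p hp
        have hp' : T p ∉ A := fun h' => hp (by rw [← hAinv]; exact h')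
        have hun : ∃ n, -f p < M n (T p) := by
          by_contra! hcon
          exact hp' ⟨-f p, by rintro _ ⟨n, rfl⟩; exact hcon n⟩
        obtain ⟨n, hn⟩ := hun
        refine tendsto_const_nhds.congr' ?_
        filter_upwards [eventually_ge_atTop n] with k hk
        have : M n (T p) ≤ M k (T p) := hmono _ hk
        change f p = max 0 (f p + M k (T p)) - M k (T p)
        rw [max_eq_right (by linarith)]
        ring
    refine absurd (ge_of_tendsto' hlim fun n => ?_) (not_le.2 hneg)
    have hi := integrable_maxBirkhoff hTm hfi
    have hiT : Integrable (fun p => M n (T p)) μ := hTm.integrable_comp_of_integrable (hi n)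
    rw [integral_sub (hi (n + 1)) hiT]
    have : ∫ p, M n (T p) ∂μ = ∫ p, M n p ∂μ := by
      have := integral_map hTm.measurable.aemeasurable (μ := μ) (f := M n)
        (by rw [hTm.map_eq]; exact (hi n).aestronglyMeasurable)
      rw [hTm.map_eq] at this
      exact this.symm
    rw [this, sub_nonneg]
    exact integral_mono (hi n) (hi (n + 1)) fun p => maxBirkhoff_le_succ f n p

/-- One half of the ergodic theorem: the Birkhoff sums of `f` minus a constant slightly above its
mean are bounded above. -/
theorem ae_limsup_birkhoffSum_le [IsProbabilityMeasure μ] (hT : Ergodic T μ) {f : Ω → ℝ}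
    (hf : Measurable f) (hfi : Integrable f μ) :
    ∀ᵐ p ∂μ, ∀ c > ∫ p, f p ∂μ, ∀ᶠ n : ℕ in atTop, birkhoffSum T f n p ≤ n * c := by
  have h1 : ∀ j : ℕ, ∀ᵐ p ∂μ, BddAbove (range fun n =>
      birkhoffSum T (fun p => f p - (∫ p, f p ∂μ + 1 / ((j : ℝ) + 1))) n p) := fun j => by
    refine ae_bddAbove_birkhoffSum hT (hf.sub_const _) (hfi.sub (integrable_const _)) ?_
    rw [integral_sub hfi (integrable_const _)]
    simp only [integral_const, probReal_univ, smul_eq_mul, one_mul]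
    have : 0 < 1 / ((j : ℝ) + 1) := by positivity
    linarith
  filter_upwards [ae_all_iff.2 h1] with p hp c hc
  obtain ⟨j, hj⟩ := exists_nat_one_div_lt (sub_pos.2 hc)
  obtain ⟨C, hC⟩ := hp j
  have hlarge : ∀ᶠ n : ℕ in atTop, C ≤ n * (c - ∫ p, f p ∂μ - 1 / ((j : ℝ) + 1)) :=
    (tendsto_natCast_atTop_atTop.atTop_mul_const (by linarith)).eventually_ge_atTop C
  filter_upwards [hlarge] with n hn
  have h2 := hC (mem_range_self n)
  simp only [birkhoffSum, Finset.sum_sub_distrib, Finset.sum_const, Finset.card_range,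
    nsmul_eq_mul] at h2
  simp only [birkhoffSum]
  linarith

/-- **Birkhoff's pointwise ergodic theorem** for an ergodic transformation of a probability
space. -/
theorem ae_tendsto_birkhoffSum_div [IsProbabilityMeasure μ] (hT : Ergodic T μ) {f : Ω → ℝ}
    (hfi : Integrable f μ) :
    ∀ᵐ p ∂μ, Tendsto (fun n : ℕ => birkhoffSum T f n p / n) atTop (𝓝 (∫ p, f p ∂μ)) := by
  have key : ∀ f : Ω → ℝ, Measurable f → Integrable f μ →
      ∀ᵐ p ∂μ, Tendsto (fun n : ℕ => birkhoffSum T f n p / n) atTop (𝓝 (∫ p, f p ∂μ)) := by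
    intro f hf hfi
    filter_upwards [ae_limsup_birkhoffSum_le hT hf hfi,
      ae_limsup_birkhoffSum_le hT hf.neg hfi.neg] with p h1 h2
    simp only [Pi.neg_apply, integral_neg] at h2
    refine tendsto_order.2 ⟨fun a ha => ?_, fun a ha => ?_⟩
    · obtain ⟨b, hb, hb'⟩ := exists_between ha
      filter_upwards [h2 (-b) (by linarith), eventually_gt_atTop 0] with n hn hn0
      have hn0' : (0 : ℝ) < n := by exact_mod_cast hn0
      have hn' : -birkhoffSum T f n p ≤ n * -b := by
        have := birkhoffSum_neg T f n p
        rw [← this]; exact hn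
      rw [lt_div_iff₀ hn0']
      nlinarith
    · obtain ⟨b, hb, hb'⟩ := exists_between ha
      filter_upwards [h1 b hb, eventually_gt_atTop 0] with n hn hn0
      have hn0' : (0 : ℝ) < n := by exact_mod_cast hn0
      rw [div_lt_iff₀ hn0']
      nlinarith
  have hmk := hfi.aestronglyMeasurable.ae_eq_mk
  have hall : ∀ᵐ p ∂μ, ∀ n : ℕ, f (T^[n] p) = hfi.aestronglyMeasurable.mk f (T^[n] p) :=
    ae_all_iff.2 fun n =>
      (hT.toMeasurePreserving.iterate n).quasiMeasurePreserving.ae hmk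
  filter_upwards [hall, key _ hfi.aestronglyMeasurable.stronglyMeasurable_mk.measurable
    (hfi.congr hmk)] with p hp hlim
  rw [integral_congr_ae hmk]
  refine hlim.congr fun n => ?_
  simp only [birkhoffSum, hp]

/-- Along almost every orbit an integrable function grows sublinearly. -/
theorem ae_tendsto_iterate_div [IsProbabilityMeasure μ] (hT : Ergodic T μ) {f : Ω → ℝ}
    (hfi : Integrable f μ) :
    ∀ᵐ p ∂μ, Tendsto (fun n : ℕ => f (T^[n] p) / n) atTop (𝓝 0) := by
  filter_upwards [ae_tendsto_birkhoffSum_div hT hfi] with p hp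
  have h1 : Tendsto (fun n : ℕ => birkhoffSum T f (n + 1) p / ((n + 1 : ℕ) : ℝ) *
      (((n + 1 : ℕ) : ℝ) / n)) atTop (𝓝 ((∫ p, f p ∂μ) * 1)) := by
    refine (hp.comp (tendsto_add_atTop_nat 1)).mul ?_
    have : Tendsto (fun n : ℕ => 1 + 1 / (n : ℝ)) atTop (𝓝 (1 + 0)) :=
      tendsto_const_nhds.add tendsto_one_div_atTop_nhds_zero_nat
    rw [add_zero] at this
    refine this.congr' ?_
    filter_upwards [eventually_gt_atTop 0] with n hn
    have : (n : ℝ) ≠ 0 := by positivity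
    push_cast
    field_simp
  have h2 := h1.sub hp
  rw [mul_one, sub_self] at h2
  refine h2.congr' ?_
  filter_upwards [eventually_gt_atTop 0] with n hn
  have hn0 : (n : ℝ) ≠ 0 := by positivity
  have hn1 : ((n + 1 : ℕ) : ℝ) ≠ 0 := by positivity
  rw [div_mul_div_cancel₀ hn1, birkhoffSum_succ]
  ring

/-! ### Maker's ergodic theorem -/

/-- A right-continuous function of a positive real variable is bounded on an interval `(0, δ)` as
soon as it is bounded at its rational points. -/
theorem forall_pos_le_of_forall_rat {h : ℝ → ℝ} {C δ : ℝ}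
    (hc : ∀ r > 0, ContinuousWithinAt h (Ioi r) r)
    (hq : ∀ r : ℚ, 0 < (r : ℝ) → (r : ℝ) < δ → h r ≤ C) (r : ℝ) (hr : 0 < r) (hrδ : r < δ) :
    h r ≤ C := by
  have hfreq : ∃ᶠ x in 𝓝[>] r, h x ≤ C := by
    refine (frequently_nhdsWithin_iff).2 ?_
    rw [Metric.nhds_basis_ball.frequently_iff]
    intro ε hε
    obtain ⟨x, hx1, hx2⟩ := exists_rat_btwn (lt_min hrδ (lt_add_of_pos_right r hε))
    refine ⟨x, ?_, hq x (hr.trans hx1) (hx2.trans_le (min_le_left _ _)), hx1⟩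
    rw [Metric.mem_ball, Real.dist_eq, abs_of_pos (sub_pos.2 hx1)]
    linarith [hx2.trans_le (min_le_right _ _)]
  exact le_of_tendsto_of_frequently (hc r hr) hfreq

/-- **Maker's ergodic theorem**: if `I r → g` almost everywhere as `r → 0`, with an integrable
majorant, then the averages `n⁻¹ ∑_{k < n} I (ρ n k) (T^k p)` converge to `∫ g`, as soon as
`ρ n k` is small when `n - k` is large. The exceptional null set does not depend on the array
`ρ`. -/
theorem ae_tendsto_sum_iterate_div [IsProbabilityMeasure μ] (hT : Ergodic T μ)
    {I : ℝ → Ω → ℝ} {g F : Ω → ℝ} (hIm : ∀ r > 0, Measurable (I r)) (hg : Measurable g)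
    (hFi : Integrable F μ)
    (hIc : ∀ᵐ p ∂μ, ∀ r > 0, ContinuousWithinAt (fun r => I r p) (Ioi r) r)
    (hIF : ∀ᵐ p ∂μ, ∀ r > 0, |I r p| ≤ F p)
    (hlim : ∀ᵐ p ∂μ, Tendsto (fun r => I r p) (𝓝[>] 0) (𝓝 (g p))) :
    Integrable g μ ∧ ∀ᵐ p ∂μ, ∀ (ρ : ℕ → ℕ → ℝ) (c η : ℝ), η < 1 → 0 ≤ η →
      (∀ n k, k < n → 0 < ρ n k) → (∀ n k, k < n → ρ n k ≤ c * η ^ (n - k)) →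
      Tendsto (fun n : ℕ => (∑ k ∈ Finset.range n, I (ρ n k) (T^[k] p)) / n) atTop
        (𝓝 (∫ p, g p ∂μ)) := by
  have hgF : ∀ᵐ p ∂μ, |g p| ≤ F p := by
    filter_upwards [hIF, hlim] with p h1 h2
    refine le_of_tendsto h2.abs ?_
    filter_upwards [self_mem_nhdsWithin] with r hr using h1 r hr
  have hgi : Integrable g μ := hFi.mono' hg.aestronglyMeasurable hgF
  refine ⟨hgi, ?_⟩
  -- the oscillation over the radii below `1 / (N + 1)`
  set E : ℕ → Ω → ℝ≥0∞ := fun N p =>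
    ⨆ r : {r : ℚ // 0 < (r : ℝ) ∧ (r : ℝ) < 1 / ((N : ℝ) + 1)},
      ENNReal.ofReal |I (r.1 : ℝ) p - g p| with hE
  have hEm : ∀ N, Measurable (E N) := fun N =>
    .iSup fun r => (((hIm _ r.2.1).sub hg).abs).ennreal_ofReal
  have hEle : ∀ᵐ p ∂μ, ∀ N, E N p ≤ ENNReal.ofReal (2 * F p) := by
    filter_upwards [hIF, hgF] with p h1 h2 N
    refine iSup_le fun r => ENNReal.ofReal_le_ofReal ?_
    have h3 := h1 _ r.2.1
    rw [abs_le] at h2 h3 ⊢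
    constructor <;> linarith [h2.1, h2.2, h3.1, h3.2]
  have hfin : ∫⁻ p, ENNReal.ofReal (2 * F p) ∂μ ≠ ⊤ := by
    have := (hFi.const_mul 2).hasFiniteIntegral
    refine ne_of_lt (lt_of_le_of_lt (lintegral_mono fun p => ?_) this)
    exact Real.ofReal_le_enorm _
  have hEzero : ∀ᵐ p ∂μ, Tendsto (fun N => E N p) atTop (𝓝 0) := by
    filter_upwards [hlim] with p hp
    rw [ENNReal.tendsto_nhds_zero]
    intro ε hε
    rcases eq_or_ne ε ⊤ with rfl | hεt
    · exact Eventually.of_forall fun _ => le_top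
    have hε' : 0 < ε.toReal := ENNReal.toReal_pos hε.ne' hεt
    have := (Metric.tendsto_nhds.1 hp) ε.toReal hε'
    rw [eventually_nhdsWithin_iff, Metric.eventually_nhds_iff] at this
    obtain ⟨δ, hδ, hδ'⟩ := this
    obtain ⟨N, hN⟩ := exists_nat_one_div_lt hδ
    filter_upwards [eventually_ge_atTop N] with n hn
    refine iSup_le fun r => ?_
    rw [← ENNReal.ofReal_toReal hεt]
    refine ENNReal.ofReal_le_ofReal ?_
    have hr : (r.1 : ℝ) < δ := by
      refine r.2.2.trans_le (le_trans ?_ hN.le)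
      gcongr
    have := hδ' (y := (r.1 : ℝ)) (by rw [Real.dist_0_eq_abs, abs_of_pos r.2.1]; exact hr) r.2.1
    rw [Real.dist_eq] at this
    exact this.le
  have hElim : Tendsto (fun N => ∫⁻ p, E N p ∂μ) atTop (𝓝 0) := by
    have := tendsto_lintegral_of_dominated_convergence (μ := μ) (F := E) (f := fun _ => 0)
      (fun p => ENNReal.ofReal (2 * F p)) hEm
      (fun N => hEle.mono fun p hp => hp N) hfin hEzero
    simpa using this
  have hEfin : ∀ N, ∫⁻ p, E N p ∂μ ≠ ⊤ := fun N =>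
    ne_top_of_le_ne_top hfin (lintegral_mono_ae (hEle.mono fun p hp => hp N))
  set e : ℕ → Ω → ℝ := fun N p => (E N p).toReal with he
  have hei : ∀ N, Integrable (e N) μ := fun N =>
    integrable_toReal_of_lintegral_ne_top (hEm N).aemeasurable (hEfin N)
  have heint : ∀ N, ∫ p, e N p ∂μ = (∫⁻ p, E N p ∂μ).toReal := fun N =>
    integral_toReal (hEm N).aemeasurable (hEle.mono fun p hp => (hp N).trans_lt ENNReal.ofReal_lt_top)
  have helim : Tendsto (fun N => ∫ p, e N p ∂μ) atTop (𝓝 0) := by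
    simp_rw [heint]
    exact (ENNReal.tendsto_toReal ENNReal.zero_ne_top).comp hElim
  -- the pointwise bounds hold along almost every orbit
  have horb : ∀ᵐ p ∂μ, ∀ k : ℕ,
      (∀ N : ℕ, ∀ r > 0, r < 1 / ((N : ℝ) + 1) → |I r (T^[k] p) - g (T^[k] p)| ≤ e N (T^[k] p)) ∧
      (∀ r > 0, |I r (T^[k] p) - g (T^[k] p)| ≤ 2 * F (T^[k] p)) := by
    refine ae_all_iff.2 fun k => ?_
    refine (hT.toMeasurePreserving.iterate k).quasiMeasurePreserving.ae
      (p := fun p => (∀ N : ℕ, ∀ r > 0, r < 1 / ((N : ℝ) + 1) → |I r p - g p| ≤ e N p) ∧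
      (∀ r > 0, |I r p - g p| ≤ 2 * F p)) ?_
    filter_upwards [hIc, hIF, hgF, hEle] with p h1 h2 h3 h4
    refine ⟨fun N r hr hrN => ?_, fun r hr => ?_⟩
    · refine forall_pos_le_of_forall_rat (h := fun r => |I r p - g p|)
        (fun r hr => ((h1 r hr).sub continuousWithinAt_const).abs) (fun r' hr' hr'N => ?_) r hr hrN
      have h5 : ENNReal.ofReal |I r' p - g p| ≤ E N p :=
        le_iSup (fun r : {r : ℚ // 0 < (r : ℝ) ∧ (r : ℝ) < 1 / ((N : ℝ) + 1)} =>
          ENNReal.ofReal |I (r.1 : ℝ) p - g p|) ⟨r', hr', hr'N⟩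
      have h6 : E N p ≠ ⊤ := ((h4 N).trans_lt ENNReal.ofReal_lt_top).ne
      exact (ENNReal.ofReal_le_iff_le_toReal h6).1 h5
    · have h5 := h2 r hr
      rw [abs_le] at h3 h5 ⊢
      constructor <;> linarith [h3.1, h3.2, h5.1, h5.2]
  filter_upwards [horb, ae_tendsto_birkhoffSum_div hT hgi, ae_tendsto_birkhoffSum_div hT hFi,
    ae_all_iff.2 fun j : ℕ => (hT.toMeasurePreserving.iterate j).quasiMeasurePreserving.ae
      (p := fun p => 0 ≤ F p) (hgF.mono fun p hp => (abs_nonneg _).trans hp),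
    ae_all_iff.2 fun N => ae_tendsto_birkhoffSum_div hT (hei N)]
    with p hp hgp hFp hF0 hep ρ c η hη hη0 hρ0 hρ
  suffices h : Tendsto (fun n : ℕ => (∑ k ∈ Finset.range n,
      (I (ρ n k) (T^[k] p) - g (T^[k] p))) / n) atTop (𝓝 0) by
    have := h.add hgp
    rw [zero_add] at this
    refine this.congr fun n => ?_
    rw [Finset.sum_sub_distrib, birkhoffSum]
    ring
  rw [Metric.tendsto_nhds]
  intro ε hε
  obtain ⟨N, hN⟩ := ((helim.eventually (gt_mem_nhds (half_pos hε)))).exists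
  have hpow : Tendsto (fun j : ℕ => c * η ^ j) atTop (𝓝 0) := by
    simpa using (tendsto_pow_atTop_nhds_zero_of_lt_one hη0 hη).const_mul c
  obtain ⟨J, hJ⟩ := (eventually_atTop.1 (hpow.eventually (gt_mem_nhds
    (show (0 : ℝ) < 1 / ((N : ℝ) + 1) by positivity))))
  have htail : Tendsto (fun n : ℕ => 2 * (birkhoffSum T F n p / n -
      birkhoffSum T F (n - J) p / ((n - J : ℕ) : ℝ) * (((n - J : ℕ) : ℝ) / n))) atTop
      (𝓝 (2 * (∫ p, F p ∂μ - (∫ p, F p ∂μ) * 1))) := by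
    refine (hFp.sub ((hFp.comp (tendsto_sub_atTop_nat J)).mul ?_)).const_mul 2
    have : Tendsto (fun n : ℕ => 1 - (J : ℝ) * (1 / (n : ℝ))) atTop (𝓝 (1 - J * 0)) :=
      tendsto_const_nhds.sub (tendsto_one_div_atTop_nhds_zero_nat.const_mul _)
    rw [mul_zero, sub_zero] at this
    refine this.congr' ?_
    filter_upwards [eventually_gt_atTop J] with n hn
    have hn0 : (n : ℝ) ≠ 0 := by
      have : 0 < n := by omega
      positivity
    rw [Nat.cast_sub hn.le]
    field_simp
  rw [mul_one, sub_self, mul_zero] at htail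
  have hsum := (hep N).add htail
  rw [add_zero] at hsum
  filter_upwards [hsum.eventually (gt_mem_nhds (hN.trans (half_lt_self hε))),
    eventually_gt_atTop J] with n hn hnJ
  have hn0 : (0 : ℝ) < n := by
    have : 0 < n := by omega
    positivity
  have hnJ0 : ((n - J : ℕ) : ℝ) ≠ 0 := by
    have : 0 < n - J := by omega
    positivity
  rw [div_mul_div_cancel₀ hnJ0] at hn
  rw [Real.dist_0_eq_abs, abs_div, abs_of_pos hn0]
  refine lt_of_le_of_lt ?_ hn
  have hsplit : birkhoffSum T F n p - birkhoffSum T F (n - J) p =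
      ∑ k ∈ Finset.range n, if n - J ≤ k then F (T^[k] p) else 0 := by
    simp only [birkhoffSum]
    have h1 : (Finset.range n).filter (fun k => ¬ n - J ≤ k) = Finset.range (n - J) := by
      ext k; simp; omega
    rw [← Finset.sum_filter_add_sum_filter_not (Finset.range n) (fun k => n - J ≤ k) (fun k => F (T^[k] p)), h1,
      add_sub_cancel_right, Finset.sum_filter]
  have : |∑ k ∈ Finset.range n, (I (ρ n k) (T^[k] p) - g (T^[k] p))| ≤
      birkhoffSum T (e N) n p + 2 * (birkhoffSum T F n p - birkhoffSum T F (n - J) p) := by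
    refine (Finset.abs_sum_le_sum_abs _ _).trans ?_
    rw [hsplit, birkhoffSum, Finset.mul_sum, ← Finset.sum_add_distrib]
    refine Finset.sum_le_sum fun k hk => ?_
    have hkn := Finset.mem_range.1 hk
    split_ifs with hkJ
    · have := (hp k).2 _ (hρ0 n k hkn)
      have h0 : 0 ≤ e N (T^[k] p) := ENNReal.toReal_nonneg
      linarith
    · have := (hp k).1 N _ (hρ0 n k hkn) ((hρ n k hkn).trans_lt (hJ (n - k) (by omega)))
      linarith
  calc _ ≤ (birkhoffSum T (e N) n p + 2 * (birkhoffSum T F n p - birkhoffSum T F (n - J) p)) / n := by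
        gcongr
    _ = _ := by ring

end Ergodic

/-! ### Images of balls under injective conformal maps -/

section Polar

variable {V : Type*} [NormedAddCommGroup V] [NormedSpace ℝ V] [FiniteDimensional ℝ V]
  [MeasurableSpace V] [BorelSpace V] (ν : Measure V) [ν.IsAddHaarMeasure]

/-- Integration in polar coordinates. -/
theorem lintegral_eq_lintegral_sphere [Nontrivial V] {f : V → ℝ≥0∞} (hf : Measurable f) :
    ∫⁻ x, f x ∂ν = ∫⁻ u : Metric.sphere (0 : V) 1, (∫⁻ t in Ioi (0 : ℝ),
      ENNReal.ofReal (t ^ (Module.finrank ℝ V - 1)) * f (t • (u : V))) ∂ν.toSphere := by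
  have h0 : MeasurableSet ({0}ᶜ : Set V) := (measurableSet_singleton _).compl
  have hmp := (ν.measurePreserving_homeomorphUnitSphereProd).symm
    (homeomorphUnitSphereProd V).toMeasurableEquiv
  have h1 : ∫⁻ x, f x ∂ν = ∫⁻ x : ({0}ᶜ : Set V), f x ∂(ν.comap (↑)) := by
    rw [lintegral_subtype_comap h0, restrict_compl_singleton]
  have hsm : Measurable fun p : Metric.sphere (0 : V) 1 × Ioi (0 : ℝ) =>
      f ((p.2 : ℝ) • (p.1 : V)) :=
    hf.comp ((measurable_subtype_coe.comp measurable_snd).smul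
      (measurable_subtype_coe.comp measurable_fst))
  have h2 : ∫⁻ x : ({0}ᶜ : Set V), f x ∂(ν.comap (↑)) =
      ∫⁻ p, f ((p.2 : ℝ) • (p.1 : V))
        ∂(ν.toSphere.prod (Measure.volumeIoiPow (Module.finrank ℝ V - 1))) := by
    exact (hmp.lintegral_comp (f := fun x : ({0}ᶜ : Set V) => f x)
      (hf.comp measurable_subtype_coe)).symm
  rw [h1, h2, lintegral_prod _ hsm.aemeasurable]
  refine lintegral_congr fun u => ?_
  have hsu : Measurable fun t : Ioi (0 : ℝ) => f ((t : ℝ) • (u : V)) :=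
    hsm.comp measurable_prodMk_left
  rw [Measure.volumeIoiPow, lintegral_withDensity_eq_lintegral_mul _
    ((measurable_subtype_coe.pow_const _).ennreal_ofReal) hsu]
  exact lintegral_subtype_comap measurableSet_Ioi
    (fun t : ℝ => ENNReal.ofReal (t ^ (Module.finrank ℝ V - 1)) * f (t • (u : V)))

theorem lintegral_Ioo_inv {α β : ℝ} (hα : 0 < α) (hαβ : α ≤ β) :
    ∫⁻ t in Ioo α β, ENNReal.ofReal t⁻¹ = ENNReal.ofReal (Real.log (β / α)) := by
  rw [← integral_inv_of_pos hα (hα.trans_le hαβ), intervalIntegral.integral_of_le hαβ,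
    integral_Ioc_eq_integral_Ioo, ofReal_integral_eq_lintegral_ofReal]
  · refine IntegrableOn.mono_set ?_ Ioo_subset_Icc_self
    refine ContinuousOn.integrableOn_Icc (continuousOn_id.inv₀ fun t ht => ?_)
    exact (hα.trans_le ht.1).ne'
  · filter_upwards [ae_restrict_mem measurableSet_Ioo] with t ht
    exact (inv_pos.2 (hα.trans ht.1)).le

/-- The integral of `‖x‖⁻ⁿ` over a spherical shell in dimension `n`. -/
theorem lintegral_shell_inv_pow [Nontrivial V] {α β : ℝ} (hα : 0 < α) (hαβ : α ≤ β) :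
    ∫⁻ x in {x : V | α < ‖x‖ ∧ ‖x‖ < β}, ENNReal.ofReal ((‖x‖ ^ Module.finrank ℝ V)⁻¹) ∂ν =
      ν.toSphere univ * ENNReal.ofReal (Real.log (β / α)) := by
  have hs : MeasurableSet {x : V | α < ‖x‖ ∧ ‖x‖ < β} :=
    (measurableSet_lt measurable_const measurable_norm).inter
      (measurableSet_lt measurable_norm measurable_const)
  have hfm : Measurable fun x : V => ENNReal.ofReal ((‖x‖ ^ Module.finrank ℝ V)⁻¹) :=
    (measurable_norm.pow_const _).inv.ennreal_ofReal
  rw [← lintegral_indicator hs, lintegral_eq_lintegral_sphere ν (hfm.indicator hs)]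
  rw [← lintegral_Ioo_inv hα hαβ, mul_comm, ← lintegral_const]
  refine lintegral_congr fun u => ?_
  have hu : ‖(u : V)‖ = 1 := by simp
  rw [← lintegral_indicator measurableSet_Ioi, ← lintegral_indicator measurableSet_Ioo]
  refine lintegral_congr fun t => ?_
  have hn : 0 < Module.finrank ℝ V := Module.finrank_pos
  by_cases ht : t ∈ Ioo α β
  · have ht0 : 0 < t := hα.trans ht.1
    have hnorm : ‖t • (u : V)‖ = t := by rw [norm_smul, hu, mul_one, Real.norm_of_nonneg ht0.le]
    rw [indicator_of_mem ht, indicator_of_mem (show t ∈ Ioi (0 : ℝ) from ht0),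
      indicator_of_mem (show t • (u : V) ∈ {x : V | α < ‖x‖ ∧ ‖x‖ < β} from
        ⟨hnorm.symm ▸ ht.1, hnorm.symm ▸ ht.2⟩), hnorm,
      ← ENNReal.ofReal_mul (by positivity)]
    congr 1
    obtain ⟨k, hk⟩ := Nat.exists_eq_succ_of_ne_zero hn.ne'
    rw [hk, Nat.succ_eq_add_one, Nat.add_sub_cancel, pow_succ]
    field_simp
  · rw [indicator_of_notMem ht]
    by_cases ht0 : t ∈ Ioi (0 : ℝ)
    · have hnorm : ‖t • (u : V)‖ = t := by
        rw [norm_smul, hu, mul_one, Real.norm_of_nonneg (le_of_lt ht0)]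
      rw [indicator_of_mem ht0, indicator_of_notMem
        (show t • (u : V) ∉ {x : V | α < ‖x‖ ∧ ‖x‖ < β} from
        fun h => ht ⟨hnorm ▸ h.1, hnorm ▸ h.2⟩),
        mul_zero]
    · rw [indicator_of_notMem ht0]

end Polar

section Ray

variable {V : Type*} [NormedAddCommGroup V] [InnerProductSpace ℝ V]

/-- Along a ray that leaves the open set `O`, the increment of `log ‖ψ‖` up to the first exit is
at most the integral over the ray of its speed. -/
theorem ofReal_log_sub_log_le_lintegral_ray {ψ : V → V} {ψ' : V → V →L[ℝ] V} {d : V → ℝ}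
    {U O C : Set V} (hO : IsOpen O) (hC : IsClosed C) (hOC : O ⊆ C) (hCU : C ⊆ U) {r' : ℝ}
    (hr' : 0 < r') (hψ : ∀ w ∈ U, HasFDerivAt ψ (ψ' w) w) (hψ0 : ∀ w ∈ U, w ≠ 0 → ψ w ≠ 0)
    (hd : ∀ w ∈ U, ∀ v, ‖ψ' w v‖ ≤ d w * ‖v‖) (hdc : ContinuousOn d U)
    (hψO : ∀ w ∈ U, w ∉ O → r' ≤ ‖ψ w‖) {u : V} (hu : ‖u‖ = 1) {ρ R : ℝ} (hρ : 0 < ρ)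
    (hρR : ρ ≤ R) (hρU : ρ • u ∈ U) (hRO : R • u ∉ O) :
    ENNReal.ofReal (Real.log r' - Real.log ‖ψ (ρ • u)‖) ≤
      ∫⁻ t in Ioi ρ, {t : ℝ | t • u ∈ U}.indicator
        (fun t => ENNReal.ofReal (d (t • u) / ‖ψ (t • u)‖)) t := by
  have hline : Continuous fun t : ℝ => t • u := continuous_id.smul continuous_const
  have hu0 : u ≠ 0 := by rintro rfl; simp at hu
  -- the first exit time
  obtain ⟨t₁, ht₁, ht₁O, hmin⟩ : ∃ t₁, ρ ≤ t₁ ∧ t₁ • u ∉ O ∧ ∀ t, ρ ≤ t → t < t₁ → t • u ∈ O := by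
    have hcl : IsClosed (Ici ρ ∩ (fun t : ℝ => t • u) ⁻¹' Oᶜ) :=
      isClosed_Ici.inter (hO.isClosed_compl.preimage hline)
    have hne : (Ici ρ ∩ (fun t : ℝ => t • u) ⁻¹' Oᶜ).Nonempty := ⟨R, hρR, hRO⟩
    have hbd : BddBelow (Ici ρ ∩ (fun t : ℝ => t • u) ⁻¹' Oᶜ) := ⟨ρ, fun t ht => ht.1⟩
    have hmem := hcl.csInf_mem hne hbd
    refine ⟨_, hmem.1, hmem.2, fun t ht ht' => ?_⟩
    by_contra hcon
    exact absurd (csInf_le hbd ⟨ht, hcon⟩) (not_le.2 ht')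
  have hIcc : ∀ t ∈ Icc ρ t₁, t • u ∈ U := by
    intro t ht
    rcases ht.2.lt_or_eq with h | rfl
    · exact hCU (hOC (hmin t ht.1 h))
    · rcases ht.1.lt_or_eq with h | rfl
      · refine hCU ?_
        have : Tendsto (fun s : ℝ => s • u) (𝓝[<] t) (𝓝 (t • u)) :=
          (hline.tendsto t).mono_left nhdsWithin_le_nhds
        refine hC.mem_of_tendsto this ?_
        filter_upwards [Ioo_mem_nhdsLT h] with s hs using hOC (hmin s hs.1.le hs.2)
      · exact hρU
  have hne0 : ∀ t ∈ Icc ρ t₁, ψ (t • u) ≠ 0 := fun t ht =>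
    hψ0 _ (hIcc t ht) (smul_ne_zero (hρ.trans_le ht.1).ne' hu0)
  have hderiv : ∀ t ∈ Icc ρ t₁, HasDerivAt (fun t : ℝ => ψ (t • u)) (ψ' (t • u) u) t := by
    intro t ht
    have h1 : HasDerivAt (fun t : ℝ => t • u) ((1 : ℝ) • u) t := (hasDerivAt_id t).smul_const u
    rw [one_smul] at h1
    exact (hψ _ (hIcc t ht)).comp_hasDerivAt t h1
  have hcont : ContinuousOn (fun t : ℝ => ψ (t • u)) (Icc ρ t₁) := fun t ht =>
    (hderiv t ht).continuousAt.continuousWithinAt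
  have hcd : ContinuousOn (fun t : ℝ => d (t • u) / ‖ψ (t • u)‖) (Icc ρ t₁) :=
    (hdc.comp hline.continuousOn hIcc).div hcont.norm fun t ht => norm_ne_zero_iff.2 (hne0 t ht)
  have hlog : ∀ t ∈ Icc ρ t₁, HasDerivAt (fun t : ℝ => (1 / 2) * Real.log (‖ψ (t • u)‖ ^ 2))
      ((1 / 2) * ((2 * inner ℝ (ψ (t • u)) (ψ' (t • u) u)) / ‖ψ (t • u)‖ ^ 2)) t := fun t ht =>
    (((hderiv t ht).norm_sq).log (pow_ne_zero 2 (norm_ne_zero_iff.2 (hne0 t ht)))).const_mul _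
  have hftc := intervalIntegral.sub_le_integral_of_hasDeriv_right_of_le ht₁
    (fun t ht => (hlog t ht).continuousAt.continuousWithinAt)
    (fun t ht => (hlog t (Ioo_subset_Icc_self ht)).hasDerivWithinAt) hcd.integrableOn_Icc
    (fun t ht => by
      have ht' := Ioo_subset_Icc_self ht
      have hpos : 0 < ‖ψ (t • u)‖ := norm_pos_iff.2 (hne0 t ht')
      have h1 := real_inner_le_norm (ψ (t • u)) (ψ' (t • u) u)
      have h2 := hd _ (hIcc t ht') u
      rw [hu, mul_one] at h2
      have h3 : inner ℝ (ψ (t • u)) (ψ' (t • u) u) ≤ ‖ψ (t • u)‖ * d (t • u) :=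
        h1.trans (by gcongr)
      rw [show (1 / 2 : ℝ) * ((2 * inner ℝ (ψ (t • u)) (ψ' (t • u) u)) / ‖ψ (t • u)‖ ^ 2) =
        inner ℝ (ψ (t • u)) (ψ' (t • u) u) / ‖ψ (t • u)‖ ^ 2 by ring, div_le_div_iff₀ (by positivity) hpos]
      calc _ ≤ ‖ψ (t • u)‖ * d (t • u) * ‖ψ (t • u)‖ := by gcongr
        _ = _ := by ring)
  have hhalf : ∀ t : ℝ, (1 / 2 : ℝ) * Real.log (‖ψ (t • u)‖ ^ 2) = Real.log ‖ψ (t • u)‖ := fun t => by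
    rw [Real.log_pow]; push_cast; ring
  rw [hhalf, hhalf] at hftc
  have hr't : Real.log r' ≤ Real.log ‖ψ (t₁ • u)‖ :=
    Real.log_le_log hr' (hψO _ (hIcc t₁ ⟨ht₁, le_rfl⟩) ht₁O)
  calc ENNReal.ofReal (Real.log r' - Real.log ‖ψ (ρ • u)‖)
      ≤ ENNReal.ofReal (∫ t in ρ..t₁, d (t • u) / ‖ψ (t • u)‖) :=
        ENNReal.ofReal_le_ofReal (by linarith)
    _ ≤ ∫⁻ t in Ioc ρ t₁, ENNReal.ofReal (d (t • u) / ‖ψ (t • u)‖) := by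
        rw [intervalIntegral.integral_of_le ht₁]
        by_cases hint : IntegrableOn (fun t => d (t • u) / ‖ψ (t • u)‖) (Ioc ρ t₁)
        · rw [ofReal_integral_eq_lintegral_ofReal hint]
          filter_upwards [ae_restrict_mem measurableSet_Ioc] with t ht
          have h2 := (norm_nonneg _).trans (hd _ (hIcc t (Ioc_subset_Icc_self ht)) u)
          rw [hu, mul_one] at h2
          exact div_nonneg h2 (norm_nonneg _)
        · rw [integral_undef hint, ENNReal.ofReal_zero]; exact zero_le
    _ ≤ _ := by
        rw [← lintegral_indicator measurableSet_Ioc, ← lintegral_indicator measurableSet_Ioi]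
        refine lintegral_mono fun t => ?_
        by_cases ht : t ∈ Ioc ρ t₁
        · rw [indicator_of_mem ht, indicator_of_mem (show t ∈ Ioi ρ from ht.1),
            indicator_of_mem (show t ∈ {t : ℝ | t • u ∈ U} from hIcc t (Ioc_subset_Icc_self ht))]
        · rw [indicator_of_notMem ht]; exact zero_le

end Ray

section Volume

variable {V : Type*} [NormedAddCommGroup V] [InnerProductSpace ℝ V]

theorem HasFDerivAt.exists_norm_le_mul_norm {f : V → V} {f' : V →L[ℝ] V} (hf : HasFDerivAt f f' 0)
    (hf0 : f 0 = 0) {A B : ℝ} (hA : ∀ v, ‖f' v‖ ≤ A * ‖v‖) (hAB : A < B) :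
    ∃ δ > 0, ∀ x, ‖x‖ < δ → ‖f x‖ ≤ B * ‖x‖ := by
  have h := hf.isLittleO.bound (sub_pos.2 hAB)
  obtain ⟨δ, hδ, h⟩ := Metric.eventually_nhds_iff.1 h
  refine ⟨δ, hδ, fun x hx => ?_⟩
  have h1 := h (y := x) (by simpa using hx)
  simp only [hf0, sub_zero] at h1
  have h2 := norm_le_norm_sub_add (f x) (f' x)
  linarith [hA x]

variable [FiniteDimensional ℝ V] [MeasurableSpace V] [BorelSpace V]

/-- The determinant is the volume scaling of a map that sends the unit ball into the ball of radius
`‖A‖`. -/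
theorem ofReal_abs_det_le_norm_pow [Nontrivial V] (ν : Measure V) [ν.IsAddHaarMeasure]
    (A : V →L[ℝ] V) :
    ENNReal.ofReal |A.det| ≤ ENNReal.ofReal (‖A‖ ^ Module.finrank ℝ V) := by
  have h1 := Measure.addHaar_image_continuousLinearMap ν A (Metric.closedBall 0 1)
  have h2 : A '' Metric.closedBall 0 1 ⊆ Metric.closedBall 0 ‖A‖ := by
    rintro _ ⟨x, hx, rfl⟩
    rw [mem_closedBall_zero_iff] at hx ⊢
    exact (A.le_opNorm x).trans (mul_le_of_le_one_right (norm_nonneg _) hx)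
  have h3 := measure_mono (μ := ν) h2
  rw [h1, Measure.addHaar_closedBall' _ _ (norm_nonneg _)] at h3
  exact (ENNReal.mul_le_mul_iff_left (Metric.measure_closedBall_pos ν _ one_pos).ne'
    measure_closedBall_lt_top.ne).1 h3

/-- Young's inequality for the conformally invariant energy along a ray. -/
theorem natCast_mul_le_pow_mul_pow_add {n : ℕ} (hn : 1 ≤ n) {h t : ℝ} (hh : 0 ≤ h) (ht : 0 < t) :
    (n : ℝ) * h ≤ t ^ (n - 1) * (h ^ n + (n - 1) * (t ^ n)⁻¹) := by
  obtain ⟨k, rfl⟩ := Nat.exists_eq_succ_of_ne_zero (by omega : n ≠ 0)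
  have h1 := one_add_mul_le_pow (show (-2 : ℝ) ≤ h * t - 1 by nlinarith [mul_nonneg hh ht.le]) (k + 1)
  rw [add_sub_cancel, mul_pow] at h1
  simp only [Nat.succ_eq_add_one, Nat.add_sub_cancel]
  push_cast at h1 ⊢
  have h2 : t * (t ^ k * (h ^ (k + 1) + ((k : ℝ) + 1 - 1) * (t ^ (k + 1))⁻¹)) =
      h ^ (k + 1) * t ^ (k + 1) + k := by
    rw [pow_succ t]; field_simp; ring
  refine le_of_mul_le_mul_left ?_ ht
  rw [h2]
  linarith

/-- The volume estimate for the image of a ball, up to an error `η`: the centres are moved to the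
origin, and the rays start at a small distance from it, where the inverse map is nearly linear. -/
theorem measure_ball_diff_image_ball_le_add (ν : Measure V) [ν.IsAddHaarMeasure]
    (hn : 2 ≤ Module.finrank ℝ V) {φ : V → V} {φ' : V → V →L[ℝ] V} {r K a : ℝ}
    (hr : 0 < r) (hK : 1 ≤ K) (ha : 0 < a)
    (hφ : ∀ x ∈ Metric.ball (0 : V) r, HasStrictFDerivAt φ (φ' x) x)
    (hφc : ContinuousOn φ' (Metric.ball 0 r))
    (hconf : ∀ x ∈ Metric.ball (0 : V) r, ∀ v, ‖φ' x v‖ = ‖φ' x‖ * ‖v‖)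
    (hpos : ∀ x ∈ Metric.ball (0 : V) r, 0 < ‖φ' x‖)
    (hinj : InjOn φ (Metric.ball 0 r)) (h0 : φ 0 = 0) (ha0 : ‖φ' 0‖ = a)
    (hKa : ∀ x ∈ Metric.ball (0 : V) r, ‖φ' x‖ ≤ K * a) {η : ℝ} (hη : 0 < η) :
    ν.real (Metric.ball 0 (K * a * r) \ φ '' Metric.ball 0 r) ≤
      (K * a * r) ^ Module.finrank ℝ V * ν.toSphere.real univ * (Real.log K + 5 * η) := by
  set n := Module.finrank ℝ V with hn_def
  have : Nontrivial V := Module.nontrivial_of_finrank_pos (R := ℝ) (by omega)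
  set B := Metric.ball (0 : V) r with hB
  set U := φ '' B with hU
  set R := K * a * r with hR
  have hKpos : 0 < K := one_pos.trans_le hK
  have hRpos : 0 < R := by positivity
  have h0B : (0 : V) ∈ B := Metric.mem_ball_self hr
  -- the derivatives are invertible
  have hL : ∀ x, ∃ L : V ≃L[ℝ] V, x ∈ B → (L : V →L[ℝ] V) = φ' x := by
    intro x
    by_cases hx : x ∈ B
    · have hi : Function.Injective (φ' x : V →ₗ[ℝ] V) := by
        refine (injective_iff_map_eq_zero _).2 fun v hv => ?_
        have h1 := hconf x hx v
        have hv' : φ' x v = 0 := hv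
        rw [hv', norm_zero, eq_comm, mul_eq_zero] at h1
        exact norm_eq_zero.1 (h1.resolve_left (hpos x hx).ne')
      exact ⟨(LinearEquiv.ofInjectiveEndo _ hi).toContinuousLinearEquiv, fun _ => by ext v; rfl⟩
    · exact ⟨ContinuousLinearEquiv.refl ℝ V, fun h => absurd h hx⟩
  choose L hL using hL
  have hφL : ∀ x ∈ B, HasStrictFDerivAt φ (L x : V →L[ℝ] V) x := fun x hx => by
    rw [hL x hx]; exact hφ x hx
  have hopen : ∀ s ⊆ B, IsOpen s → IsOpen (φ '' s) := by
    intro s hs hso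
    rw [isOpen_iff_mem_nhds]
    rintro _ ⟨x, hx, rfl⟩
    rw [← (hφL x (hs hx)).map_nhds_eq_of_equiv]
    exact image_mem_map (hso.mem_nhds hx)
  have hUo : IsOpen U := hopen B subset_rfl Metric.isOpen_ball
  -- the inverse map
  set ψ : V → V := Function.invFunOn φ B with hψdef
  have hψφ : ∀ x ∈ B, ψ (φ x) = x := hinj.leftInvOn_invFunOn
  have hψ : ∀ w ∈ U, HasFDerivAt ψ ((L (ψ w)).symm : V →L[ℝ] V) w := by
    rintro _ ⟨x, hx, rfl⟩
    rw [hψφ x hx]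
    refine ((hφL x hx).to_local_left_inverse ?_).hasFDerivAt
    filter_upwards [Metric.isOpen_ball.mem_nhds hx] with y hy using hψφ y hy
  have hψc : ContinuousOn ψ U := fun w hw => (hψ w hw).continuousAt.continuousWithinAt
  have hψB : ∀ w ∈ U, ψ w ∈ B ∧ φ (ψ w) = w := by
    rintro _ ⟨x, hx, rfl⟩
    rw [hψφ x hx]
    exact ⟨hx, rfl⟩
  have hsymm : ∀ x ∈ B, ∀ v, ‖(L x).symm v‖ ≤ ‖φ' x‖⁻¹ * ‖v‖ := by
    intro x hx v
    have h1 : φ' x ((L x).symm v) = v := by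
      rw [← hL x hx]; exact (L x).apply_symm_apply v
    have h2 := hconf x hx ((L x).symm v)
    rw [h1] at h2
    rw [h2, inv_mul_cancel_left₀ (hpos x hx).ne']
  set d : V → ℝ := fun w => ‖φ' (ψ w)‖⁻¹ with hd
  have hdc : ContinuousOn d U :=
    ((hφc.comp hψc fun w hw => (hψB w hw).1).norm).inv₀ fun w hw => (hpos _ (hψB w hw).1).ne'
  have hψ00 : ψ 0 = 0 := by
    have := hψφ 0 h0B
    rwa [h0] at this
  have h0U : (0 : V) ∈ U := ⟨0, h0B, h0⟩
  have hψne : ∀ w ∈ U, w ≠ 0 → ψ w ≠ 0 := by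
    intro w hw hw0 hcon
    have := (hψB w hw).2
    rw [hcon, h0] at this
    exact hw0 this.symm
  have hφle : ∀ x ∈ B, ‖φ x‖ ≤ K * a * ‖x‖ := by
    intro x hx
    have := Convex.norm_image_sub_le_of_norm_hasFDerivWithin_le (f := φ) (f' := φ') (C := K * a)
      (fun y hy => (hφ y hy).hasFDerivAt.hasFDerivWithinAt) hKa (convex_ball (0 : V) r) h0B hx
    simpa [h0] using this
  have hUR : U ⊆ Metric.ball 0 R := by
    rintro _ ⟨x, hx, rfl⟩
    rw [mem_ball_zero_iff]
    refine (hφle x hx).trans_lt ?_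
    have : ‖x‖ < r := by simpa [hB] using hx
    exact mul_lt_mul_of_pos_left this (by positivity)
  -- the inner radius
  have hexp : 1 < Real.exp η := Real.one_lt_exp_iff.2 hη
  obtain ⟨δ, hδ, hδφ⟩ := (hφ 0 h0B).hasFDerivAt.exists_norm_le_mul_norm h0
    (fun v => (hconf 0 h0B v).le) (B := Real.exp η * a) (by rw [ha0]; nlinarith)
  have hψ0' := hψ 0 h0U
  obtain ⟨δ', hδ', hδψ⟩ := hψ0'.exists_norm_le_mul_norm hψ00 (A := a⁻¹) (B := Real.exp η * a⁻¹)
    (fun v => by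
      have := hsymm 0 h0B v
      rw [ha0] at this
      rw [hψ00]; exact this) (by have := inv_pos.2 ha; nlinarith)
  obtain ⟨δ'', hδ'', hδU⟩ := Metric.isOpen_iff.1 hUo 0 h0U
  obtain ⟨ρ, hρ, hρlt⟩ : ∃ ρ > 0, ρ < min (min δ' (Real.exp η * a * δ))
      (min δ'' (min R (Real.exp (-(2 * η)) * (r * a)))) := by
    refine ⟨_, half_pos ?_, half_lt_self ?_⟩ <;> positivity
  simp only [lt_min_iff] at hρlt
  obtain ⟨⟨hρ1, hρ2⟩, hρ3, hρ4, hρ5⟩ := hρlt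
  have hcbU : Metric.closedBall 0 ρ ⊆ U := (Metric.closedBall_subset_ball hρ3).trans hδU
  set Λ := Real.log (r * a / ρ) with hΛ
  have hΛη : 2 * η ≤ Λ := by
    rw [hΛ, Real.le_log_iff_exp_le (by positivity), le_div_iff₀ hρ]
    have : Real.exp (2 * η) * Real.exp (-(2 * η)) = 1 := by rw [← Real.exp_add]; simp
    have h1 := mul_le_mul_of_nonneg_left hρ5.le (Real.exp_pos (2 * η)).le
    calc _ ≤ _ := h1
      _ = (Real.exp (2 * η) * Real.exp (-(2 * η))) * (r * a) := by ring
      _ = _ := by rw [this, one_mul]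
  set W := U \ Metric.closedBall 0 ρ with hW
  have hWo : IsOpen W := hUo.sdiff Metric.isClosed_closedBall
  have hW0 : ∀ w ∈ W, ρ < ‖w‖ := fun w hw => by simpa using hw.2
  have hWψ : ∀ w ∈ W, 0 < ‖ψ w‖ := fun w hw =>
    norm_pos_iff.2 (hψne w hw.1 (norm_pos_iff.1 (hρ.trans (hW0 w hw))))
  set H : V → ℝ≥0∞ := W.indicator fun w => ENNReal.ofReal ((d w / ‖ψ w‖) ^ n) with hH
  set J : V → ℝ≥0∞ := W.indicator fun w => ENNReal.ofReal ((‖w‖ ^ n)⁻¹) with hJ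
  have hHm : Measurable H := by
    classical
    rw [hH, ← piecewise_eq_indicator]
    refine ContinuousOn.measurable_piecewise ?_ continuousOn_const hWo.measurableSet
    refine ENNReal.continuous_ofReal.comp_continuousOn (ContinuousOn.pow ?_ n)
    exact (hdc.mono sdiff_subset).div (hψc.mono sdiff_subset).norm fun w hw => (hWψ w hw).ne'
  have hJm : Measurable J :=
    ((measurable_norm.pow_const _).inv.ennreal_ofReal).indicator hWo.measurableSet
  set σ := ν.toSphere univ with hσ
  have hσtop : σ ≠ ⊤ := measure_ne_top _ _
  -- integrate the inequality along rays over the sphere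
  have hray : ∀ u : Metric.sphere (0 : V) 1, ENNReal.ofReal (n * (Λ - 2 * η)) ≤
      ∫⁻ t in Ioi (0 : ℝ), ENNReal.ofReal (t ^ (n - 1)) *
        (H (t • (u : V)) + ENNReal.ofReal (n - 1) * J (t • (u : V))) := by
    intro u
    have hu : ‖(u : V)‖ = 1 := by simp
    set r' := r * Real.exp (-η) with hr'
    have hr'pos : 0 < r' := by positivity
    have hr'r : r' < r := by
      have : Real.exp (-η) < 1 := Real.exp_lt_one_iff.2 (by linarith)
      nlinarith
    have hsub : Metric.closedBall (0 : V) r' ⊆ B := Metric.closedBall_subset_ball hr'r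
    have hρu : ‖ρ • (u : V)‖ = ρ := by rw [norm_smul, hu, mul_one, Real.norm_of_nonneg hρ.le]
    have hρU : ρ • (u : V) ∈ U := hcbU (by rw [mem_closedBall_zero_iff, hρu])
    have h1 := ofReal_log_sub_log_le_lintegral_ray (ψ := ψ)
      (ψ' := fun w => ((L (ψ w)).symm : V →L[ℝ] V)) (d := d) (U := U)
      (O := φ '' Metric.ball 0 r') (C := φ '' Metric.closedBall 0 r') (r' := r') (R := R)
      (hopen _ (Metric.ball_subset_closedBall.trans hsub) Metric.isOpen_ball)
      ((isCompact_closedBall _ _).image_of_continuousOn fun x hx =>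
        (hφ x (hsub hx)).continuousAt.continuousWithinAt).isClosed
      (image_mono Metric.ball_subset_closedBall) (image_mono hsub) hr'pos hψ hψne
      (fun w hw v => hsymm _ (hψB w hw).1 v) hdc
      (fun w hw hwO => by
        by_contra hcon
        exact hwO ⟨ψ w, by simpa using hcon, (hψB w hw).2⟩)
      hu hρ hρ4.le hρU (fun hcon => by
        have := hUR (image_mono (Metric.ball_subset_closedBall.trans hsub) hcon)
        rw [mem_ball_zero_iff, norm_smul, hu, mul_one, Real.norm_of_nonneg hRpos.le] at this
        exact lt_irrefl _ this)
    have h2 : Λ - 2 * η ≤ Real.log r' - Real.log ‖ψ (ρ • (u : V))‖ := by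
      have h3 : ‖ψ (ρ • (u : V))‖ ≤ Real.exp η * a⁻¹ * ρ := by
        have := hδψ (ρ • (u : V)) (by rw [hρu]; exact hρ1)
        rwa [hρu] at this
      have h4 : 0 < ‖ψ (ρ • (u : V))‖ := by
        refine norm_pos_iff.2 (hψne _ hρU (norm_pos_iff.1 ?_))
        rw [hρu]; exact hρ
      have h5 := Real.log_le_log h4 h3
      rw [Real.log_mul (by positivity) hρ.ne', Real.log_mul (Real.exp_pos _).ne' (by positivity),
        Real.log_exp, Real.log_inv] at h5
      rw [hΛ, hr', Real.log_mul hr.ne' (Real.exp_pos _).ne', Real.log_exp,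
        Real.log_div (by positivity) hρ.ne', Real.log_mul hr.ne' ha.ne']
      linarith
    rw [ENNReal.ofReal_mul (by positivity)]
    refine (mul_le_mul_right ((ENNReal.ofReal_le_ofReal h2).trans h1) _).trans ?_
    rw [← lintegral_const_mul' _ _ ENNReal.ofReal_ne_top]
    refine le_trans ?_ (lintegral_mono_set (Ioi_subset_Ioi hρ.le))
    refine setLIntegral_mono' measurableSet_Ioi fun t ht => ?_
    have ht0 : 0 < t := hρ.trans ht
    have htu : ‖t • (u : V)‖ = t := by rw [norm_smul, hu, mul_one, Real.norm_of_nonneg ht0.le]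
    by_cases htU : t • (u : V) ∈ U
    · have htW : t • (u : V) ∈ W := ⟨htU, by
        rw [mem_closedBall_zero_iff, htu]; exact not_le.2 ht⟩
      have hpos' : 0 ≤ d (t • (u : V)) / ‖ψ (t • (u : V))‖ :=
        div_nonneg (inv_nonneg.2 (norm_nonneg _)) (norm_nonneg _)
      have hn1 : (0 : ℝ) ≤ n - 1 := by
        have : (2 : ℝ) ≤ n := by exact_mod_cast hn
        linarith
      rw [indicator_of_mem (show t ∈ {t : ℝ | t • (u : V) ∈ U} from htU), hH, hJ,
        indicator_of_mem htW, indicator_of_mem htW, htu, ← ENNReal.ofReal_mul (by positivity),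
        ← ENNReal.ofReal_mul hn1, ← ENNReal.ofReal_add (by positivity) (by positivity),
        ← ENNReal.ofReal_mul (by positivity)]
      exact ENNReal.ofReal_le_ofReal (natCast_mul_le_pow_mul_pow_add (by omega) hpos' ht0)
    · rw [indicator_of_notMem (show t ∉ {t : ℝ | t • (u : V) ∈ U} from htU), mul_zero]
      exact zero_le
  have hmain : ENNReal.ofReal (n * (Λ - 2 * η)) * σ ≤
      ∫⁻ w, H w ∂ν + ENNReal.ofReal (n - 1) * ∫⁻ w, J w ∂ν := by
    rw [← lintegral_const_mul _ hJm, ← lintegral_add_left hHm, hσ, ← lintegral_const,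
      lintegral_eq_lintegral_sphere ν (f := fun w => H w + ENNReal.ofReal (n - 1) * J w)
        (hHm.add (hJm.const_mul _))]
    exact lintegral_mono hray
  -- the conformally invariant energy, computed in the source
  have henergy : ∫⁻ w, H w ∂ν ≤ σ * ENNReal.ofReal (Λ + η) := by
    set s := B ∩ φ ⁻¹' (Metric.closedBall 0 ρ)ᶜ with hs
    have hso : IsOpen s := ContinuousOn.isOpen_inter_preimage
      (fun x hx => (hφ x hx).continuousAt.continuousWithinAt) Metric.isOpen_ball
      Metric.isClosed_closedBall.isOpen_compl
    have hWs : W = φ '' s := by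
      rw [hs, image_inter_preimage]; rfl
    set α := Real.exp (-η) * (ρ / a) with hα
    have hαpos : 0 < α := by positivity
    have hexpmul : Real.exp η * Real.exp (-η) = 1 := by rw [← Real.exp_add]; simp
    have hαδ : α < δ := by
      have h1 : ρ / a < Real.exp η * δ := by rw [div_lt_iff₀ ha]; linarith
      calc α < Real.exp (-η) * (Real.exp η * δ) := by rw [hα]; gcongr
        _ = (Real.exp η * Real.exp (-η)) * δ := by ring
        _ = δ := by rw [hexpmul, one_mul]
    have hsα : s ⊆ {x : V | α < ‖x‖ ∧ ‖x‖ < r} := by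
      rintro x ⟨hxB, hx⟩
      refine ⟨?_, by simpa [hB] using hxB⟩
      by_contra! hcon
      refine hx ?_
      rw [mem_closedBall_zero_iff]
      calc ‖φ x‖ ≤ Real.exp η * a * ‖x‖ := hδφ x (hcon.trans_lt hαδ)
        _ ≤ Real.exp η * a * α := by gcongr
        _ = (Real.exp η * Real.exp (-η)) * ρ := by rw [hα]; field_simp
        _ = ρ := by rw [hexpmul, one_mul]
    rw [hH, lintegral_indicator hWo.measurableSet, hWs,
      lintegral_image_eq_lintegral_abs_det_fderiv_mul ν hso.measurableSet
        (fun x hx => (hφ x hx.1).hasFDerivAt.hasFDerivWithinAt) (hinj.mono inter_subset_left)]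
    have hαr : α ≤ r := by
      have h1 : ρ ≤ Real.exp (-(2 * η)) * (r * a) := hρ5.le
      have h2 : Real.exp (-(2 * η)) ≤ 1 := Real.exp_le_one_iff.2 (by linarith)
      have h3 : ρ / a ≤ r := by
        rw [div_le_iff₀ ha]
        exact h1.trans (mul_le_of_le_one_left (by positivity) h2)
      have h4 : Real.exp (-η) ≤ 1 := Real.exp_le_one_iff.2 (by linarith)
      exact (mul_le_of_le_one_left (by positivity) h4).trans h3
    have hlog : Λ + η = Real.log (r / α) := by
      rw [hα, hΛ, Real.log_div hr.ne' (by positivity), Real.log_mul (Real.exp_pos _).ne' (by positivity),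
        Real.log_exp, Real.log_div hρ.ne' ha.ne', Real.log_div (by positivity) hρ.ne',
        Real.log_mul hr.ne' ha.ne']
      ring
    rw [hlog, hσ, ← lintegral_shell_inv_pow ν hαpos hαr]
    refine le_trans ?_ (lintegral_mono_set hsα)
    refine setLIntegral_mono' hso.measurableSet fun x hx => ?_
    refine (mul_le_mul_left (ofReal_abs_det_le_norm_pow ν (φ' x)) _).trans ?_
    rw [← ENNReal.ofReal_mul (by positivity)]
    refine ENNReal.ofReal_le_ofReal (le_of_eq ?_)
    have := (hpos x hx.1).ne'
    simp only [hd]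
    rw [hψφ x hx.1, div_pow, inv_pow, ← hn_def]
    field_simp
  -- the rest of the shell is missed by the image
  have hshell : ∫⁻ w, J w ∂ν + ENNReal.ofReal ((R ^ n)⁻¹) * ν (Metric.ball 0 R \ U) ≤
      σ * ENNReal.ofReal (Λ + Real.log K) := by
    have hlog : Λ + Real.log K = Real.log (R / ρ) := by
      rw [hΛ, hR, Real.log_div (by positivity) hρ.ne', Real.log_div (by positivity) hρ.ne',
        Real.log_mul (by positivity) hr.ne', Real.log_mul hKpos.ne' ha.ne',
        Real.log_mul hr.ne' ha.ne']
      ring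
    have hDm : MeasurableSet (Metric.ball 0 R \ U) :=
      Metric.isOpen_ball.measurableSet.diff hUo.measurableSet
    have hdis : Disjoint W (Metric.ball 0 R \ U) :=
      disjoint_left.2 fun w hw hw' => hw'.2 hw.1
    rw [hlog, hσ, ← lintegral_shell_inv_pow ν hρ hρ4.le, hJ,
      lintegral_indicator hWo.measurableSet, ← setLIntegral_const]
    calc _ ≤ ∫⁻ w in W, ENNReal.ofReal ((‖w‖ ^ n)⁻¹) ∂ν +
          ∫⁻ w in Metric.ball 0 R \ U, ENNReal.ofReal ((‖w‖ ^ n)⁻¹) ∂ν := by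
          refine add_le_add le_rfl ?_
          refine setLIntegral_mono' hDm fun w hw => ENNReal.ofReal_le_ofReal ?_
          have h1 : ‖w‖ < R := by simpa using hw.1
          have h2 : 0 < ‖w‖ := by
            refine norm_pos_iff.2 ?_
            rintro rfl
            exact hw.2 h0U
          gcongr
      _ = ∫⁻ w in W ∪ Metric.ball 0 R \ U, ENNReal.ofReal ((‖w‖ ^ n)⁻¹) ∂ν :=
          (lintegral_union hDm hdis).symm
      _ ≤ _ := by
          refine lintegral_mono_set (union_subset (fun w hw => ⟨hW0 w hw, ?_⟩) fun w hw => ⟨?_, ?_⟩)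
          · simpa using hUR hw.1
          · by_contra! hcon
            exact hw.2 (hcbU (by simpa using hcon))
          · simpa using hw.1
  -- conclusion in the reals
  have hΛK : 0 ≤ Λ + Real.log K := by
    have := Real.log_nonneg hK
    linarith
  have htop2 : σ * ENNReal.ofReal (Λ + Real.log K) ≠ ⊤ := ENNReal.mul_ne_top hσtop ENNReal.ofReal_ne_top
  have hJtop : ∫⁻ w, J w ∂ν ≠ ⊤ := ne_top_of_le_ne_top htop2 (le_self_add.trans hshell)
  have hmtop : ν (Metric.ball 0 R \ U) ≠ ⊤ :=
    measure_ne_top_of_subset sdiff_subset measure_ball_lt_top.ne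
  have e1 := ENNReal.toReal_mono (ENNReal.add_ne_top.2 ⟨ENNReal.mul_ne_top hσtop ENNReal.ofReal_ne_top,
    ENNReal.mul_ne_top ENNReal.ofReal_ne_top hJtop⟩) (hmain.trans (add_le_add_left henergy _))
  have e2 := ENNReal.toReal_mono htop2 hshell
  rw [ENNReal.toReal_add (ENNReal.mul_ne_top hσtop ENNReal.ofReal_ne_top)
    (ENNReal.mul_ne_top ENNReal.ofReal_ne_top hJtop)] at e1
  rw [ENNReal.toReal_add hJtop (ENNReal.mul_ne_top ENNReal.ofReal_ne_top hmtop)] at e2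
  have hn2 : (2 : ℝ) ≤ n := by exact_mod_cast hn
  simp only [ENNReal.toReal_mul] at e1 e2
  rw [ENNReal.toReal_ofReal (mul_nonneg (by positivity) (by linarith)), ENNReal.toReal_ofReal (by linarith),
    ENNReal.toReal_ofReal (by linarith)] at e1
  rw [ENNReal.toReal_ofReal (by positivity), ENNReal.toReal_ofReal hΛK] at e2
  change ν.real _ ≤ _
  rw [measureReal_def]
  change (ν (Metric.ball 0 R \ U)).toReal ≤ R ^ n * σ.toReal * _
  have hσ0 : 0 ≤ σ.toReal := ENNReal.toReal_nonneg
  set x := (∫⁻ w, J w ∂ν).toReal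
  set m := (ν (Metric.ball 0 R \ U)).toReal
  set S := σ.toReal
  have hRn : 0 < R ^ n := by positivity
  have e3 : (n - 1) * ((R ^ n)⁻¹ * m) ≤ (n - 1) * (S * (Real.log K + 5 * η)) := by
    have e4 : ((n : ℝ) - 1) * (x + (R ^ n)⁻¹ * m) ≤ (n - 1) * (S * (Λ + Real.log K)) := by
      refine mul_le_mul_of_nonneg_left e2 (by linarith)
    have e5 : 0 ≤ S * (3 * n - 6) * η := by
      refine mul_nonneg (mul_nonneg hσ0 (by linarith)) hη.le
    nlinarith
  have e6 : (R ^ n)⁻¹ * m ≤ S * (Real.log K + 5 * η) := le_of_mul_le_mul_left e3 (by linarith)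
  rw [inv_mul_le_iff₀ hRn] at e6
  linarith

/-- **The image of a ball under an injective conformal map almost fills a ball**, in dimension
`n ≥ 2`, when the derivative on the ball is at most `K` times its value at the centre with `K`
close to `1`. Integrating the speed of `log ‖φ⁻¹‖` along the rays from the image of the centre,
Young's inequality bounds from below the integral of `‖w‖⁻ⁿ` over the image by the conformally
invariant energy, which is known exactly. -/
theorem measure_ball_diff_image_ball_le (ν : Measure V) [ν.IsAddHaarMeasure]
    (hn : 2 ≤ Module.finrank ℝ V) {φ : V → V} {φ' : V → V →L[ℝ] V} {y : V} {r K : ℝ}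
    (hr : 0 < r) (hK : 1 ≤ K)
    (hφ : ∀ x ∈ Metric.ball y r, HasStrictFDerivAt φ (φ' x) x)
    (hφc : ContinuousOn φ' (Metric.ball y r))
    (hconf : ∀ x ∈ Metric.ball y r, ∀ v, ‖φ' x v‖ = ‖φ' x‖ * ‖v‖)
    (hpos : ∀ x ∈ Metric.ball y r, 0 < ‖φ' x‖)
    (hinj : InjOn φ (Metric.ball y r))
    (hK' : ∀ x ∈ Metric.ball y r, ‖φ' x‖ ≤ K * ‖φ' y‖) :
    ν.real (Metric.ball (φ y) (K * ‖φ' y‖ * r) \ φ '' Metric.ball y r) ≤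
      (K * ‖φ' y‖ * r) ^ Module.finrank ℝ V * ν.toSphere.real univ * Real.log K := by
  have hsh : ∀ x ∈ Metric.ball (0 : V) r, y + x ∈ Metric.ball y r := fun x hx => by
    simpa [dist_eq_norm] using hx
  have hy : y ∈ Metric.ball y r := Metric.mem_ball_self hr
  have key : ∀ η > 0, ν.real (Metric.ball 0 (K * ‖φ' y‖ * r) \
      (fun x => φ (y + x) - φ y) '' Metric.ball 0 r) ≤
      (K * ‖φ' y‖ * r) ^ Module.finrank ℝ V * ν.toSphere.real univ * (Real.log K + 5 * η) := by
    intro η hη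
    refine measure_ball_diff_image_ball_le_add ν hn (φ' := fun x => φ' (y + x)) hr hK
      (hpos y hy) (fun x hx => ?_)
      (hφc.comp (continuous_const.add continuous_id).continuousOn hsh)
      (fun x hx => hconf _ (hsh x hx)) (fun x hx => hpos _ (hsh x hx)) (fun x hx x' hx' h => ?_)
      (by simp) (by simp) (fun x hx => hK' _ (hsh x hx)) hη
    · have h1 : HasStrictFDerivAt (fun x => y + x) (ContinuousLinearMap.id ℝ V) x :=
        (hasStrictFDerivAt_id x).const_add y
      have h2 := (hφ _ (hsh x hx)).comp x h1
      rw [ContinuousLinearMap.comp_id] at h2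
      exact h2.sub_const _
    · have := hinj (hsh x hx) (hsh x' hx') (sub_left_injective h)
      exact add_left_cancel this
  have htrans : Metric.ball (φ y) (K * ‖φ' y‖ * r) \ φ '' Metric.ball y r =
      (fun w => w + -φ y) ⁻¹' (Metric.ball 0 (K * ‖φ' y‖ * r) \
        (fun x => φ (y + x) - φ y) '' Metric.ball 0 r) := by
    ext w
    rw [mem_preimage, Set.mem_sdiff, Set.mem_sdiff]
    refine and_congr (by simp [dist_eq_norm, sub_eq_add_neg]) (not_congr ⟨?_, ?_⟩)
    · rintro ⟨x, hx, rfl⟩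
      exact ⟨x - y, by simpa [dist_eq_norm] using hx, by simp [sub_eq_add_neg]⟩
    · rintro ⟨x, hx, h⟩
      exact ⟨y + x, hsh x hx, sub_left_injective (h.trans (sub_eq_add_neg _ _).symm)⟩
  rw [htrans, measureReal_def]
  rw [measure_preimage_add_right, ← measureReal_def]
  have hlim : Tendsto (fun η : ℝ => (K * ‖φ' y‖ * r) ^ Module.finrank ℝ V * ν.toSphere.real univ *
      (Real.log K + 5 * η)) (𝓝[>] 0) (𝓝 ((K * ‖φ' y‖ * r) ^ Module.finrank ℝ V *
        ν.toSphere.real univ * (Real.log K + 5 * 0))) := by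
    refine Tendsto.mono_left (Continuous.tendsto ?_ 0) nhdsWithin_le_nhds
    fun_prop
  rw [mul_zero, add_zero] at hlim
  exact ge_of_tendsto hlim (eventually_nhdsWithin_of_forall key)

end Volume

/-! ### Distortion of the generators -/

namespace RandomCIFS

variable {q : ℕ} {Λ : Type*} [MeasurableSpace Λ] {m : Measure Λ} {E : Type*}

/-- The scaling factor `|(φ_e^λ)'(x)|`. -/
noncomputable abbrev scale (S : RandomCIFS q m E) (e : E) (lam : Λ)
    (x : EuclideanSpace ℝ (Fin q)) : ℝ :=
  ‖fderiv ℝ (S.φ e lam) x‖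

variable (S : RandomCIFS q m E)

theorem hasStrictFDerivAt_φ (e : E) (lam : Λ) {x : EuclideanSpace ℝ (Fin q)} (hx : x ∈ S.W) :
    HasStrictFDerivAt (S.φ e lam) (fderiv ℝ (S.φ e lam) x) x :=
  ((S.contDiffOn_W e lam).contDiffAt (S.isOpen_W.mem_nhds hx)).hasStrictFDerivAt one_ne_zero

theorem continuousOn_fderiv_φ (e : E) (lam : Λ) :
    ContinuousOn (fderiv ℝ (S.φ e lam)) S.W :=
  (S.contDiffOn_W e lam).continuousOn_fderiv_of_isOpen S.isOpen_W le_rfl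

theorem nontrivial_space (hq : 1 ≤ q) : Nontrivial (EuclideanSpace ℝ (Fin q)) :=
  Module.nontrivial_of_finrank_pos (R := ℝ) (by rw [finrank_euclideanSpace_fin]; omega)

theorem norm_fderiv_apply (hq : 1 ≤ q) (e : E) (lam : Λ) {x : EuclideanSpace ℝ (Fin q)}
    (hx : x ∈ S.W) (v : EuclideanSpace ℝ (Fin q)) :
    ‖fderiv ℝ (S.φ e lam) x v‖ = S.scale e lam x * ‖v‖ := by
  have := nontrivial_space hq
  obtain ⟨c, hc, li, hli⟩ := conformalAt_iff_isConformalMap_fderiv.1 (S.conformalAt_W e lam x hx)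
  rw [scale, hli, norm_smul, LinearIsometry.norm_toContinuousLinearMap, mul_one]
  simp [norm_smul]

theorem scale_pos (hq : 1 ≤ q) (e : E) (lam : Λ) {x : EuclideanSpace ℝ (Fin q)}
    (hx : x ∈ S.W) : 0 < S.scale e lam x := by
  have := nontrivial_space hq
  exact norm_pos_iff.2
    (conformalAt_iff_isConformalMap_fderiv.1 (S.conformalAt_W e lam x hx)).ne_zero

theorem scale_le (e : E) (lam : Λ) {x : EuclideanSpace ℝ (Fin q)} (hx : x ∈ S.X) :
    S.scale e lam x ≤ S.s := by
  have hint : ∀ y ∈ interior S.X, S.scale e lam y ≤ S.s := fun y hy =>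
    (S.hasStrictFDerivAt_φ e lam (S.X_subset_W (interior_subset hy))).hasFDerivAt.le_of_lipschitzOn
      (mem_interior_iff_mem_nhds.1 hy) (S.lipschitz_X e lam)
  have hxc : x ∈ closure (interior S.X) := by rwa [S.closure_interior_X]
  obtain ⟨u, hu, hux⟩ := mem_closure_iff_seq_limit.1 hxc
  refine le_of_tendsto' (x := atTop) (f := fun n => S.scale e lam (u n)) ?_ fun n => hint _ (hu n)
  have hc : ContinuousAt (fderiv ℝ (S.φ e lam)) x :=
    (S.continuousOn_fderiv_φ e lam).continuousAt (S.isOpen_W.mem_nhds (S.X_subset_W hx))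
  exact (hc.norm.tendsto).comp hux

theorem compl_W_nonempty (hq : 1 ≤ q) : (S.Wᶜ).Nonempty := by
  have := nontrivial_space hq
  rw [nonempty_compl]
  intro h
  exact NormedSpace.unbounded_univ ℝ (EuclideanSpace ℝ (Fin q)) (h ▸ S.isBounded_W)

theorem exists_le_infDist (hq : 1 ≤ q) : ∃ δ > 0, ∀ x ∈ S.X, δ ≤ Metric.infDist x S.Wᶜ := by
  obtain ⟨x, hx, hmin⟩ := S.isCompact_X.exists_isMinOn S.isConnected_X.nonempty
    (Metric.continuous_infDist_pt S.Wᶜ).continuousOn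
  refine ⟨Metric.infDist x S.Wᶜ, ?_, fun y hy => hmin hy⟩
  exact (S.isOpen_W.isClosed_compl.notMem_iff_infDist_pos (S.compl_W_nonempty hq)).1
    (fun h => h (S.X_subset_W hx))

/-- The bounded distortion property with a uniform radius. -/
theorem exists_radius_scale_le (hq : 1 ≤ q) (hB : S.BoundedDistortion) {K : ℝ} (hK : 1 < K) :
    ∃ r₀ > 0, ∀ e lam, ∀ x ∈ S.X, ∀ y, ‖y - x‖ ≤ r₀ →
      y ∈ S.W ∧ S.scale e lam y ≤ K * S.scale e lam x := by
  obtain ⟨δ, hδ, hδX⟩ := S.exists_le_infDist hq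
  obtain ⟨k, -, -, hk, hkB⟩ := hB
  have hev : ∀ᶠ t in 𝓝[>] (0 : ℝ), k t < K := hk.eventually (gt_mem_nhds hK)
  obtain ⟨t, htK, ht0, ht1⟩ := (hev.and (Ioo_mem_nhdsGT one_pos)).exists
  refine ⟨t * δ, mul_pos ht0 hδ, fun e lam x hx y hy => ⟨?_, ?_⟩⟩
  · refine Metric.ball_infDist_compl_subset (x := x) ?_
    rw [Metric.mem_ball, dist_eq_norm]
    have := hδX x hx
    nlinarith
  · have h1 := hkB t ⟨ht0.le, ht1⟩ e lam x hx y
      (hy.trans (mul_le_mul_of_nonneg_left (hδX x hx) ht0.le))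
    rw [div_le_iff₀ (S.scale_pos hq e lam (S.X_subset_W hx))] at h1
    exact h1.trans (by gcongr)

/-- The generators scale small distances by at most the scaling factor, up to `e^ε`. -/
theorem exists_radius_dist_le (hq : 1 ≤ q) (hB : S.BoundedDistortion) {ε : ℝ} (hε : 0 < ε) :
    ∃ r₀ > 0, ∀ e lam, ∀ y ∈ S.X, ∀ z, ∀ r ≤ r₀, dist z y ≤ r →
      dist (S.φ e lam z) (S.φ e lam y) ≤ Real.exp ε * S.scale e lam y * r := by
  obtain ⟨r₀, hr₀, h⟩ := S.exists_radius_scale_le hq hB (Real.one_lt_exp_iff.2 hε)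
  refine ⟨r₀, hr₀, fun e lam y hy z r hr hz => ?_⟩
  have hr0 : 0 ≤ r := dist_nonneg.trans hz
  have hball : ∀ w ∈ Metric.closedBall y r, ‖w - y‖ ≤ r₀ := fun w hw => by
    rw [← dist_eq_norm]; exact (Metric.mem_closedBall.1 hw).trans hr
  have := Convex.norm_image_sub_le_of_norm_hasFDerivWithin_le (f := S.φ e lam)
    (f' := fderiv ℝ (S.φ e lam)) (C := Real.exp ε * S.scale e lam y)
    (fun w hw => (S.hasStrictFDerivAt_φ e lam
      (h e lam y hy w (hball w hw)).1).hasFDerivAt.hasFDerivWithinAt)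
    (fun w hw => (h e lam y hy w (hball w hw)).2) (convex_closedBall y r)
    (Metric.mem_closedBall_self hr0) (Metric.mem_closedBall.2 hz)
  rw [dist_eq_norm]
  refine this.trans ?_
  rw [← dist_eq_norm]
  gcongr

/-- By connectedness of `X`, the scaling factors at any two points of `X` are comparable,
uniformly in the generator. -/
theorem exists_scale_le_mul_scale (hq : 1 ≤ q) (hB : S.BoundedDistortion) :
    ∃ C, 1 ≤ C ∧ ∀ e lam, ∀ y ∈ S.X, ∀ z ∈ S.X, S.scale e lam y ≤ C * S.scale e lam z := by
  obtain ⟨r₀, hr₀, h⟩ := S.exists_radius_scale_le hq hB (one_lt_two)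
  have hpt : ∀ y ∈ S.X, ∀ z ∈ S.X, ∃ C : ℝ, 0 ≤ C ∧
      ∀ e lam, S.scale e lam y ≤ C * S.scale e lam z := by
    intro y hy z hz
    refine S.isConnected_X.isPreconnected.induction₂' (fun y z => ∃ C : ℝ, 0 ≤ C ∧
      ∀ e lam, S.scale e lam y ≤ C * S.scale e lam z) (fun x hx => ?_) ?_ hy hz
    · filter_upwards [inter_mem_nhdsWithin S.X (Metric.closedBall_mem_nhds x hr₀)] with w hw
      have hd : ‖w - x‖ ≤ r₀ := by rw [← dist_eq_norm]; exact hw.2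
      exact ⟨⟨2, zero_le_two, fun e lam => (h e lam w hw.1 x (by rwa [norm_sub_rev])).2⟩,
        ⟨2, zero_le_two, fun e lam => (h e lam x hx w hd).2⟩⟩
    · rintro x y z - - - ⟨C, hC, h1⟩ ⟨C', hC', h2⟩
      refine ⟨C * C', mul_nonneg hC hC', fun e lam => (h1 e lam).trans ?_⟩
      rw [mul_assoc]
      exact mul_le_mul_of_nonneg_left (h2 e lam) hC
  choose! c hc0 hc using hpt
  obtain ⟨t, htX, htf, hcov⟩ := S.isCompact_X.finite_cover_balls hr₀
  set A := ∑ i ∈ htf.toFinset, ∑ j ∈ htf.toFinset, c i j with hA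
  have hA0 : 0 ≤ A := Finset.sum_nonneg fun i hi => Finset.sum_nonneg fun j hj =>
    hc0 i (htX (htf.mem_toFinset.1 hi)) j (htX (htf.mem_toFinset.1 hj))
  have hcA : ∀ i ∈ t, ∀ j ∈ t, c i j ≤ A := by
    intro i hi j hj
    refine le_trans (Finset.single_le_sum (f := fun j => c i j) (fun j hj =>
      hc0 i (htX hi) j (htX (htf.mem_toFinset.1 hj))) (htf.mem_toFinset.2 hj)) ?_
    exact Finset.single_le_sum (f := fun i => ∑ j ∈ htf.toFinset, c i j) (fun i hi =>
      Finset.sum_nonneg fun j hj => hc0 i (htX (htf.mem_toFinset.1 hi)) j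
        (htX (htf.mem_toFinset.1 hj))) (htf.mem_toFinset.2 hi)
  refine ⟨1 + 4 * A, by linarith, fun e lam y hy z hz => ?_⟩
  obtain ⟨i, hi, hyi⟩ := mem_iUnion₂.1 (hcov hy)
  obtain ⟨j, hj, hzj⟩ := mem_iUnion₂.1 (hcov hz)
  have h1 := (h e lam i (htX hi) y (by rw [← dist_eq_norm]; exact (Metric.mem_ball.1 hyi).le)).2
  have h2 := (h e lam z hz j (by
    rw [← dist_eq_norm, dist_comm]; exact (Metric.mem_ball.1 hzj).le)).2
  have h3 := hc i (htX hi) j (htX hj) e lam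
  have hz0 : 0 ≤ S.scale e lam z := norm_nonneg _
  have hj0 : 0 ≤ S.scale e lam j := norm_nonneg _
  have h4 : S.scale e lam i ≤ A * S.scale e lam j :=
    h3.trans (mul_le_mul_of_nonneg_right (hcA i hi j hj) hj0)
  have h5 : A * S.scale e lam j ≤ A * (2 * S.scale e lam z) := mul_le_mul_of_nonneg_left h2 hA0
  linarith

/-- Points of `X` with disjoint balls of radius `r` around them have images at distance at
least about `2 r |φ'|`: the images of the balls are disjoint and almost fill balls. -/
theorem exists_radius_le_dist_of_disjoint (hq : 2 ≤ q) (hB : S.BoundedDistortion) {C c : ℝ}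
    (hC : 1 ≤ C) (hcC : c < 1 / C) :
    ∃ r₀ > 0, ∀ r, 0 < r → r ≤ r₀ → ∀ e lam, ∀ y ∈ S.X, ∀ z ∈ S.X, 2 * r ≤ dist z y →
      S.scale e lam y ≤ C * S.scale e lam z → S.scale e lam z ≤ C * S.scale e lam y →
      2 * c * S.scale e lam y * r ≤ dist (S.φ e lam z) (S.φ e lam y) := by
  have hq1 : 1 ≤ q := by omega
  have := nontrivial_space hq1
  have hC0 : 0 < C := one_pos.trans_le hC
  -- the constant `K` of the distortion is chosen close to `1` in terms of `C` and `c`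
  obtain ⟨K, hK1, hK⟩ : ∃ K > 1, q * Real.log K * (K ^ q + (K * C) ^ q) < (1 / C - c) ^ q := by
    have hcont : ContinuousAt (fun K : ℝ => q * Real.log K * (K ^ q + (K * C) ^ q)) 1 :=
      (continuousAt_const.mul (Real.continuousAt_log one_ne_zero)).mul (by fun_prop)
    have hlt : (fun K : ℝ => q * Real.log K * (K ^ q + (K * C) ^ q)) 1 < (1 / C - c) ^ q := by
      simp only [Real.log_one, mul_zero, zero_mul]
      exact pow_pos (sub_pos.2 hcC) q
    have hev := (hcont.eventually (gt_mem_nhds hlt)).filter_mono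
      (nhdsWithin_le_nhds (s := Ioi (1 : ℝ)))
    obtain ⟨K, hK, hK'⟩ := (hev.and self_mem_nhdsWithin).exists
    exact ⟨K, hK', hK⟩
  obtain ⟨r₀, hr₀, h⟩ := S.exists_radius_scale_le hq1 hB hK1
  refine ⟨r₀, hr₀, fun r hr hrr₀ e lam y hy z hz hyz hab hba => ?_⟩
  by_contra! hcon
  set a := S.scale e lam y with ha
  set b := S.scale e lam z with hb
  set ν : Measure (EuclideanSpace ℝ (Fin q)) := volume
  have ha0 : 0 < a := S.scale_pos hq1 e lam (S.X_subset_W hy)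
  have hb0 : 0 < b := S.scale_pos hq1 e lam (S.X_subset_W hz)
  have hball : ∀ x ∈ S.X, ∀ w ∈ Metric.ball x r, w ∈ S.W ∧ S.scale e lam w ≤ K * S.scale e lam x :=
    fun x hx w hw => h e lam x hx w (by
      rw [← dist_eq_norm]; exact (Metric.mem_ball.1 hw).le.trans hrr₀)
  have hvol : ∀ x ∈ S.X, ν.real (Metric.ball (S.φ e lam x) (K * S.scale e lam x * r) \
      S.φ e lam '' Metric.ball x r) ≤
      (K * S.scale e lam x * r) ^ q * ν.toSphere.real univ * Real.log K := by
    intro x hx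
    have hW := fun w hw => (hball x hx w hw).1
    have := measure_ball_diff_image_ball_le ν (φ := S.φ e lam) (φ' := fderiv ℝ (S.φ e lam))
      (y := x) (r := r) (K := K) (by simpa using hq) hr hK1.le
      (fun w hw => S.hasStrictFDerivAt_φ e lam (hW w hw))
      ((S.continuousOn_fderiv_φ e lam).mono hW)
      (fun w hw => S.norm_fderiv_apply hq1 e lam (hW w hw))
      (fun w hw => S.scale_pos hq1 e lam (hW w hw)) ((S.injOn_W e lam).mono hW)
      (fun w hw => (hball x hx w hw).2)
    simpa using this
  set Y := S.φ e lam y with hY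
  set Z := S.φ e lam z with hZ
  set w := midpoint ℝ Z Y with hw
  set τ := a * r / C - dist Z Y / 2 with hτ
  have hτlow : (1 / C - c) * (a * r) ≤ τ := by
    rw [hτ]
    have : a * r / C = 1 / C * (a * r) := by ring
    rw [this]
    nlinarith
  have hτpos : 0 < τ := (mul_pos (sub_pos.2 hcC) (mul_pos ha0 hr)).trans_le hτlow
  have hac : a / C ≤ b := by rw [div_le_iff₀ hC0]; linarith
  have haa : a / C ≤ a := div_le_self ha0.le hC
  have hsubY : Metric.ball w τ ⊆ Metric.ball Y (K * a * r) := by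
    refine Metric.ball_subset_ball' ?_
    have : dist w Y = dist Z Y / 2 := by
      rw [hw, dist_midpoint_right]; simp [div_eq_inv_mul]
    rw [this, hτ]
    have h1 : a * r / C ≤ K * a * r := by
      calc a * r / C = (a / C) * r := by ring
        _ ≤ a * r := by gcongr
        _ = 1 * a * r := by ring
        _ ≤ K * a * r := by gcongr
    linarith
  have hsubZ : Metric.ball w τ ⊆ Metric.ball Z (K * b * r) := by
    refine Metric.ball_subset_ball' ?_
    have : dist w Z = dist Z Y / 2 := by
      rw [hw, dist_midpoint_left]; simp [div_eq_inv_mul]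
    rw [this, hτ]
    have h1 : a * r / C ≤ K * b * r := by
      calc a * r / C = (a / C) * r := by ring
        _ ≤ b * r := by gcongr
        _ = 1 * b * r := by ring
        _ ≤ K * b * r := by gcongr
    linarith
  have hdisj : Disjoint (S.φ e lam '' Metric.ball y r) (S.φ e lam '' Metric.ball z r) := by
    rw [disjoint_left]
    rintro _ ⟨u, hu, rfl⟩ ⟨v, hv, huv⟩
    have huv' := S.injOn_W e lam (hball z hz v hv).1 (hball y hy u hu).1 huv
    subst huv'
    have h1 := dist_triangle_left z y v
    rw [Metric.mem_ball] at hu hv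
    linarith
  have hsub : Metric.ball w τ ⊆ (Metric.ball Y (K * a * r) \ S.φ e lam '' Metric.ball y r) ∪
      (Metric.ball Z (K * b * r) \ S.φ e lam '' Metric.ball z r) := by
    intro p hp
    by_cases hp1 : p ∈ S.φ e lam '' Metric.ball y r
    · exact Or.inr ⟨hsubZ hp, disjoint_left.1 hdisj hp1⟩
    · exact Or.inl ⟨hsubY hp, hp1⟩
  have hfin : ν ((Metric.ball Y (K * a * r) \ S.φ e lam '' Metric.ball y r) ∪
      (Metric.ball Z (K * b * r) \ S.φ e lam '' Metric.ball z r)) ≠ ⊤ :=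
    measure_union_ne_top (measure_ne_top_of_subset sdiff_subset measure_ball_lt_top.ne)
      (measure_ne_top_of_subset sdiff_subset measure_ball_lt_top.ne)
  have h1 := (measureReal_mono hsub hfin).trans (measureReal_union_le _ _)
  have h2 := h1.trans (add_le_add (hvol y hy) (hvol z hz))
  rw [measureReal_def, Measure.addHaar_ball ν w hτpos.le, ENNReal.toReal_mul,
    ENNReal.toReal_ofReal (by positivity), Measure.toSphere_real_apply_univ, ← measureReal_def,
    finrank_euclideanSpace_fin] at h2
  have hω : 0 < ν.real (Metric.ball 0 1) :=
    ENNReal.toReal_pos (Metric.measure_ball_pos ν _ one_pos).ne' measure_ball_lt_top.ne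
  set ω := ν.real (Metric.ball 0 1)
  have hlog : 0 ≤ Real.log K := Real.log_nonneg hK1.le
  have h3 : ((1 / C - c) * (a * r)) ^ q ≤ τ ^ q :=
    pow_le_pow_left₀ (mul_nonneg (sub_pos.2 hcC).le (by positivity)) hτlow q
  have h4 : (K * b * r) ^ q ≤ (K * C) ^ q * (a * r) ^ q := by
    rw [← mul_pow]
    refine pow_le_pow_left₀ (by positivity) ?_ q
    calc K * b * r ≤ K * (C * a) * r := by gcongr
      _ = _ := by ring
  have h5 : (K * a * r) ^ q = K ^ q * (a * r) ^ q := by rw [← mul_pow]; ring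
  rw [mul_pow] at h3
  change τ ^ q * ω ≤ (K * a * r) ^ q * (q * ω) * Real.log K + (K * b * r) ^ q * (q * ω) * Real.log K at h2
  have hP : 0 < (a * r) ^ q * ω := by positivity
  have h6 : (1 / C - c) ^ q * ((a * r) ^ q * ω) ≤
      q * Real.log K * (K ^ q + (K * C) ^ q) * ((a * r) ^ q * ω) := by
    calc (1 / C - c) ^ q * ((a * r) ^ q * ω) = (1 / C - c) ^ q * (a * r) ^ q * ω := by ring
      _ ≤ τ ^ q * ω := by gcongr
      _ ≤ _ := h2
      _ ≤ (K ^ q * (a * r) ^ q) * (q * ω) * Real.log K +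
          ((K * C) ^ q * (a * r) ^ q) * (q * ω) * Real.log K := by
          rw [h5]; gcongr
      _ = _ := by ring
  exact absurd (le_of_mul_le_mul_right h6 hP) (not_le.2 hK)

end RandomCIFS

namespace RandomCIFS

variable {q : ℕ} {Λ : Type*} [MeasurableSpace Λ] {m : Measure Λ} {E : Type*}

/-- On the line `X` is an interval, and the mean value theorem applies between its points. -/
theorem exists_mem_dist_eq_of_dim_one (S : RandomCIFS 1 m E) (e : E) (lam : Λ)
    {y z : EuclideanSpace ℝ (Fin 1)} (hy : y ∈ S.X) (hz : z ∈ S.X) :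
    ∃ c ∈ S.X, dist c y ≤ dist z y ∧
      dist (S.φ e lam z) (S.φ e lam y) = S.scale e lam c * dist z y := by
  have hnorm : ∀ v : EuclideanSpace ℝ (Fin 1), ‖v‖ = |v 0| := fun v => by
    rw [EuclideanSpace.norm_eq, Fin.sum_univ_one, Real.sqrt_sq (norm_nonneg _), Real.norm_eq_abs]
  have hcoord : Continuous fun v : EuclideanSpace ℝ (Fin 1) => v 0 := by fun_prop
  have hseg : ∀ t ∈ Icc (0 : ℝ) 1, y + t • (z - y) ∈ S.X := by
    intro t ht
    have hord : ((fun v : EuclideanSpace ℝ (Fin 1) => v 0) '' S.X).OrdConnected :=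
      (S.isConnected_X.isPreconnected.image _ hcoord.continuousOn).ordConnected
    have hconv : Convex ℝ ((fun v : EuclideanSpace ℝ (Fin 1) => v 0) '' S.X) := hord.convex
    obtain ⟨x, hx, hxe⟩ := hconv (mem_image_of_mem _ hy) (mem_image_of_mem _ hz)
      (sub_nonneg.2 ht.2) ht.1 (sub_add_cancel 1 t)
    have : y + t • (z - y) = x := by
      ext i
      rw [Subsingleton.elim i 0]
      simp only [smul_eq_mul] at hxe
      simp only [PiLp.add_apply, PiLp.smul_apply, PiLp.sub_apply, smul_eq_mul]
      rw [hxe]; ring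
    rwa [this]
  have hpath : ∀ t : ℝ, HasDerivAt (fun t : ℝ => y + t • (z - y)) (z - y) t := fun t => by
    have := ((hasDerivAt_id t).smul_const (z - y)).const_add y
    rwa [one_smul] at this
  have hder : ∀ t ∈ Icc (0 : ℝ) 1, HasDerivAt (fun t : ℝ => S.φ e lam (y + t • (z - y)) 0)
      (fderiv ℝ (S.φ e lam) (y + t • (z - y)) (z - y) 0) t := by
    intro t ht
    have h1 := (S.hasStrictFDerivAt_φ e lam
      (S.X_subset_W (hseg t ht))).hasFDerivAt.comp_hasDerivAt t (hpath t)
    exact (EuclideanSpace.proj (𝕜 := ℝ) (0 : Fin 1)).hasFDerivAt.comp_hasDerivAt t h1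
  obtain ⟨t, ht, hslope⟩ := exists_hasDerivAt_eq_slope _ _ (zero_lt_one (α := ℝ))
    (fun t ht => (hder t ht).continuousAt.continuousWithinAt)
    (fun t ht => hder t (Ioo_subset_Icc_self ht))
  have htI := Ioo_subset_Icc_self ht
  refine ⟨y + t • (z - y), hseg t htI, ?_, ?_⟩
  · rw [dist_eq_norm, add_sub_cancel_left, norm_smul, Real.norm_of_nonneg htI.1, dist_eq_norm]
    exact mul_le_of_le_one_left (norm_nonneg _) htI.2
  · have h1 := S.norm_fderiv_apply le_rfl e lam (S.X_subset_W (hseg t htI)) (z - y)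
    rw [dist_eq_norm, dist_eq_norm, ← h1, hnorm, hnorm]
    simp only [one_smul, zero_smul, add_zero, sub_zero, div_one, add_sub_cancel] at hslope
    rw [hslope]
    rfl

variable (S : RandomCIFS q m E)

/-- The generators scale small distances in `X` by at least the scaling factor, up to `e^{-ε}`. -/
theorem exists_radius_le_dist (hq : 1 ≤ q) (hB : S.BoundedDistortion) {ε : ℝ} (hε : 0 < ε) :
    ∃ r₀ > 0, ∀ e lam, ∀ y ∈ S.X, ∀ z ∈ S.X, dist z y ≤ r₀ →
      Real.exp (-ε) * S.scale e lam y * dist z y ≤ dist (S.φ e lam z) (S.φ e lam y) := by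
  rcases hq.lt_or_eq with hq2 | rfl
  · have hexp : 1 < Real.exp (ε / 2) := Real.one_lt_exp_iff.2 (half_pos hε)
    obtain ⟨r₁, hr₁, h₁⟩ := S.exists_radius_scale_le hq hB hexp
    obtain ⟨r₂, hr₂, h₂⟩ := S.exists_radius_le_dist_of_disjoint hq2 hB (C := Real.exp (ε / 2))
      (c := Real.exp (-ε)) hexp.le
      (by rw [one_div, ← Real.exp_neg, Real.exp_lt_exp]; linarith)
    refine ⟨min r₁ r₂, lt_min hr₁ hr₂, fun e lam y hy z hz hyz => ?_⟩
    rcases (dist_nonneg (x := z) (y := y)).eq_or_lt with h0 | h0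
    · rw [← h0, mul_zero]; exact dist_nonneg
    have hd1 := hyz.trans (min_le_left _ _)
    have hd2 := hyz.trans (min_le_right _ _)
    have := h₂ (dist z y / 2) (half_pos h0) (by linarith) e lam y hy z hz (by linarith)
      (h₁ e lam z hz y (by rwa [← dist_eq_norm, dist_comm])).2
      (h₁ e lam y hy z (by rwa [← dist_eq_norm])).2
    calc _ = 2 * Real.exp (-ε) * S.scale e lam y * (dist z y / 2) := by ring
      _ ≤ _ := this
  · obtain ⟨r₁, hr₁, h₁⟩ := S.exists_radius_scale_le le_rfl hB (Real.one_lt_exp_iff.2 hε)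
    refine ⟨r₁, hr₁, fun e lam y hy z hz hyz => ?_⟩
    obtain ⟨c, hc, hcy, heq⟩ := S.exists_mem_dist_eq_of_dim_one e lam hy hz
    rw [heq]
    gcongr
    have := (h₁ e lam c hc y (by rw [← dist_eq_norm, dist_comm]; exact hcy.trans hyz)).2
    rw [Real.exp_neg, inv_mul_le_iff₀ (Real.exp_pos _)]
    exact this

/-- Points of `X` that are not close have images at a distance that is bounded below in terms of the
scaling factor. -/
theorem exists_le_dist_of_le_dist (hq : 1 ≤ q) (hB : S.BoundedDistortion) {r₀ : ℝ} (hr₀ : 0 < r₀) :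
    ∃ c > 0, ∀ e lam, ∀ y ∈ S.X, ∀ z ∈ S.X, r₀ ≤ dist z y →
      c * S.scale e lam y ≤ dist (S.φ e lam z) (S.φ e lam y) := by
  obtain ⟨C, hC, hCS⟩ := S.exists_scale_le_mul_scale hq hB
  have hC0 : 0 < C := one_pos.trans_le hC
  rcases hq.lt_or_eq with hq2 | rfl
  · obtain ⟨r₂, hr₂, h₂⟩ := S.exists_radius_le_dist_of_disjoint hq2 hB (C := C)
      (c := 1 / (2 * C)) hC (by gcongr; linarith)
    refine ⟨2 * (1 / (2 * C)) * min r₂ (r₀ / 2), by positivity, fun e lam y hy z hz hyz => ?_⟩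
    have := h₂ (min r₂ (r₀ / 2)) (by positivity) (min_le_left _ _) e lam y hy z hz
      (by linarith [min_le_right r₂ (r₀ / 2)]) (hCS e lam y hy z hz) (hCS e lam z hz y hy)
    linarith
  · refine ⟨r₀ / C, by positivity, fun e lam y hy z hz hyz => ?_⟩
    obtain ⟨c, hc, hcy, heq⟩ := S.exists_mem_dist_eq_of_dim_one e lam hy hz
    rw [heq, div_mul_eq_mul_div, div_le_iff₀ hC0]
    have h0 : 0 ≤ S.scale e lam c := norm_nonneg _
    calc r₀ * S.scale e lam y ≤ dist z y * (C * S.scale e lam c) := by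
          gcongr
          exact hCS e lam y hy c hc
      _ = _ := by ring

/-- The preimage under a generator of a small ball is contained in a ball whose radius is that
given by the scaling factor, up to `e^ε`. -/
theorem exists_radius_dist_le_of_dist_le (hq : 1 ≤ q) (hB : S.BoundedDistortion) {ε : ℝ}
    (hε : 0 < ε) :
    ∃ r₀ > 0, ∀ e lam, ∀ y ∈ S.X, ∀ z ∈ S.X, ∀ r ≤ r₀,
      dist (S.φ e lam z) (S.φ e lam y) ≤ Real.exp (-ε) * S.scale e lam y * r → dist z y ≤ r := by
  obtain ⟨r₁, hr₁, h₁⟩ := S.exists_radius_le_dist hq hB hε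
  obtain ⟨c, hc, h₂⟩ := S.exists_le_dist_of_le_dist hq hB hr₁
  refine ⟨c / 2, half_pos hc, fun e lam y hy z hz r hr hd => ?_⟩
  have ha : 0 < S.scale e lam y := S.scale_pos hq e lam (S.X_subset_W hy)
  have hexp : Real.exp (-ε) ≤ 1 := Real.exp_le_one_iff.2 (by linarith)
  rcases le_total (dist z y) r₁ with h | h
  · have := (h₁ e lam y hy z hz h).trans hd
    exact le_of_mul_le_mul_left this (by positivity)
  · exfalso
    have h3 := (h₂ e lam y hy z hz h).trans hd
    have h4 : Real.exp (-ε) * S.scale e lam y * r ≤ S.scale e lam y * (c / 2) := by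
      calc _ ≤ Real.exp (-ε) * S.scale e lam y * (c / 2) := by gcongr
        _ ≤ 1 * S.scale e lam y * (c / 2) := by gcongr
        _ = _ := by ring
    nlinarith

end RandomCIFS

/-! ### A maximal inequality for conditional masses of balls -/

section Maximal

variable {Y : Type*} [MetricSpace Y] [SecondCountableTopology Y] [MeasurableSpace Y] [BorelSpace Y]

/-- A weak type maximal inequality, from the Besicovitch covering theorem: the constant depends
only on the space. -/
theorem exists_measure_setOf_le_mul [HasBesicovitchCovering Y] :
    ∃ N : ℕ, ∀ (ρ ν : Measure Y) (t : ℝ≥0∞),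
      ρ {x | ∃ r > 0, ρ (Metric.closedBall x r) ≤ t * ν (Metric.closedBall x r)} ≤
        N * (t * ν univ) := by
  obtain ⟨N, τ, hτ, hN⟩ := HasBesicovitchCovering.no_satelliteConfig (α := Y)
  refine ⟨N, fun ρ ν t => ?_⟩
  set A : ℕ → Set Y := fun R => {x | ∃ r > 0, r ≤ (R : ℝ) ∧
    ρ (Metric.closedBall x r) ≤ t * ν (Metric.closedBall x r)} with hA
  have hmono : Monotone A := by
    rintro R R' hRR' x ⟨r, hr, hrR, h⟩
    exact ⟨r, hr, hrR.trans (by exact_mod_cast hRR'), h⟩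
  have hunion : {x | ∃ r > 0, ρ (Metric.closedBall x r) ≤ t * ν (Metric.closedBall x r)} =
      ⋃ R, A R := by
    ext x
    rw [mem_iUnion]
    constructor
    · rintro ⟨r, hr, h⟩
      obtain ⟨R, hR⟩ := exists_nat_ge r
      exact ⟨R, r, hr, hR, h⟩
    · rintro ⟨R, r, hr, -, h⟩
      exact ⟨r, hr, h⟩
  rw [hunion, hmono.measure_iUnion]
  refine iSup_le fun R => ?_
  choose! r hr hrR hle using fun x (hx : x ∈ A R) => hx
  let b : Besicovitch.BallPackage (A R) Y :=
    { c := fun x => x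
      r := fun x => r x
      rpos := fun x => hr x x.2
      r_bound := R
      r_le := fun x => hrR x x.2 }
  obtain ⟨u, hu, hcov⟩ := Besicovitch.exist_disjoint_covering_families hτ hN b
  have hcount : ∀ i, (u i).Countable := fun i =>
    (hu i).countable_of_nonempty_interior fun j _ =>
      (Metric.nonempty_ball.2 (b.rpos j)).mono Metric.ball_subset_interior_closedBall
  have hsub : A R ⊆ ⋃ i : Fin N, ⋃ j ∈ u i, Metric.closedBall (j : Y) (r j) := by
    intro x hx
    have hx' : x ∈ range b.c := ⟨⟨x, hx⟩, rfl⟩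
    obtain ⟨i, hi⟩ := mem_iUnion.1 (hcov hx')
    obtain ⟨j, hj, hxj⟩ := mem_iUnion₂.1 hi
    exact mem_iUnion.2 ⟨i, mem_iUnion₂.2 ⟨j, hj, Metric.ball_subset_closedBall hxj⟩⟩
  calc ρ (A R) ≤ ∑ i : Fin N, ρ (⋃ j ∈ u i, Metric.closedBall (j : Y) (r j)) :=
        (measure_mono hsub).trans (measure_iUnion_fintype_le _ _)
    _ ≤ ∑ i : Fin N, t * ν univ := by
        refine Finset.sum_le_sum fun i _ => ?_
        have := (hcount i).to_subtype
        calc ρ (⋃ j ∈ u i, Metric.closedBall (j : Y) (r j))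
            ≤ ∑' j : u i, ρ (Metric.closedBall ((j : A R) : Y) (r (j : A R))) :=
              measure_biUnion_le _ (hcount i) _
          _ ≤ ∑' j : u i, t * ν (Metric.closedBall ((j : A R) : Y) (r (j : A R))) :=
              ENNReal.tsum_le_tsum fun j => hle _ (j : A R).2
          _ = t * ν (⋃ j ∈ u i, Metric.closedBall (j : Y) (r j)) := by
              rw [ENNReal.tsum_mul_left, measure_biUnion (hcount i) (hu i)
                fun j _ => Metric.isClosed_closedBall.measurableSet]
          _ ≤ t * ν univ := by gcongr; exact subset_univ _
    _ = N * (t * ν univ) := by simp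

/-- A layer-cake bound by the integer levels. -/
theorem ENNReal.le_tsum_indicator_natCast_lt (v : ℝ≥0∞) :
    v ≤ ∑' n : ℕ, {n : ℕ | (n : ℝ≥0∞) < v}.indicator (fun _ => (1 : ℝ≥0∞)) n := by
  refine le_of_forall_lt fun w hw => ?_
  have hwt : w ≠ ⊤ := (hw.trans_le le_top).ne
  obtain ⟨k, hk1, hk2⟩ : ∃ k : ℕ, w < (k : ℝ≥0∞) ∧ ∀ n < k, (n : ℝ≥0∞) < v := by
    obtain ⟨j, hj⟩ := ENNReal.exists_nat_gt hwt
    refine ⟨Nat.find ⟨j, hj⟩, Nat.find_spec (⟨j, hj⟩ : ∃ k : ℕ, w < (k : ℝ≥0∞)), fun n hn => ?_⟩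
    exact (not_lt.1 (Nat.find_min (⟨j, hj⟩ : ∃ k : ℕ, w < (k : ℝ≥0∞)) hn)).trans_lt hw
  refine hk1.trans_le ?_
  calc (k : ℝ≥0∞) = ∑ n ∈ Finset.range k,
        {n : ℕ | (n : ℝ≥0∞) < v}.indicator (fun _ => (1 : ℝ≥0∞)) n := by
        rw [Finset.sum_congr rfl fun n hn => indicator_of_mem
          (show n ∈ {n : ℕ | (n : ℝ≥0∞) < v} from hk2 n (Finset.mem_range.1 hn)) _]
        simp
    _ ≤ _ := ENNReal.sum_le_tsum _

/-- The first `-log a` terms are bounded by `a`, and from there on the series is geometric with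
first term at most `N * a`. -/
theorem tsum_min_exp_le {a : ℝ} (ha : 0 < a) (ha1 : a ≤ 1) (N : ℕ) :
    ∑' n : ℕ, min (ENNReal.ofReal a) (N * ENNReal.ofReal (Real.exp (-n))) ≤
      ENNReal.ofReal a * (ENNReal.ofReal (-Real.log a) +
        (1 + N * ∑' n : ℕ, ENNReal.ofReal (Real.exp (-n)))) := by
  set L := -Real.log a with hL
  have hL0 : 0 ≤ L := by have := Real.log_nonpos ha.le ha1; linarith
  set k := ⌈L⌉₊ with hk
  have hkL : (k : ℝ) ≤ L + 1 := (Nat.ceil_lt_add_one hL0).le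
  have hka : Real.exp (-(k : ℝ)) ≤ a := by
    calc Real.exp (-(k : ℝ)) ≤ Real.exp (-L) := Real.exp_le_exp.2 (neg_le_neg (Nat.le_ceil L))
      _ = a := by rw [hL, neg_neg, Real.exp_log ha]
  rw [← ENNReal.summable.sum_add_tsum_nat_add' (k := k)]
  calc _ ≤ ∑ n ∈ Finset.range k, ENNReal.ofReal a +
        ∑' n : ℕ, N * (ENNReal.ofReal a * ENNReal.ofReal (Real.exp (-n))) := by
        refine add_le_add (Finset.sum_le_sum fun n _ => min_le_left _ _)
          (ENNReal.tsum_le_tsum fun n => (min_le_right _ _).trans ?_)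
        rw [← ENNReal.ofReal_mul ha.le]
        gcongr
        push_cast
        rw [neg_add, Real.exp_add, mul_comm]
        gcongr
    _ ≤ ENNReal.ofReal a * (ENNReal.ofReal L + 1) +
        ENNReal.ofReal a * (N * ∑' n : ℕ, ENNReal.ofReal (Real.exp (-n))) := by
        refine add_le_add ?_ (le_of_eq ?_)
        · rw [Finset.sum_const, Finset.card_range, nsmul_eq_mul, mul_comm]
          gcongr
          rw [← ENNReal.ofReal_one, ← ENNReal.ofReal_add hL0 zero_le_one,
            ← ENNReal.ofReal_natCast]
          exact ENNReal.ofReal_le_ofReal hkL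
        · rw [ENNReal.tsum_mul_left, ENNReal.tsum_mul_left]
          ring
    _ = _ := by ring

theorem tsum_ofReal_exp_neg_lt_top : ∑' n : ℕ, ENNReal.ofReal (Real.exp (-n)) < ⊤ := by
  have h1 : Summable fun n : ℕ => Real.exp (-n) := by
    have := summable_geometric_of_lt_one (Real.exp_pos (-1)).le (Real.exp_lt_one_iff.2 (by norm_num))
    refine this.congr fun n => ?_
    rw [← Real.exp_nat_mul]; ring_nf
  rw [← ENNReal.ofReal_tsum_of_nonneg (fun n => (Real.exp_pos _).le) h1]
  exact ENNReal.ofReal_lt_top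

/-- On a cell `A`, the supremum over all radii of the information `-log P(A | g ∈ B(g ω, r))` has
integral at most `P(A) (-log P(A) + C)`, with a constant `C` depending only on the space. -/
theorem exists_lintegral_iSup_info_le [HasBesicovitchCovering Y] :
    ∃ C : ℝ≥0∞, C ≠ ⊤ ∧ ∀ {Ω : Type*} [MeasurableSpace Ω] (P : Measure Ω) [IsProbabilityMeasure P]
      (g : Ω → Y) (A : Set Ω), Measurable g → MeasurableSet A →
      ∀ F : Ω → ℝ≥0∞, Measurable F →
      (∀ ω ∈ A, F ω = ⨆ r : {r : ℚ // 0 < r}, ENNReal.ofReal (-Real.log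
        (P.real {ω' | ω' ∈ A ∧ dist (g ω') (g ω) ≤ (r.1 : ℝ)} /
          P.real {ω' | dist (g ω') (g ω) ≤ (r.1 : ℝ)}))) →
      ∫⁻ ω in A, F ω ∂P ≤ ∫⁻ _ in A, (ENNReal.ofReal (-Real.log (P.real A)) + C) ∂P := by
  obtain ⟨N, hN⟩ := exists_measure_setOf_le_mul (Y := Y)
  refine ⟨1 + N * ∑' n : ℕ, ENNReal.ofReal (Real.exp (-n)), ?_, ?_⟩
  · exact ENNReal.add_ne_top.2 ⟨ENNReal.one_ne_top,
      ENNReal.mul_ne_top (ENNReal.natCast_ne_top N) tsum_ofReal_exp_neg_lt_top.ne⟩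
  intro Ω _ P _ g A hg hA F hF hFA
  rw [setLIntegral_const, mul_comm]
  rcases eq_or_ne (P A) 0 with h0 | h0
  · rw [Measure.restrict_eq_zero.2 h0]; simp
  have ha0 : 0 < P.real A := ENNReal.toReal_pos h0 (measure_ne_top _ _)
  have haP : P A = ENNReal.ofReal (P.real A) := (ENNReal.ofReal_toReal (measure_ne_top _ _)).symm
  set ν := P.map g with hν
  set ρ := (P.restrict A).map g with hρ
  have hball : ∀ x r, MeasurableSet (Metric.closedBall (x : Y) r) := fun x r =>
    Metric.isClosed_closedBall.measurableSet
  have hνb : ∀ x r, ν (Metric.closedBall x r) = P {ω' | dist (g ω') x ≤ r} := fun x r => by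
    rw [hν, Measure.map_apply hg (hball _ _)]; rfl
  have hρb : ∀ x r, ρ (Metric.closedBall x r) = P {ω' | ω' ∈ A ∧ dist (g ω') x ≤ r} := fun x r => by
    rw [hρ, Measure.map_apply hg (hball _ _), Measure.restrict_apply (hg (hball _ _)), inter_comm]
    rfl
  have htail : ∀ n : ℕ, P.restrict A {ω | (n : ℝ≥0∞) < F ω} ≤
      min (ENNReal.ofReal (P.real A)) (N * ENNReal.ofReal (Real.exp (-n))) := by
    intro n
    refine le_min ?_ ?_
    · rw [← haP]
      exact (measure_mono (subset_univ _)).trans (by rw [Measure.restrict_apply_univ])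
    · have hsub : {ω | (n : ℝ≥0∞) < F ω} ∩ A ⊆ g ⁻¹' {x | ∃ r > 0, ρ (Metric.closedBall x r) ≤
          ENNReal.ofReal (Real.exp (-n)) * ν (Metric.closedBall x r)} := by
        rintro ω ⟨hω, hωA⟩
        change (n : ℝ≥0∞) < F ω at hω
        rw [hFA ω hωA] at hω
        obtain ⟨⟨r, hr⟩, hrn⟩ := lt_iSup_iff.1 hω
        refine ⟨r, by exact_mod_cast hr, ?_⟩
        rw [hρb, hνb]
        set x := P.real {ω' | ω' ∈ A ∧ dist (g ω') (g ω) ≤ (r : ℝ)} with hx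
        set y := P.real {ω' | dist (g ω') (g ω) ≤ (r : ℝ)} with hy
        have hlog : (n : ℝ) < -Real.log (x / y) := by
          rw [← ENNReal.ofReal_natCast] at hrn
          exact (ENNReal.ofReal_lt_ofReal_iff_of_nonneg (by positivity)).1 hrn
        have hx0 : 0 ≤ x := measureReal_nonneg
        have hy0 : 0 ≤ y := measureReal_nonneg
        -- a ball of mass zero, or disjoint from `A`, has information `-log 0 = 0 ≤ n`
        have hxy : x ≤ Real.exp (-n) * y := by
          rcases hy0.eq_or_lt with h | h
          · rw [← h, div_zero, Real.log_zero, neg_zero] at hlog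
            exact absurd hlog (not_lt.2 (by positivity))
          rcases hx0.eq_or_lt with h' | h'
          · rw [← h', zero_div, Real.log_zero, neg_zero] at hlog
            exact absurd hlog (not_lt.2 (by positivity))
          rw [← div_le_iff₀ h, ← Real.log_le_iff_le_exp (div_pos h' h)]
          linarith
        rw [← ENNReal.ofReal_toReal (measure_ne_top P {ω' | ω' ∈ A ∧ dist (g ω') (g ω) ≤ (r : ℝ)}),
          ← ENNReal.ofReal_toReal (measure_ne_top P {ω' | dist (g ω') (g ω) ≤ (r : ℝ)}),
          ← ENNReal.ofReal_mul (Real.exp_pos _).le]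
        exact ENNReal.ofReal_le_ofReal hxy
      calc P.restrict A {ω | (n : ℝ≥0∞) < F ω}
          = P.restrict A ({ω | (n : ℝ≥0∞) < F ω} ∩ A) := by
            rw [Measure.restrict_apply' hA, Measure.restrict_apply' hA, inter_assoc, inter_self]
        _ ≤ P.restrict A (g ⁻¹' _) := measure_mono hsub
        _ ≤ ρ _ := Measure.le_map_apply hg.aemeasurable _
        _ ≤ N * (ENNReal.ofReal (Real.exp (-n)) * ν univ) := hN _ _ _
        _ = N * ENNReal.ofReal (Real.exp (-n)) := by
            rw [hν, Measure.map_apply hg MeasurableSet.univ, preimage_univ, measure_univ, mul_one]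
  have hFm : ∀ n : ℕ, MeasurableSet {ω | (n : ℝ≥0∞) < F ω} := fun n =>
    measurableSet_lt measurable_const hF
  calc ∫⁻ ω in A, F ω ∂P
      ≤ ∫⁻ ω in A, ∑' n : ℕ, {ω | (n : ℝ≥0∞) < F ω}.indicator (fun _ => (1 : ℝ≥0∞)) ω ∂P :=
        lintegral_mono fun ω => ENNReal.le_tsum_indicator_natCast_lt (F ω)
    _ = ∑' n : ℕ, P.restrict A {ω | (n : ℝ≥0∞) < F ω} := by
        rw [lintegral_tsum fun n => (measurable_const.indicator (hFm n)).aemeasurable]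
        congr 1
        ext n
        rw [lintegral_indicator_const (hFm n), one_mul]
    _ ≤ _ := (ENNReal.tsum_le_tsum htail).trans (tsum_min_exp_le ha0 measureReal_le_one N)
    _ = _ := by rw [haP, mul_comm]

end Maximal

/-! ### Conditional information along shrinking balls -/

section CondEntropy

variable {Ω Z E : Type*} [MeasurableSpace Ω] [MeasurableSpace Z] {μ : Measure Ω}
  [IsProbabilityMeasure μ] {Ψ : Ω → Z}

/-- A conditional probability given `Ψ` is characterized by its integrals over preimages. -/
theorem condExp_indicator_ae_eq_comp (hΨ : Measurable Ψ) {A : Set Ω} (hA : MeasurableSet A)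
    {D : Z → ℝ≥0∞} (hD : Measurable D)
    (h : ∀ B, MeasurableSet B → ∫⁻ p in Ψ ⁻¹' B, D (Ψ p) ∂μ = μ (A ∩ Ψ ⁻¹' B)) :
    μ[A.indicator (fun _ => (1 : ℝ)) | MeasurableSpace.comap Ψ inferInstance] =ᵐ[μ]
      fun p => (D (Ψ p)).toReal := by
  have hDm : Measurable fun p => D (Ψ p) := hD.comp hΨ
  have hfin : ∫⁻ p, D (Ψ p) ∂μ ≠ ⊤ := by
    have := h univ MeasurableSet.univ
    rw [preimage_univ, Measure.restrict_univ, inter_univ] at this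
    rw [this]; exact measure_ne_top _ _
  have hint : Integrable (fun p => (D (Ψ p)).toReal) μ :=
    integrable_toReal_of_lintegral_ne_top hDm.aemeasurable hfin
  refine (ae_eq_condExp_of_forall_setIntegral_eq hΨ.comap_le
    ((integrable_const _).indicator hA) (fun _ _ _ => hint.integrableOn) ?_ ?_).symm
  · rintro _ ⟨B, hB, rfl⟩ -
    rw [integral_toReal hDm.aemeasurable
      (ae_restrict_of_ae (ae_lt_top hDm hfin)), h B hB, integral_indicator hA]
    simp [measureReal_def, Measure.restrict_apply hA]
  · exact ((hD.ennreal_toReal.comp (comap_measurable Ψ)).stronglyMeasurable).aestronglyMeasurable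

theorem condEntropy_comap_eq [Countable E] (hΨ : Measurable Ψ) {f : Ω → E}
    (hf : ∀ e, MeasurableSet (f ⁻¹' {e})) {D : E → Z → ℝ≥0∞} (hD : ∀ e, Measurable (D e))
    (h : ∀ e, ∀ B, MeasurableSet B →
      ∫⁻ p in Ψ ⁻¹' B, D e (Ψ p) ∂μ = μ (f ⁻¹' {e} ∩ Ψ ⁻¹' B)) :
    condEntropy μ f (MeasurableSpace.comap Ψ inferInstance) =
      ∫⁻ p, ENNReal.ofReal (-Real.log (D (f p) (Ψ p)).toReal) ∂μ := by
  refine lintegral_congr_ae ?_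
  filter_upwards [ae_all_iff.2 fun e => condExp_indicator_ae_eq_comp hΨ (hf e) (hD e) (h e)]
    with p hp
  rw [hp (f p)]

end CondEntropy

section BallInfo

variable {Λ Ω E Y : Type*} [MeasurableSpace Λ] [MeasurableSpace Ω] [MetricSpace Y]

/-- The conditional mass of the points whose image under `G` is within `r` of `G p`. -/
noncomputable def ballMass (κ : Kernel Λ Ω) (G : Λ × Ω → Y) (r : ℝ) (p : Λ × Ω) : ℝ :=
  (κ p.1).real {ω | dist (G (p.1, ω)) (G p) ≤ r}

/-- The conditional mass of the points in the same cell as `p`, that is with the same value of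
`f`, whose image under `G` is within `r` of `G p`. -/
noncomputable def cellBallMass (κ : Kernel Λ Ω) (f : Λ × Ω → E) (G : Λ × Ω → Y) (r : ℝ)
    (p : Λ × Ω) : ℝ :=
  (κ p.1).real {ω | f (p.1, ω) = f p ∧ dist (G (p.1, ω)) (G p) ≤ r}

/-- The information carried by the cell of `p`, given that the image under `G` is within `r` of
`G p`. -/
noncomputable def ballInfo (κ : Kernel Λ Ω) (f : Λ × Ω → E) (G : Λ × Ω → Y) (r : ℝ)
    (p : Λ × Ω) : ℝ :=
  -Real.log (cellBallMass κ f G r p / ballMass κ G r p)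

variable {κ : Kernel Λ Ω} [IsMarkovKernel κ] {f : Λ × Ω → E} {G : Λ × Ω → Y}

theorem cellBallMass_le_ballMass (r : ℝ) (p : Λ × Ω) :
    cellBallMass κ f G r p ≤ ballMass κ G r p :=
  measureReal_mono (fun _ h => h.2) (measure_ne_top _ _)

theorem ballInfo_nonneg (r : ℝ) (p : Λ × Ω) : 0 ≤ ballInfo κ f G r p := by
  rw [ballInfo, neg_nonneg]
  exact Real.log_nonpos (div_nonneg measureReal_nonneg measureReal_nonneg)
    (div_le_one_of_le₀ (cellBallMass_le_ballMass r p) measureReal_nonneg)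

theorem ballMass_le_one (r : ℝ) (p : Λ × Ω) : ballMass κ G r p ≤ 1 := measureReal_le_one

variable [SecondCountableTopology Y] [MeasurableSpace Y] [BorelSpace Y]

section Measurability

variable [MeasurableSpace E] [Countable E] [MeasurableSingletonClass E]

theorem measurableSet_cell_ball (hf : Measurable f) (hG : Measurable G) (r : ℝ) :
    MeasurableSet {x : (Λ × Ω) × Ω |
      f (x.1.1, x.2) = f x.1 ∧ dist (G (x.1.1, x.2)) (G x.1) ≤ r} := by
  have h1 : Measurable fun x : (Λ × Ω) × Ω => (x.1.1, x.2) :=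
    (measurable_fst.comp measurable_fst).prodMk measurable_snd
  exact (measurableSet_eq_fun (hf.comp h1) (hf.comp measurable_fst)).inter
    (measurableSet_le ((hG.comp h1).dist (hG.comp measurable_fst)) measurable_const)

theorem measurable_cellBallMass_enn (hf : Measurable f) (hG : Measurable G) (r : ℝ) :
    Measurable fun p : Λ × Ω => κ p.1 {ω | f (p.1, ω) = f p ∧ dist (G (p.1, ω)) (G p) ≤ r} :=
  Kernel.measurable_kernel_prodMk_left (κ := κ.comap Prod.fst measurable_fst)
    (measurableSet_cell_ball hf hG r)

theorem measurable_cellBallMass (hf : Measurable f) (hG : Measurable G) (r : ℝ) :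
    Measurable (cellBallMass κ f G r) :=
  (measurable_cellBallMass_enn hf hG r).ennreal_toReal

theorem measurable_ballMass_enn (hG : Measurable G) (r : ℝ) :
    Measurable fun p : Λ × Ω => κ p.1 {ω | dist (G (p.1, ω)) (G p) ≤ r} := by
  have := measurable_cellBallMass_enn (κ := κ) (f := fun _ : Λ × Ω => ()) measurable_const hG r
  simpa using this

theorem measurable_ballMass (hG : Measurable G) (r : ℝ) :
    Measurable (ballMass κ G r) :=
  (measurable_ballMass_enn hG r).ennreal_toReal

theorem measurable_ballInfo (hf : Measurable f) (hG : Measurable G) (r : ℝ) :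
    Measurable (ballInfo κ f G r) :=
  ((measurable_cellBallMass hf hG r).div (measurable_ballMass hG r)).log.neg

end Measurability

theorem continuousWithinAt_real_setOf_le (P : Measure Ω) [IsFiniteMeasure P] {A : Set Ω}
    (hA : MeasurableSet A) {h : Ω → ℝ} (hh : Measurable h) (r : ℝ) :
    ContinuousWithinAt (fun r => P.real {ω | ω ∈ A ∧ h ω ≤ r}) (Ioi r) r := by
  have h1 := tendsto_measure_biInter_gt (μ := P) (s := fun r => {ω | ω ∈ A ∧ h ω ≤ r}) (a := r)
    (fun r' _ => (hA.inter (measurableSet_le hh measurable_const)).nullMeasurableSet)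
    (fun i j _ hij ω hω => ⟨hω.1, hω.2.trans hij⟩) ⟨r + 1, by simp, measure_ne_top _ _⟩
  have h2 : ⋂ r' > r, {ω | ω ∈ A ∧ h ω ≤ r'} = {ω | ω ∈ A ∧ h ω ≤ r} := by
    ext ω
    simp only [mem_iInter]
    constructor
    · intro hω
      exact ⟨(hω (r + 1) (by simp)).1, le_of_forall_gt_imp_ge_of_dense fun r' hr' => (hω r' hr').2⟩
    · exact fun hω r' hr' => ⟨hω.1, hω.2.trans (le_of_lt hr')⟩
  rw [h2] at h1
  exact (ENNReal.tendsto_toReal (measure_ne_top _ _)).comp h1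

theorem continuousWithinAt_cellBallMass_div [MeasurableSpace E] [MeasurableSingletonClass E]
    (hf : Measurable f) (hG : Measurable G) {p : Λ × Ω} {r : ℝ}
    (hpos : 0 < cellBallMass κ f G r p) :
    ContinuousWithinAt (fun r => cellBallMass κ f G r p / ballMass κ G r p) (Ioi r) r := by
  have hGm : Measurable fun ω => dist (G (p.1, ω)) (G p) :=
    (hG.comp measurable_prodMk_left).dist measurable_const
  have hA : MeasurableSet {ω | f (p.1, ω) = f p} :=
    (hf.comp measurable_prodMk_left) (measurableSet_singleton (f p))
  have h1 : ContinuousWithinAt (fun r => cellBallMass κ f G r p) (Ioi r) r :=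
    continuousWithinAt_real_setOf_le (κ p.1) hA hGm r
  have h2 : ContinuousWithinAt (fun r => ballMass κ G r p) (Ioi r) r := by
    have := continuousWithinAt_real_setOf_le (κ p.1) MeasurableSet.univ hGm r
    simpa [ballMass] using this
  have hpos' : 0 < ballMass κ G r p := hpos.trans_le (cellBallMass_le_ballMass r p)
  exact h1.div h2 hpos'.ne'

theorem continuousWithinAt_ballInfo [MeasurableSpace E] [MeasurableSingletonClass E]
    (hf : Measurable f) (hG : Measurable G) {p : Λ × Ω} {r : ℝ}
    (hpos : 0 < cellBallMass κ f G r p) :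
    ContinuousWithinAt (fun r => ballInfo κ f G r p) (Ioi r) r :=
  ((continuousWithinAt_cellBallMass_div hf hG hpos).log
    (div_pos hpos (hpos.trans_le (cellBallMass_le_ballMass r p))).ne').neg

variable [MeasurableSpace E] [Countable E] [MeasurableSingletonClass E]
  {m : Measure Λ}

/-- Almost every point of a cell has its image in the support of the image of the measure restricted
to the cell. -/
theorem ae_forall_cellBallMass_pos (hf : Measurable f) (hG : Measurable G) :
    ∀ᵐ p ∂(m ⊗ₘ κ), ∀ r > 0, 0 < cellBallMass κ f G r p := by
  have key : ∀ᵐ p ∂(m ⊗ₘ κ), ∀ n : ℕ, 0 < cellBallMass κ f G (1 / ((n : ℝ) + 1)) p := by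
    have hset : MeasurableSet {p | ∀ n : ℕ, 0 < cellBallMass κ f G (1 / ((n : ℝ) + 1)) p} := by
      simp only [ofPred_forall]
      exact MeasurableSet.iInter fun n =>
        measurableSet_lt measurable_const (measurable_cellBallMass hf hG _)
    refine Measure.ae_compProd_of_ae_ae hset ?_
    refine ae_of_all _ fun lam => ?_
    have hA : ∀ e, MeasurableSet {ω | f (lam, ω) = e} := fun e =>
      (hf.comp measurable_prodMk_left) (measurableSet_singleton e)
    have hg : Measurable fun ω => G (lam, ω) := hG.comp measurable_prodMk_left
    have h1 : ∀ e, ∀ᵐ ω ∂κ lam, f (lam, ω) = e → G (lam, ω) ∈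
        (((κ lam).restrict {ω | f (lam, ω) = e}).map fun ω => G (lam, ω)).support := by
      intro e
      have h2 := ae_of_ae_map hg.aemeasurable (Measure.support_mem_ae
        (μ := ((κ lam).restrict {ω | f (lam, ω) = e}).map fun ω => G (lam, ω)))
      exact (ae_restrict_iff' (hA e)).1 h2
    filter_upwards [ae_all_iff.2 h1] with ω hω n
    have h3 := hω (f (lam, ω)) rfl
    rw [Measure.mem_support_iff_forall] at h3
    have h4 := h3 _ (Metric.closedBall_mem_nhds (G (lam, ω))
      (show (0 : ℝ) < 1 / ((n : ℝ) + 1) by positivity))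
    rw [Measure.map_apply hg Metric.isClosed_closedBall.measurableSet,
      Measure.restrict_apply (hg Metric.isClosed_closedBall.measurableSet), inter_comm] at h4
    exact ENNReal.toReal_pos h4.ne' (measure_ne_top _ _)
  filter_upwards [key] with p hp r hr
  obtain ⟨n, hn⟩ := exists_nat_one_div_lt hr
  exact (hp n).trans_le (measureReal_mono (fun ω hω => ⟨hω.1, hω.2.trans hn.le⟩)
    (measure_ne_top _ _))

variable [IsProbabilityMeasure m]

theorem condEntropy_base_eq (hf : Measurable f) :
    condEntropy (m ⊗ₘ κ) f (MeasurableSpace.comap Prod.fst inferInstance) =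
      ∫⁻ p, ENNReal.ofReal (-Real.log ((κ p.1).real {ω | f (p.1, ω) = f p})) ∂(m ⊗ₘ κ) := by
  have hfe : ∀ e, MeasurableSet (f ⁻¹' {e}) := fun e => hf (measurableSet_singleton e)
  have hD : ∀ e, Measurable fun lam => κ lam {ω | f (lam, ω) = e} := fun e =>
    Kernel.measurable_kernel_prodMk_left (hfe e)
  refine condEntropy_comap_eq (D := fun e lam => κ lam {ω | f (lam, ω) = e}) measurable_fst hfe hD
    fun e B hB => ?_
  have hS : MeasurableSet (f ⁻¹' {e} ∩ Prod.fst ⁻¹' B) := (hfe e).inter (measurable_fst hB)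
  have hI : Measurable ((Prod.fst ⁻¹' B).indicator
      fun p : Λ × Ω => κ p.1 {ω | f (p.1, ω) = e}) :=
    ((hD e).comp measurable_fst).indicator (measurable_fst hB)
  rw [Measure.compProd_apply hS, ← lintegral_indicator (measurable_fst hB),
    Measure.lintegral_compProd hI]
  refine lintegral_congr fun lam => ?_
  by_cases hl : lam ∈ B
  · have : Prod.mk lam ⁻¹' (f ⁻¹' {e} ∩ Prod.fst ⁻¹' B) = {ω | f (lam, ω) = e} := by
      ext ω; simp [hl]
    simp [indicator, hl, this]
  · have : Prod.mk lam ⁻¹' (f ⁻¹' {e} ∩ Prod.fst ⁻¹' B) = ∅ := by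
      ext ω; simp [hl]
    simp [indicator, hl, this]

/-- The maximal information over all radii is integrable as soon as the fibrewise entropy of the
partition is finite. -/
theorem lintegral_iSup_ballInfo_lt_top [HasBesicovitchCovering Y] (hf : Measurable f)
    (hG : Measurable G)
    (hH : condEntropy (m ⊗ₘ κ) f (MeasurableSpace.comap Prod.fst inferInstance) < ⊤) :
    ∫⁻ p, ⨆ r : {r : ℚ // 0 < r}, ENNReal.ofReal (ballInfo κ f G (r.1 : ℝ) p) ∂(m ⊗ₘ κ) < ⊤ := by
  obtain ⟨C, hC, hCF⟩ := exists_lintegral_iSup_info_le (Y := Y)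
  set F : Λ × Ω → ℝ≥0∞ := fun p =>
    ⨆ r : {r : ℚ // 0 < r}, ENNReal.ofReal (ballInfo κ f G (r.1 : ℝ) p) with hF
  have hFm : Measurable F := .iSup fun r => (measurable_ballInfo hf hG _).ennreal_ofReal
  set H : Λ × Ω → ℝ≥0∞ := fun p =>
    ENNReal.ofReal (-Real.log ((κ p.1).real {ω | f (p.1, ω) = f p})) + C with hHdef
  have hHm : Measurable H := by
    have h1 : Measurable fun p : Λ × Ω => κ p.1 {ω | f (p.1, ω) = f p} :=
      Kernel.measurable_kernel_prodMk_left (κ := κ.comap Prod.fst measurable_fst)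
        (t := {x : (Λ × Ω) × Ω | f (x.1.1, x.2) = f x.1})
        (measurableSet_eq_fun (hf.comp ((measurable_fst.comp measurable_fst).prodMk measurable_snd))
          (hf.comp measurable_fst))
    exact h1.ennreal_toReal.log.neg.ennreal_ofReal.add_const _
  have hle : ∀ lam, ∫⁻ ω, F (lam, ω) ∂κ lam ≤ ∫⁻ ω, H (lam, ω) ∂κ lam := by
    intro lam
    have hA : ∀ e, MeasurableSet {ω | f (lam, ω) = e} := fun e =>
      (hf.comp measurable_prodMk_left) (measurableSet_singleton e)
    have hdis : Pairwise (Function.onFun Disjoint fun e => {ω | f (lam, ω) = e}) := by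
      intro e e' hee'
      exact disjoint_left.2 fun ω h h' => hee' (h.symm.trans h')
    have huniv : ⋃ e, {ω | f (lam, ω) = e} = univ := by
      ext ω; simp
    rw [← setLIntegral_univ, ← huniv, lintegral_iUnion hA hdis, ← setLIntegral_univ, ← huniv,
      lintegral_iUnion hA hdis]
    refine ENNReal.tsum_le_tsum fun e => ?_
    refine (hCF (κ lam) (fun ω => G (lam, ω)) {ω | f (lam, ω) = e}
      (hG.comp measurable_prodMk_left) (hA e) (fun ω => F (lam, ω))
      (hFm.comp measurable_prodMk_left) (fun ω hω => ?_)).trans (le_of_eq ?_)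
    · rw [← show f (lam, ω) = e from hω]
      rfl
    · refine setLIntegral_congr_fun (hA e) fun ω hω => ?_
      rw [← show f (lam, ω) = e from hω]
  rw [Measure.lintegral_compProd hFm]
  refine (lintegral_mono hle).trans_lt ?_
  rw [← Measure.lintegral_compProd hHm, lintegral_add_right _ measurable_const, ← condEntropy_base_eq hf]
  simpa using ⟨hH, hC.lt_top⟩

end BallInfo

/-- The pushforwards of the restrictions of the conditional measures depend measurably on the
parameter. -/
theorem ProbabilityTheory.exists_kernel_map_restrict {Λ Ω Y : Type*} [MeasurableSpace Λ]
    [MeasurableSpace Ω] [MeasurableSpace Y] (κ : Kernel Λ Ω) [IsMarkovKernel κ] {G : Λ × Ω → Y}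
    {A : Set (Λ × Ω)} (hA : MeasurableSet A) (hG : Measurable G) :
    ∃ N : Kernel Λ Y, IsFiniteKernel N ∧ ∀ lam,
      N lam = ((κ lam).restrict (Prod.mk lam ⁻¹' A)).map fun ω => G (lam, ω) := by
  refine ⟨((Kernel.id ×ₖ κ).restrict hA).map G, inferInstance, fun lam => ?_⟩
  rw [Kernel.map_apply _ hG, Kernel.restrict_apply, Kernel.prod_apply, Kernel.id_apply,
    Measure.dirac_prod, Measure.restrict_map measurable_prodMk_left hA,
    Measure.map_map hG measurable_prodMk_left]
  rfl

section BallInfoLimit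

variable {Λ Ω E Y : Type*} [MeasurableSpace Λ] [MeasurableSpace Ω]
  [MetricSpace Y] [SecondCountableTopology Y] [MeasurableSpace Y] [BorelSpace Y]
  {κ : Kernel Λ Ω} [IsMarkovKernel κ] {f : Λ × Ω → E} {G : Λ × Ω → Y}
  [MeasurableSpace E] [Countable E] [MeasurableSingletonClass E]
  {m : Measure Λ} [IsProbabilityMeasure m]

/-- The conditional probability of the cell `f = e`, given the first coordinate and `G`, is a
density that is the limit of the relative masses of the cell in shrinking balls. -/
theorem exists_density_tendsto [HasBesicovitchCovering Y] (hf : Measurable f) (hG : Measurable G)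
    (e : E) :
    ∃ D : Λ × Y → ℝ≥0∞, Measurable D ∧
      (∀ B, MeasurableSet B → ∫⁻ p in (fun p : Λ × Ω => (p.1, G p)) ⁻¹' B, D (p.1, G p) ∂(m ⊗ₘ κ) =
        (m ⊗ₘ κ) (f ⁻¹' {e} ∩ (fun p : Λ × Ω => (p.1, G p)) ⁻¹' B)) ∧
      ∀ᵐ p ∂(m ⊗ₘ κ), f p = e →
        Tendsto (fun r => cellBallMass κ f G r p / ballMass κ G r p) (𝓝[>] 0)
          (𝓝 (D (p.1, G p)).toReal) := by
  have hfe : MeasurableSet (f ⁻¹' {e}) := hf (measurableSet_singleton e)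
  obtain ⟨N, hNf, hN⟩ := exists_kernel_map_restrict (G := G) κ MeasurableSet.univ hG
  obtain ⟨M, hMf, hM⟩ := exists_kernel_map_restrict (G := G) κ hfe hG
  simp only [preimage_univ, Measure.restrict_univ] at hN
  have hGl : ∀ lam, Measurable fun ω => G (lam, ω) := fun lam => hG.comp measurable_prodMk_left
  have hΨ : Measurable fun p : Λ × Ω => (p.1, G p) := measurable_fst.prodMk hG
  have hfl : ∀ lam, MeasurableSet (Prod.mk lam ⁻¹' (f ⁻¹' {e})) := fun lam =>
    measurable_prodMk_left hfe
  have hac : ∀ lam, M lam ≪ N lam := fun lam => by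
    rw [hN, hM]
    exact Measure.AbsolutelyContinuous.map Measure.restrict_le_self.absolutelyContinuous (hGl lam)
  have hDm : Measurable fun x : Λ × Y => Kernel.rnDeriv M N x.1 x.2 :=
    Kernel.measurable_rnDeriv M N
  refine ⟨fun x => Kernel.rnDeriv M N x.1 x.2, hDm, fun B hB => ?_, ?_⟩
  · have hI : Measurable (((fun p : Λ × Ω => (p.1, G p)) ⁻¹' B).indicator
        fun p : Λ × Ω => Kernel.rnDeriv M N p.1 (G p)) := (hDm.comp hΨ).indicator (hΨ hB)
    rw [← lintegral_indicator (hΨ hB), Measure.lintegral_compProd hI,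
      Measure.compProd_apply (hfe.inter (hΨ hB))]
    refine lintegral_congr fun lam => ?_
    have hBl : MeasurableSet (Prod.mk lam ⁻¹' B) := measurable_prodMk_left hB
    have h1 := Kernel.setLIntegral_rnDeriv (hac lam) hBl
    rw [← lintegral_indicator hBl, hN, lintegral_map
      ((Kernel.measurable_rnDeriv_right M N lam).indicator hBl) (hGl lam), hM,
      Measure.map_apply (hGl lam) hBl, Measure.restrict_apply (hGl lam hBl), inter_comm] at h1
    exact h1
  -- the limit is taken over rational radii to have a measurable event, and extended to all radii by
  -- right continuity
  · have hset : MeasurableSet {p : Λ × Ω | f p = e → Tendsto (fun r : ℚ =>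
        cellBallMass κ f G r p / ballMass κ G r p) (comap ((↑) : ℚ → ℝ) (𝓝[>] 0))
          (𝓝 (Kernel.rnDeriv M N p.1 (G p)).toReal)} := by
      have h1 : MeasurableSet {p : Λ × Ω | Tendsto (fun r : ℚ =>
        cellBallMass κ f G r p / ballMass κ G r p) (comap ((↑) : ℚ → ℝ) (𝓝[>] 0))
          (𝓝 (Kernel.rnDeriv M N p.1 (G p)).toReal)} :=
        measurableSet_tendsto_fun (fun r => (measurable_cellBallMass hf hG _).div
          (measurable_ballMass hG _)) (hDm.comp hΨ).ennreal_toReal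
      have h2 := hfe.compl.union h1
      convert h2 using 1
      ext p
      simp [imp_iff_not_or]
    have hae : ∀ᵐ p ∂(m ⊗ₘ κ), f p = e → Tendsto (fun r : ℚ =>
        cellBallMass κ f G r p / ballMass κ G r p) (comap ((↑) : ℚ → ℝ) (𝓝[>] 0))
          (𝓝 (Kernel.rnDeriv M N p.1 (G p)).toReal) := by
      refine Measure.ae_compProd_of_ae_ae hset (ae_of_all _ fun lam => ?_)
      have h1 : ∀ᵐ y ∂N lam, Tendsto (fun r => (M lam (Metric.closedBall y r) /
          N lam (Metric.closedBall y r)).toReal) (𝓝[>] 0)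
          (𝓝 (Kernel.rnDeriv M N lam y).toReal) := by
        filter_upwards [Besicovitch.ae_tendsto_rnDeriv (M lam) (N lam),
          Kernel.rnDeriv_eq_rnDeriv_measure (κ := M) (η := N) (a := lam),
          Kernel.rnDeriv_ne_top M N (a := lam)] with y h1 h2 h3
        rw [h2] at h3 ⊢
        exact (ENNReal.tendsto_toReal h3).comp h1
      rw [hN] at h1
      filter_upwards [ae_of_ae_map (hGl lam).aemeasurable h1] with ω hω hfω
      refine (hω.comp tendsto_comap).congr fun r => ?_
      have hcb : MeasurableSet (Metric.closedBall (G (lam, ω)) (r : ℝ)) :=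
        Metric.isClosed_closedBall.measurableSet
      rw [Function.comp, hM, Measure.map_apply (hGl lam) hcb, Measure.map_apply (hGl lam) hcb,
        Measure.restrict_apply (hGl lam hcb), ENNReal.toReal_div, inter_comm]
      simp only [cellBallMass, ballMass, hfω]
      rfl
    filter_upwards [hae, ae_forall_cellBallMass_pos (m := m) hf hG] with p hp hpos hfp
    have h1 := hp hfp
    set L := (Kernel.rnDeriv M N p.1 (G p)).toReal
    rw [Metric.tendsto_nhds] at h1 ⊢
    intro ε hε
    have h2 := h1 (ε / 2) (half_pos hε)
    rw [eventually_comap, eventually_nhdsWithin_iff, Metric.eventually_nhds_iff] at h2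
    obtain ⟨δ, hδ, h2⟩ := h2
    rw [eventually_nhdsWithin_iff, Metric.eventually_nhds_iff]
    refine ⟨δ, hδ, fun r hr hr0 => ?_⟩
    have hr' : r < δ := by simpa [abs_of_pos (show (0 : ℝ) < r from hr0)] using hr
    refine (forall_pos_le_of_forall_rat (C := ε / 2)
      (h := fun r => dist (cellBallMass κ f G r p / ballMass κ G r p) L) (fun r hr => ?_)
      (fun r hr0 hr => ?_) r hr0 hr').trans_lt (half_lt_self hε)
    · exact ((continuousWithinAt_cellBallMass_div hf hG (hpos r hr)).dist continuousWithinAt_const)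
    · exact (h2 (by rwa [Real.dist_eq, sub_zero, abs_of_pos hr0]) hr0 r rfl).le

/-- The information of a cell given a shrinking ball is dominated by an integrable function and
converges to the information given the first coordinate and `G`, whose integral is the conditional
entropy. -/
theorem exists_ballInfo_limit [HasBesicovitchCovering Y] (hf : Measurable f) (hG : Measurable G)
    (hH : condEntropy (m ⊗ₘ κ) f (MeasurableSpace.comap Prod.fst inferInstance) < ⊤) :
    condEntropy (m ⊗ₘ κ) f (MeasurableSpace.comap Prod.fst inferInstance ⊔
        MeasurableSpace.comap G inferInstance) < ⊤ ∧
      ∃ g F : Λ × Ω → ℝ, Measurable g ∧ Integrable F (m ⊗ₘ κ) ∧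
        ∫ p, g p ∂(m ⊗ₘ κ) = (condEntropy (m ⊗ₘ κ) f (MeasurableSpace.comap Prod.fst inferInstance ⊔
          MeasurableSpace.comap G inferInstance)).toReal ∧
        (∀ᵐ p ∂(m ⊗ₘ κ), ∀ r > 0, |ballInfo κ f G r p| ≤ F p) ∧
        ∀ᵐ p ∂(m ⊗ₘ κ), Tendsto (fun r => ballInfo κ f G r p) (𝓝[>] 0) (𝓝 (g p)) := by
  have hfe : ∀ e, MeasurableSet (f ⁻¹' {e}) := fun e => hf (measurableSet_singleton e)
  have hΨ : Measurable fun p : Λ × Ω => (p.1, G p) := measurable_fst.prodMk hG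
  choose D hDm hDint hDlim using exists_density_tendsto (κ := κ) (m := m) hf hG
  have hsup : MeasurableSpace.comap Prod.fst inferInstance ⊔ MeasurableSpace.comap G inferInstance
      = MeasurableSpace.comap (fun p : Λ × Ω => (p.1, G p)) inferInstance := by
    simp only [Prod.instMeasurableSpace, MeasurableSpace.prod, MeasurableSpace.comap_sup,
      MeasurableSpace.comap_comp]
    rfl
  rw [hsup, condEntropy_comap_eq hΨ hfe hDm hDint]
  set Fe : Λ × Ω → ℝ≥0∞ := fun p =>
    ⨆ r : {r : ℚ // 0 < r}, ENNReal.ofReal (ballInfo κ f G (r.1 : ℝ) p) with hFe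
  have hFm : Measurable Fe := .iSup fun r => (measurable_ballInfo hf hG _).ennreal_ofReal
  have hFlt : ∫⁻ p, Fe p ∂(m ⊗ₘ κ) < ⊤ := lintegral_iSup_ballInfo_lt_top hf hG hH
  have hpos := ae_forall_cellBallMass_pos (κ := κ) (m := m) hf hG
  have hdom : ∀ᵐ p ∂(m ⊗ₘ κ), ∀ r > 0, ballInfo κ f G r p ≤ (Fe p).toReal := by
    filter_upwards [ae_lt_top hFm hFlt.ne, hpos] with p hp hpos r hr
    refine forall_pos_le_of_forall_rat (h := fun r => ballInfo κ f G r p) (δ := r + 1)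
      (fun r hr => continuousWithinAt_ballInfo hf hG (hpos r hr)) (fun r hr0 _ => ?_) r hr
      (lt_add_one r)
    rw [← ENNReal.ofReal_le_iff_le_toReal hp.ne]
    exact le_iSup (fun r : {r : ℚ // 0 < r} => ENNReal.ofReal (ballInfo κ f G (r.1 : ℝ) p))
      ⟨r, by exact_mod_cast hr0⟩
  have hfDm : Measurable fun p : Λ × Ω => D (f p) (p.1, G p) := by
    have : Measurable fun x : E × (Λ × Y) => D x.1 x.2 :=
      measurable_from_prod_countable_right fun e => hDm e
    exact this.comp (hf.prodMk hΨ)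
  have hlim : ∀ᵐ p ∂(m ⊗ₘ κ), Tendsto (fun r => ballInfo κ f G r p) (𝓝[>] 0)
      (𝓝 (-Real.log (D (f p) (p.1, G p)).toReal)) := by
    filter_upwards [hdom, hpos, ae_all_iff.2 hDlim] with p hdom hpos hp
    have h1 := hp (f p) rfl
    -- the domination of the information keeps the limit of the ratios away from `0`
    have hge : Real.exp (-(Fe p).toReal) ≤ (D (f p) (p.1, G p)).toReal := by
      refine ge_of_tendsto h1 ?_
      filter_upwards [self_mem_nhdsWithin] with r hr
      have hc := hpos r hr
      have hb := hc.trans_le (cellBallMass_le_ballMass r p)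
      rw [← Real.le_log_iff_exp_le (div_pos hc hb)]
      have := hdom r hr
      rw [ballInfo] at this
      linarith
    exact (h1.log ((Real.exp_pos _).trans_le hge).ne').neg
  have hgm : Measurable fun p : Λ × Ω => -Real.log (D (f p) (p.1, G p)).toReal :=
    hfDm.ennreal_toReal.log.neg
  have hFint : Integrable (fun p => (Fe p).toReal) (m ⊗ₘ κ) :=
    integrable_toReal_of_lintegral_ne_top hFm.aemeasurable hFlt.ne
  have hg0 : ∀ᵐ p ∂(m ⊗ₘ κ), 0 ≤ -Real.log (D (f p) (p.1, G p)).toReal := by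
    filter_upwards [hlim] with p hp
    exact ge_of_tendsto' hp fun r => ballInfo_nonneg r p
  have hgF : ∀ᵐ p ∂(m ⊗ₘ κ), -Real.log (D (f p) (p.1, G p)).toReal ≤ (Fe p).toReal := by
    filter_upwards [hlim, hdom] with p hp hdom
    refine le_of_tendsto hp ?_
    filter_upwards [self_mem_nhdsWithin] with r hr using hdom r hr
  refine ⟨?_, _, fun p => (Fe p).toReal, hgm, hFint, ?_, ?_, hlim⟩
  · refine (lintegral_mono_ae ?_).trans_lt hFlt
    filter_upwards [hgF, ae_lt_top hFm hFlt.ne] with p hp hp'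
    exact ENNReal.ofReal_le_of_le_toReal hp
  · exact integral_eq_lintegral_of_nonneg_ae hg0 hgm.aestronglyMeasurable
  · filter_upwards [hdom] with p hp r hr
    rw [abs_of_nonneg (ballInfo_nonneg r p)]
    exact hp r hr

end BallInfoLimit

/-! ### The coding map -/

theorem measurable_shift {E : Type*} [MeasurableSpace E] : Measurable (shift : (ℕ → E) → ℕ → E) :=
  measurable_pi_lambda _ fun n => measurable_pi_apply (n + 1)

theorem measurable_firstLetter {Λ E : Type*} [MeasurableSpace Λ] [MeasurableSpace E] :
    Measurable (firstLetter : Λ × (ℕ → E) → E) :=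
  (measurable_pi_apply 0).comp measurable_snd

namespace RandomCIFS

variable {q : ℕ} {Λ : Type*} [MeasurableSpace Λ] {m : Measure Λ} {E : Type*}
  (S : RandomCIFS q m E)

theorem coding_mem (lam : Λ) (ω : ℕ → E) (n : ℕ) :
    S.coding lam ω ∈ S.iter lam ω (n + 1) '' S.X := by
  have h : S.coding lam ω ∈ ⋂ n : ℕ, S.iter lam ω (n + 1) '' S.X := by
    rw [S.iInter_eq_coding]; rfl
  exact mem_iInter.1 h n

theorem coding_mem_X (lam : Λ) (ω : ℕ → E) : S.coding lam ω ∈ S.X := by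
  obtain ⟨x, hx, h⟩ := S.coding_mem lam ω 0
  rw [← h]
  exact S.mapsTo_X _ _ hx

theorem tendsto_iter_coding (lam : Λ) (ω : ℕ → E) {x : EuclideanSpace ℝ (Fin q)} (hx : x ∈ S.X) :
    Tendsto (fun n => S.iter lam ω (n + 1) x) atTop (𝓝 (S.coding lam ω)) := by
  rw [tendsto_iff_dist_tendsto_zero]
  have hlim : Tendsto (fun n : ℕ => (S.s : ℝ) ^ (n + 1) * Metric.diam S.X) atTop (𝓝 0) := by
    have h := ((tendsto_pow_atTop_nhds_zero_of_lt_one S.s.coe_nonneg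
      (by exact_mod_cast S.s_lt_one)).comp (tendsto_add_atTop_nat 1)).mul_const (Metric.diam S.X)
    simpa using h
  refine squeeze_zero (fun _ => dist_nonneg) (fun n => ?_) hlim
  obtain ⟨y, hy, h⟩ := S.coding_mem lam ω n
  rw [← h]
  refine ((S.iter_lipschitz lam ω (n + 1)).dist_le_mul x hx y hy).trans ?_
  push_cast
  exact mul_le_mul_of_nonneg_left (Metric.dist_le_diam_of_mem S.isCompact_X.isBounded hx hy)
    (by positivity)

theorem iter_succ_eq (lam : Λ) (ω : ℕ → E) (n : ℕ) (x : EuclideanSpace ℝ (Fin q)) :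
    S.iter lam ω (n + 1) x = S.φ (ω 0) lam (S.iter (S.θ lam) (shift ω) n x) := by
  induction n generalizing x with
  | zero => rfl
  | succ n ih =>
    change S.iter lam ω (n + 1) (S.φ (ω (n + 1)) (S.θ^[n + 1] lam) x) = _
    rw [ih]
    rfl

theorem coding_eq (lam : Λ) (ω : ℕ → E) :
    S.coding lam ω = S.φ (ω 0) lam (S.coding (S.θ lam) (shift ω)) := by
  obtain ⟨x, hx⟩ := S.isConnected_X.nonempty
  have h1 := (S.tendsto_iter_coding lam ω hx).comp (tendsto_add_atTop_nat 1)
  have h2 := S.tendsto_iter_coding (S.θ lam) (shift ω) hx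
  have hm : ∀ (n : ℕ) (lam : Λ) (ω : ℕ → E) (y), y ∈ S.X → S.iter lam ω n y ∈ S.X := by
    intro n lam ω
    induction n with
    | zero => exact fun y hy => hy
    | succ n ih => exact fun y hy => ih _ (S.mapsTo_X _ _ hy)
  have h3 : ContinuousWithinAt (S.φ (ω 0) lam) S.X (S.coding (S.θ lam) (shift ω)) :=
    (S.lipschitz_X _ _).continuousOn _ (S.coding_mem_X _ _)
  have h4 := h3.tendsto.comp (tendsto_nhdsWithin_iff.2 ⟨h2, Eventually.of_forall fun n =>
    hm (n + 1) _ _ x hx⟩)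
  refine tendsto_nhds_unique h1 (h4.congr fun n => ?_)
  exact (S.iter_succ_eq lam ω (n + 1) x).symm

theorem proj_eq (p : Λ × (ℕ → E)) : S.proj p = S.φ (p.2 0) p.1 (S.proj (S.skew p)) :=
  S.coding_eq p.1 p.2

theorem proj_mem_X (p : Λ × (ℕ → E)) : S.proj p ∈ S.X := S.coding_mem_X _ _

/-- The scaling factor of the first map at the coding point of the shifted sequence. -/
noncomputable def firstScale (S : RandomCIFS q m E) (p : Λ × (ℕ → E)) : ℝ :=
  S.scale (p.2 0) p.1 (S.proj (S.skew p))

theorem firstScale_pos (hq : 1 ≤ q) (p : Λ × (ℕ → E)) : 0 < S.firstScale p :=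
  S.scale_pos hq _ _ (S.X_subset_W (S.proj_mem_X _))

theorem firstScale_le (p : Λ × (ℕ → E)) : S.firstScale p ≤ S.s :=
  S.scale_le _ _ (S.proj_mem_X _)

/-- At interior points of `X` the scaling factor is a limit of difference quotients within `X`, where
the measurability of the generators is known. -/
theorem measurable_scale (hq : 1 ≤ q) (e : E) {y : EuclideanSpace ℝ (Fin q)} (hy : y ∈ S.X) :
    Measurable fun lam => S.scale e lam y := by
  have hint : ∀ y ∈ interior S.X, Measurable fun lam => S.scale e lam y := by
    intro y hy
    have := nontrivial_space hq
    obtain ⟨v, hv⟩ := exists_norm_eq (EuclideanSpace ℝ (Fin q)) (zero_le_one' ℝ)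
    obtain ⟨δ, hδ, hb⟩ := Metric.isOpen_iff.1 isOpen_interior y hy
    obtain ⟨t, ht0, htδ, htl⟩ : ∃ t : ℕ → ℝ, (∀ n, 0 < t n) ∧ (∀ n, t n < δ) ∧
        Tendsto t atTop (𝓝[≠] 0) := by
      obtain ⟨t, -, h0, h1⟩ := exists_seq_strictAnti_tendsto' hδ
      exact ⟨t, fun n => (h0 n).1, fun n => (h0 n).2,
        tendsto_nhdsWithin_iff.2 ⟨h1, Eventually.of_forall fun n => (h0 n).1.ne'⟩⟩
    have htX : ∀ n, y + t n • v ∈ S.X := by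
      intro n
      refine interior_subset (hb ?_)
      rw [Metric.mem_ball, dist_self_add_left, norm_smul, hv, mul_one, Real.norm_eq_abs,
        abs_of_pos (ht0 n)]
      exact htδ n
    have hyX := interior_subset hy
    have hm : ∀ n, Measurable fun lam => ‖(t n)⁻¹ • (S.φ e lam (y + t n • v) - S.φ e lam y)‖ := by
      intro n
      have h1 := S.measurable_φ e _ (htX n)
      have h2 := S.measurable_φ e _ hyX
      have h3 : Measurable fun lam => S.φ e lam (y + t n • v) - S.φ e lam y := h1.sub h2
      simp only [norm_smul]
      exact h3.norm.const_mul _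
    refine measurable_of_tendsto_metrizable hm ?_
    refine tendsto_pi_nhds.2 fun lam => ?_
    have h1 : Tendsto (fun t : ℝ => t⁻¹ • (S.φ e lam (y + t • v) - S.φ e lam y)) (𝓝[≠] 0)
        (𝓝 (fderiv ℝ (S.φ e lam) y v)) :=
      ((S.hasStrictFDerivAt_φ e lam (S.X_subset_W hyX)).hasFDerivAt.hasLineDerivAt
        v).tendsto_slope_zero
    have h2 := (h1.comp htl).norm
    rw [S.norm_fderiv_apply hq e lam (S.X_subset_W hyX), hv, mul_one] at h2
    exact h2
  have hyc : y ∈ closure (interior S.X) := by rwa [S.closure_interior_X]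
  obtain ⟨u, hu, huy⟩ := mem_closure_iff_seq_limit.1 hyc
  refine measurable_of_tendsto_metrizable (fun n => hint _ (hu n)) (tendsto_pi_nhds.2 fun lam => ?_)
  have hc : ContinuousAt (fderiv ℝ (S.φ e lam)) y :=
    (S.continuousOn_fderiv_φ e lam).continuousAt (S.isOpen_W.mem_nhds (S.X_subset_W hy))
  exact (hc.norm.tendsto).comp huy

section Measurability

variable [MeasurableSpace E]

theorem measurable_skew : Measurable (S.skew) :=
  S.θ.measurable.prodMap measurable_shift

variable [Countable E] [MeasurableSingletonClass E] {α : Type*} [MeasurableSpace α]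
  {a : α → E} {l : α → Λ} {x : α → EuclideanSpace ℝ (Fin q)}

/-- Carathéodory functions on `E × Λ × X` are jointly measurable. -/
theorem measurable_caratheodory {Y : Type*} [TopologicalSpace Y]
    [TopologicalSpace.PseudoMetrizableSpace Y] [MeasurableSpace Y] [BorelSpace Y] {u : E → Λ → EuclideanSpace ℝ (Fin q) → Y}
    (hc : ∀ e lam, ContinuousOn (u e lam) S.X) (hm : ∀ e, ∀ y ∈ S.X, Measurable fun lam => u e lam y)
    (ha : Measurable a) (hl : Measurable l) (hx : Measurable x) (hxX : ∀ p, x p ∈ S.X) :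
    Measurable fun p => u (a p) (l p) (x p) := by
  have h1 : ∀ e, Measurable (Function.uncurry fun (y : S.X) (lam : Λ) => u e lam y) := fun e =>
    measurable_uncurry_of_continuous_of_measurable
      (fun lam => continuousOn_iff_continuous_domRestrict.1 (hc e lam)) (fun y => hm e y y.2)
  have h2 : Measurable fun z : E × (S.X × Λ) => u z.1 z.2.2 z.2.1 :=
    measurable_from_prod_countable_right fun e => h1 e
  exact h2.comp (ha.prodMk ((hx.subtype_mk (h := hxX)).prodMk hl))

theorem measurable_φ_comp (ha : Measurable a) (hl : Measurable l) (hx : Measurable x)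
    (hxX : ∀ p, x p ∈ S.X) : Measurable fun p => S.φ (a p) (l p) (x p) :=
  S.measurable_caratheodory (fun e lam => (S.lipschitz_X e lam).continuousOn) S.measurable_φ
    ha hl hx hxX

theorem measurable_iter (n : ℕ) {w : α → ℕ → E} (hw : Measurable w) (hl : Measurable l)
    (hx : Measurable x) (hxX : ∀ p, x p ∈ S.X) :
    Measurable fun p => S.iter (l p) (w p) n (x p) := by
  induction n generalizing x with
  | zero => exact hx
  | succ n ih =>
    exact ih (S.measurable_φ_comp ((measurable_pi_apply n).comp hw)
      ((S.θ.measurable.iterate n).comp hl) hx hxX) fun p => S.mapsTo_X _ _ (hxX p)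

theorem measurable_proj : Measurable S.proj := by
  obtain ⟨x, hx⟩ := S.isConnected_X.nonempty
  exact measurable_of_tendsto_metrizable
    (fun n => S.measurable_iter (n + 1) measurable_snd measurable_fst measurable_const fun _ => hx)
    (tendsto_pi_nhds.2 fun p => S.tendsto_iter_coding p.1 p.2 hx)

theorem measurable_firstScale (hq : 1 ≤ q) : Measurable S.firstScale :=
  S.measurable_caratheodory (u := fun e lam y => S.scale e lam y)
    (fun e lam => ((S.continuousOn_fderiv_φ e lam).mono S.X_subset_W).norm)
    (fun e _ hy => S.measurable_scale hq e hy) measurable_firstLetter measurable_fst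
    (S.measurable_proj.comp S.measurable_skew) fun _ => S.proj_mem_X _

end Measurability

/-! ### Invariance of the conditional measures -/

variable [MeasurableSpace E] [Countable E] [MeasurableSingletonClass E]

/-- The conditional measures are equivariant: `κ_λ ∘ σ⁻¹ = κ_{θ λ}` for almost every `λ`. -/
theorem ae_map_shift_eq [IsProbabilityMeasure m] (κ : Kernel Λ (ℕ → E)) [IsMarkovKernel κ]
    (hμ : MeasurePreserving S.skew (m ⊗ₘ κ) (m ⊗ₘ κ)) :
    ∀ᵐ lam ∂m, (κ lam).map shift = κ (S.θ lam) := by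
  have hθ : MeasurePreserving S.θ m m := S.ergodic_θ.toMeasurePreserving
  have hk : κ.map shift =ᵐ[m] κ.comap S.θ S.θ.measurable := by
    refine Kernel.ae_eq_of_compProd_eq ?_
    ext A hA
    have h1 : MeasurableSet (Prod.map S.θ.symm id ⁻¹' A : Set (Λ × (ℕ → E))) :=
      (S.θ.symm.measurable.prodMap measurable_id) hA
    have h2 := hμ.measure_preimage h1.nullMeasurableSet
    have h3 : S.skew ⁻¹' (Prod.map S.θ.symm id ⁻¹' A) = Prod.map id shift ⁻¹' A := by
      ext p
      simp [skew, Prod.map]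
    rw [h3, Measure.compProd_apply ((measurable_id.prodMap measurable_shift) hA),
      Measure.compProd_apply h1] at h2
    rw [Measure.compProd_apply hA, Measure.compProd_apply hA]
    have h4 := hθ.lintegral_comp_emb S.θ.measurableEmbedding
      fun lam => κ lam (Prod.mk lam ⁻¹' (Prod.map S.θ.symm id ⁻¹' A))
    calc ∫⁻ lam, (κ.map shift) lam (Prod.mk lam ⁻¹' A) ∂m
        = ∫⁻ lam, κ lam (Prod.mk lam ⁻¹' (Prod.map id shift ⁻¹' A)) ∂m := by
          refine lintegral_congr fun lam => ?_
          rw [Kernel.map_apply' _ measurable_shift _ (measurable_prodMk_left hA)]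
          rfl
      _ = _ := by
          rw [h2, ← h4]
          refine lintegral_congr fun lam => ?_
          rw [Kernel.comap_apply]
          congr 1
          ext ω
          simp
  filter_upwards [hk] with lam h
  rwa [Kernel.map_apply _ measurable_shift, Kernel.comap_apply] at h

end RandomCIFS

/-! ### Interpolation between a sequence of radii -/

section Interpolation

variable {R b : ℕ → ℝ} {ℓ : ℝ → ℝ} {A B c : ℝ}

theorem eventually_exists_between (hR0 : ∀ n, 0 < R n) (hR : Tendsto R atTop (𝓝 0)) (n₀ : ℕ) :
    ∀ᶠ r in 𝓝[>] (0 : ℝ), ∃ n ≥ n₀, R (n + 1) < r ∧ r ≤ R n := by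
  have h1 : ∀ᶠ r in 𝓝[>] (0 : ℝ), ∀ n ∈ Finset.range (n₀ + 1), r ≤ R n :=
    (eventually_all_finset _).2 fun n _ =>
      mem_of_superset (Ioc_mem_nhdsGT (hR0 n)) fun r hr => hr.2
  filter_upwards [h1, self_mem_nhdsWithin] with r hr hr0
  have hex : ∃ n, R n < r := (hR.eventually_lt_const hr0).exists
  classical
  have hpos : n₀ < Nat.find hex := by
    by_contra! h
    exact absurd (Nat.find_spec hex) (not_lt.2 (hr _ (Finset.mem_range.2 (by omega))))
  refine ⟨Nat.find hex - 1, by omega, ?_, ?_⟩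
  · rw [Nat.sub_add_cancel (by omega)]
    exact Nat.find_spec hex
  · exact not_lt.1 (Nat.find_min hex (by omega))

theorem tendsto_succ_div_natCast : Tendsto (fun n : ℕ => ((n + 1 : ℕ) : ℝ) / n) atTop (𝓝 1) := by
  have h := (tendsto_natCast_div_add_atTop (1 : ℝ)).inv₀ one_ne_zero
  simpa using h

/-- An upper bound for the quotient by the logarithm along a sequence of radii extends to all radii
when the logarithms of the sequence grow at least linearly. -/
theorem eventually_div_neg_log_lt (hR0 : ∀ n, 0 < R n) (hR : Tendsto R atTop (𝓝 0))
    (hb : ∀ n r, R n < r → ℓ r ≤ b n) (hB : ∀ᶠ n : ℕ in atTop, b n ≤ n * B)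
    (hA : ∀ᶠ n : ℕ in atTop, n * A ≤ -Real.log (R n)) (hA0 : 0 < A) (hB0 : 0 ≤ B)
    (hc : B / A < c) : ∀ᶠ r in 𝓝[>] (0 : ℝ), ℓ r / -Real.log r < c := by
  have h1 : ∀ᶠ n : ℕ in atTop, ((n + 1 : ℕ) : ℝ) / n * (B / A) < c := by
    have := tendsto_succ_div_natCast.mul_const (B / A)
    rw [one_mul] at this
    exact this.eventually_lt_const hc
  obtain ⟨n₀, h⟩ := eventually_atTop.1
    ((h1.and (((tendsto_add_atTop_nat 1).eventually hB).and hA)).and (eventually_gt_atTop 0))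
  filter_upwards [eventually_exists_between hR0 hR n₀, self_mem_nhdsWithin] with r hr hr0
  obtain ⟨n, hn, hlt, hle⟩ := hr
  obtain ⟨⟨h1, h2, h3⟩, h4⟩ := h n hn
  have hn0 : (0 : ℝ) < n := by exact_mod_cast h4
  have h5 : n * A ≤ -Real.log r := h3.trans (neg_le_neg (Real.log_le_log hr0 hle))
  have h6 : 0 < -Real.log r := (mul_pos hn0 hA0).trans_le h5
  refine lt_of_le_of_lt ?_ h1
  rw [div_mul_div_comm]
  exact div_le_div₀ (by positivity) ((hb _ r hlt).trans h2) (by positivity) h5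

/-- A lower bound for the quotient by the logarithm along a sequence of radii extends to all radii
when the logarithms of the sequence grow at most linearly. -/
theorem eventually_lt_div_neg_log (hR0 : ∀ n, 0 < R n) (hR : Tendsto R atTop (𝓝 0))
    (hb : ∀ n r, 0 < r → r ≤ R n → b n ≤ ℓ r) (hℓ : ∀ r, 0 ≤ ℓ r)
    (hB : ∀ᶠ n : ℕ in atTop, n * B ≤ b n)
    (hA : ∀ᶠ n : ℕ in atTop, -Real.log (R n) ≤ n * A) (hA0 : 0 < A)
    (hc : c < B / A) : ∀ᶠ r in 𝓝[>] (0 : ℝ), c < ℓ r / -Real.log r := by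
  have hpos : ∀ᶠ r in 𝓝[>] (0 : ℝ), r < 1 :=
    mem_of_superset (Ioo_mem_nhdsGT one_pos) fun r hr => hr.2
  rcases lt_or_ge B 0 with hB0 | hB0
  · filter_upwards [self_mem_nhdsWithin, hpos] with r hr0 hr1
    have h1 : 0 < -Real.log r := neg_pos.2 (Real.log_neg hr0 hr1)
    exact (hc.trans (div_neg_of_neg_of_pos hB0 hA0)).trans_le (div_nonneg (hℓ r) h1.le)
  have h1 : ∀ᶠ n : ℕ in atTop, c < (((n + 1 : ℕ) : ℝ) / n)⁻¹ * (B / A) := by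
    have := (tendsto_succ_div_natCast.inv₀ one_ne_zero).mul_const (B / A)
    rw [inv_one, one_mul] at this
    exact this.eventually_const_lt hc
  obtain ⟨n₀, h⟩ := eventually_atTop.1
    ((h1.and (hB.and ((tendsto_add_atTop_nat 1).eventually hA))).and (eventually_gt_atTop 0))
  filter_upwards [eventually_exists_between hR0 hR n₀, self_mem_nhdsWithin, hpos] with r hr hr0 hr1
  obtain ⟨n, hn, hlt, hle⟩ := hr
  obtain ⟨⟨h1, h2, h3⟩, h4⟩ := h n hn
  have h5 : -Real.log r ≤ ((n + 1 : ℕ) : ℝ) * A :=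
    (neg_le_neg (Real.log_le_log (hR0 _) hlt.le)).trans h3
  have h6 : 0 < -Real.log r := neg_pos.2 (Real.log_neg hr0 hr1)
  refine h1.trans_le ?_
  rw [inv_div, div_mul_div_comm]
  exact div_le_div₀ (hℓ r) (h2.trans (hb n r hr0 hle)) h6 h5

end Interpolation

/-! ### Telescoping along an orbit -/

section Telescoping

variable {Ω : Type*} {T : Ω → Ω} {c : Ω → ℝ} {r₀ : ℝ}

/-- The radius obtained from `r₀` at time `n` by multiplying with the factor `c` along the first
`n` points of the orbit. -/
def orbitRadius (T : Ω → Ω) (c : Ω → ℝ) (r₀ : ℝ) : ℕ → Ω → ℝ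
  | 0, _ => r₀
  | n + 1, p => c p * orbitRadius T c r₀ n (T p)

theorem orbitRadius_pos (hr : 0 < r₀) (hc : ∀ p, 0 < c p) (n : ℕ) (p : Ω) :
    0 < orbitRadius T c r₀ n p := by
  induction n generalizing p with
  | zero => exact hr
  | succ n ih => exact mul_pos (hc p) (ih _)

theorem orbitRadius_le {η : ℝ} (hr : 0 < r₀) (hc : ∀ p, 0 < c p) (hη : ∀ p, c p ≤ η) (n : ℕ)
    (p : Ω) : orbitRadius T c r₀ n p ≤ r₀ * η ^ n := by
  induction n generalizing p with
  | zero => simp [orbitRadius]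
  | succ n ih =>
    have := mul_le_mul (hη p) (ih (T p)) (orbitRadius_pos hr hc n _).le
      ((hc p).le.trans (hη p))
    calc orbitRadius T c r₀ (n + 1) p ≤ η * (r₀ * η ^ n) := this
      _ = _ := by ring

theorem neg_log_orbitRadius (hr : 0 < r₀) (hc : ∀ p, 0 < c p) (n : ℕ) (p : Ω) :
    -Real.log (orbitRadius T c r₀ n p) =
      -Real.log r₀ + birkhoffSum T (fun p => -Real.log (c p)) n p := by
  induction n generalizing p with
  | zero => simp [orbitRadius]
  | succ n ih =>
    rw [orbitRadius, Real.log_mul (hc p).ne' (orbitRadius_pos hr hc n _).ne', birkhoffSum_succ',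
      neg_add, ih]
    ring

/-- A one-step inequality between consecutive points of an orbit, valid for radii up to `r₀`, adds up
along the orbit. -/
theorem le_add_sum_orbitRadius {L I J : ℝ → Ω → ℝ} (hr : 0 < r₀) (hc : ∀ p, 0 < c p)
    (hc1 : ∀ p, c p ≤ 1) (p : Ω)
    (h : ∀ k : ℕ, ∀ r, 0 < r → r ≤ r₀ → L (c (T^[k] p) * r) (T^[k] p) ≤
      L r (T^[k + 1] p) + (J r (T^[k] p) - I (c (T^[k] p) * r) (T^[k] p))) (n : ℕ) :
    L (orbitRadius T c r₀ n p) p ≤ L r₀ (T^[n] p) + ∑ k ∈ Finset.range n,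
      (J (orbitRadius T c r₀ (n - 1 - k) (T^[k + 1] p)) (T^[k] p) -
        I (orbitRadius T c r₀ (n - k) (T^[k] p)) (T^[k] p)) := by
  induction n generalizing p with
  | zero => simp [orbitRadius]
  | succ n ih =>
    have h1 := h 0 (orbitRadius T c r₀ n (T p)) (orbitRadius_pos hr hc n _)
      ((orbitRadius_le hr hc hc1 n _).trans (by simp))
    have h2 := ih (T p) fun k => h (k + 1)
    rw [Finset.sum_range_succ']
    simp only [Function.iterate_succ, Function.comp, Function.iterate_zero, id] at h1 h2 ⊢
    have h3 : ∀ k, n - 0 - (k + 1) = n - 1 - k := fun k => by omega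
    have h4 : ∀ k, n + 1 - (k + 1) = n - k := fun k => by omega
    simp only [h3, h4]
    have h5 : orbitRadius T c r₀ (n + 1 - 0) p = c p * orbitRadius T c r₀ n (T p) := rfl
    have h6 : orbitRadius T c r₀ (n + 1) p = c p * orbitRadius T c r₀ n (T p) := rfl
    rw [h5, h6, Nat.sub_zero, Nat.sub_zero]
    linarith

end Telescoping

/-! ### Integrability of the mass of balls of a fixed radius -/

section BallMass

variable {Λ Ω Y : Type*} [MeasurableSpace Λ] [MeasurableSpace Ω]
  [MetricSpace Y] [SecondCountableTopology Y] [MeasurableSpace Y] [BorelSpace Y]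
  {κ : Kernel Λ Ω} [IsMarkovKernel κ] {G : Λ × Ω → Y} {m : Measure Λ} [IsProbabilityMeasure m]

/-- If `G` takes values in a compact set, covered by finitely many pieces of diameter at most `r`,
then each piece contributes at most one to the integral of the inverse of the mass. -/
theorem integrable_neg_log_ballMass (hG : Measurable G) {K : Set Y} (hK : IsCompact K)
    (hGK : ∀ p, G p ∈ K) {r : ℝ} (hr : 0 < r) :
    Integrable (fun p => -Real.log (ballMass κ G r p)) (m ⊗ₘ κ) := by
  have hinv : Measurable fun p : Λ × Ω => (κ p.1 {ω | dist (G (p.1, ω)) (G p) ≤ r})⁻¹ :=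
    (measurable_ballMass_enn hG r).inv
  obtain ⟨t, -, ht, hcov⟩ := hK.finite_cover_balls (half_pos hr)
  have hlint : ∫⁻ p, (κ p.1 {ω | dist (G (p.1, ω)) (G p) ≤ r})⁻¹ ∂(m ⊗ₘ κ) ≠ ⊤ := by
    rw [Measure.lintegral_compProd hinv]
    have hl : ∀ lam, ∫⁻ ω, (κ lam {ω' | dist (G (lam, ω')) (G (lam, ω)) ≤ r})⁻¹ ∂κ lam ≤
        ∑ _x : ht.toFinset, 1 := by
      intro lam
      have hGl : Measurable fun ω => G (lam, ω) := hG.comp measurable_prodMk_left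
      set C : Y → Set Ω := fun x => (fun ω => G (lam, ω)) ⁻¹' Metric.ball x (r / 2) with hC
      have huniv : (univ : Set Ω) ⊆ ⋃ x : ht.toFinset, C x := by
        intro ω _
        have := hcov (hGK (lam, ω))
        simpa [hC] using this
      rw [← setLIntegral_univ]
      refine (lintegral_mono_set huniv).trans ((lintegral_iUnion_le _ _).trans ?_)
      rw [tsum_fintype]
      refine Finset.sum_le_sum fun x _ => ?_
      have hCx : MeasurableSet (C x) := hGl Metric.isOpen_ball.measurableSet
      calc ∫⁻ ω in C x, (κ lam {ω' | dist (G (lam, ω')) (G (lam, ω)) ≤ r})⁻¹ ∂κ lam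
          ≤ ∫⁻ _ in C x, (κ lam (C x))⁻¹ ∂κ lam := by
            refine setLIntegral_mono' hCx fun ω hω => ENNReal.inv_le_inv.2 (measure_mono ?_)
            intro ω' hω'
            have h1 : dist (G (lam, ω')) x < r / 2 := hω'
            have h2 : dist (G (lam, ω)) x < r / 2 := hω
            have := dist_triangle_right (G (lam, ω')) (G (lam, ω)) x
            exact (by linarith : dist (G (lam, ω')) (G (lam, ω)) ≤ r)
        _ = (κ lam (C x))⁻¹ * κ lam (C x) := by rw [setLIntegral_const]
        _ ≤ 1 := ENNReal.inv_mul_le_one _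
    refine ((lintegral_mono hl).trans_lt ?_).ne
    simp
  have hint := integrable_toReal_of_lintegral_ne_top hinv.aemeasurable hlint
  refine hint.mono' (measurable_ballMass hG r).log.neg.aestronglyMeasurable (ae_of_all _ fun p => ?_)
  have h0 : 0 ≤ ballMass κ G r p := measureReal_nonneg
  rw [Real.norm_eq_abs, abs_of_nonneg (neg_nonneg.2 (Real.log_nonpos h0 (ballMass_le_one r p))),
    ENNReal.toReal_inv]
  change _ ≤ (ballMass κ G r p)⁻¹
  rcases h0.eq_or_lt with h | h
  · simp [← h]
  · rw [← Real.log_inv]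
    exact (Real.log_le_sub_one_of_pos (inv_pos.2 h)).trans (by linarith)

end BallMass

/-! ### Information along the orbits of the skew product -/

section Orbit

variable {Λ Ω E Y : Type*} [MeasurableSpace Λ] [MeasurableSpace Ω]
  [MetricSpace Y] [SecondCountableTopology Y] [MeasurableSpace Y] [BorelSpace Y]
  [HasBesicovitchCovering Y]
  {κ : Kernel Λ Ω} [IsMarkovKernel κ] {f : Λ × Ω → E} {G : Λ × Ω → Y}
  [MeasurableSpace E] [Countable E] [MeasurableSingletonClass E]
  {m : Measure Λ} [IsProbabilityMeasure m] {T : Λ × Ω → Λ × Ω}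

theorem ae_tendsto_sum_ballInfo (hT : Ergodic T (m ⊗ₘ κ)) (hf : Measurable f) (hG : Measurable G)
    (hH : condEntropy (m ⊗ₘ κ) f (MeasurableSpace.comap Prod.fst inferInstance) < ⊤) :
    ∀ᵐ p ∂(m ⊗ₘ κ), ∀ (ρ : ℕ → ℕ → ℝ) (c η : ℝ), η < 1 → 0 ≤ η →
      (∀ n k, k < n → 0 < ρ n k) → (∀ n k, k < n → ρ n k ≤ c * η ^ (n - k)) →
      Tendsto (fun n : ℕ => (∑ k ∈ Finset.range n, ballInfo κ f G (ρ n k) (T^[k] p)) / n) atTop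
        (𝓝 (condEntropy (m ⊗ₘ κ) f (MeasurableSpace.comap Prod.fst inferInstance ⊔
          MeasurableSpace.comap G inferInstance)).toReal) := by
  obtain ⟨-, g, F, hg, hF, hint, hdom, hlim⟩ := exists_ballInfo_limit hf hG hH
  rw [← hint]
  refine (ae_tendsto_sum_iterate_div hT (fun r _ => measurable_ballInfo hf hG r) hg hF ?_ hdom
    hlim).2
  filter_upwards [ae_forall_cellBallMass_pos (m := m) hf hG] with p hp r hr
    using continuousWithinAt_ballInfo hf hG (hp r hr)

end Orbit

namespace RandomCIFS

variable {q : ℕ} {Λ : Type*} [MeasurableSpace Λ] {m : Measure Λ} {E : Type*}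
  (S : RandomCIFS q m E)

theorem dist_proj_le {ε r₀ r : ℝ} (h : ∀ e lam, ∀ y ∈ S.X, ∀ z, ∀ r ≤ r₀, dist z y ≤ r →
      dist (S.φ e lam z) (S.φ e lam y) ≤ Real.exp ε * S.scale e lam y * r) (hr : r ≤ r₀)
    {p p' : Λ × (ℕ → E)} (h1 : p'.1 = p.1) (h2 : firstLetter p' = firstLetter p)
    (hd : dist (S.proj (S.skew p')) (S.proj (S.skew p)) ≤ r) :
    dist (S.proj p') (S.proj p) ≤ Real.exp ε * S.firstScale p * r := by
  rw [S.proj_eq p', S.proj_eq p, h1, show p'.2 0 = p.2 0 from h2]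
  exact h _ _ _ (S.proj_mem_X _) _ _ hr hd

theorem dist_proj_skew_le {ε r₀ r : ℝ} (h : ∀ e lam, ∀ y ∈ S.X, ∀ z ∈ S.X, ∀ r ≤ r₀,
      dist (S.φ e lam z) (S.φ e lam y) ≤ Real.exp (-ε) * S.scale e lam y * r → dist z y ≤ r)
    (hr : r ≤ r₀) {p p' : Λ × (ℕ → E)} (h1 : p'.1 = p.1) (h2 : firstLetter p' = firstLetter p)
    (hd : dist (S.proj p') (S.proj p) ≤ Real.exp (-ε) * S.firstScale p * r) :
    dist (S.proj (S.skew p')) (S.proj (S.skew p)) ≤ r := by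
  rw [S.proj_eq p', S.proj_eq p, h1, show p'.2 0 = p.2 0 from h2] at hd
  exact h _ _ _ (S.proj_mem_X _) _ (S.proj_mem_X _) _ hr hd

variable [MeasurableSpace E] {κ : Kernel Λ (ℕ → E)} [IsMarkovKernel κ]

theorem neg_log_ballMass_add_ballInfo {G : Λ × (ℕ → E) → EuclideanSpace ℝ (Fin q)} {r : ℝ}
    {p : Λ × (ℕ → E)} (h : 0 < cellBallMass κ firstLetter G r p) :
    -Real.log (ballMass κ G r p) + ballInfo κ firstLetter G r p =
      -Real.log (cellBallMass κ firstLetter G r p) := by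
  rw [ballInfo, Real.log_div h.ne' (h.trans_le (cellBallMass_le_ballMass r p)).ne']
  ring

variable [Countable E] [MeasurableSingletonClass E] [IsProbabilityMeasure m]

/-- By equivariance of the conditional measures, the balls for the shifted coding are the balls at
the next point of the orbit. -/
theorem ae_ballMass_proj_skew (hT : Ergodic S.skew (m ⊗ₘ κ)) :
    ∀ᵐ p ∂(m ⊗ₘ κ), ∀ r, ballMass κ (S.proj ∘ S.skew) r p = ballMass κ S.proj r (S.skew p) := by
  have hfst : MeasurePreserving Prod.fst (m ⊗ₘ κ) m :=
    ⟨measurable_fst, Measure.fst_compProd m κ⟩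
  filter_upwards [hfst.quasiMeasurePreserving.ae
    (S.ae_map_shift_eq κ hT.toMeasurePreserving)] with p hp r
  have hms : MeasurableSet {ω | dist (S.proj ((S.skew p).1, ω)) (S.proj (S.skew p)) ≤ r} :=
    measurableSet_le ((S.measurable_proj.comp measurable_prodMk_left).dist measurable_const)
      measurable_const
  change (κ p.1).real _ = (κ (S.θ p.1)).real _
  rw [← hp]
  simp only [Measure.real]
  rw [Measure.map_apply measurable_shift hms]
  rfl

/-- The facts on the masses of balls at a point, which hold almost everywhere and along orbits. -/
theorem ae_regular (hT : Ergodic S.skew (m ⊗ₘ κ)) :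
    ∀ᵐ p ∂(m ⊗ₘ κ), ∀ k : ℕ,
      (∀ r, ballMass κ (S.proj ∘ S.skew) r (S.skew^[k] p) =
        ballMass κ S.proj r (S.skew^[k + 1] p)) ∧
      (∀ r > 0, 0 < cellBallMass κ firstLetter S.proj r (S.skew^[k] p)) ∧
      ∀ r > 0, 0 < cellBallMass κ firstLetter (S.proj ∘ S.skew) r (S.skew^[k] p) := by
  refine ae_all_iff.2 fun k => ?_
  have h := (hT.toMeasurePreserving.iterate k).quasiMeasurePreserving.ae
    ((S.ae_ballMass_proj_skew hT).and
      ((ae_forall_cellBallMass_pos (m := m) (κ := κ) measurable_firstLetter S.measurable_proj).and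
        (ae_forall_cellBallMass_pos (m := m) (κ := κ) measurable_firstLetter
          (S.measurable_proj.comp S.measurable_skew))))
  filter_upwards [h] with p hp
  refine ⟨fun r => ?_, hp.2.1, hp.2.2⟩
  rw [hp.1 r, Function.iterate_succ_apply']

/-- The average increment of the information along the orbit converges to the projectional
entropy, for radii contracted along the orbit. -/
theorem ae_tendsto_sum_increment (hq : 1 ≤ q) (hT : Ergodic S.skew (m ⊗ₘ κ))
    (hH : condEntropy (m ⊗ₘ κ) firstLetter (baseAlgebra Λ E) < ⊤) {a r₀ : ℝ}
    (ha : Real.exp a * S.s < 1) (hr₀ : 0 < r₀) :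
    ∀ᵐ p ∂(m ⊗ₘ κ), Tendsto (fun n : ℕ => (∑ k ∈ Finset.range n,
      (ballInfo κ firstLetter (S.proj ∘ S.skew)
          (orbitRadius S.skew (fun p => Real.exp a * S.firstScale p) r₀ (n - 1 - k)
            (S.skew^[k + 1] p)) (S.skew^[k] p) -
        ballInfo κ firstLetter S.proj
          (orbitRadius S.skew (fun p => Real.exp a * S.firstScale p) r₀ (n - k)
            (S.skew^[k] p)) (S.skew^[k] p))) / n) atTop
      (𝓝 ((condEntropy (m ⊗ₘ κ) firstLetter
          (baseAlgebra Λ E ⊔ MeasurableSpace.comap (S.proj ∘ S.skew) inferInstance)).toReal -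
        (condEntropy (m ⊗ₘ κ) firstLetter
          (baseAlgebra Λ E ⊔ MeasurableSpace.comap S.proj inferInstance)).toReal)) := by
  have hs : (0 : ℝ) < S.s := by exact_mod_cast S.s_pos
  have hη : 0 < Real.exp a * S.s := mul_pos (Real.exp_pos a) hs
  have hc : ∀ p, 0 < Real.exp a * S.firstScale p := fun p =>
    mul_pos (Real.exp_pos a) (S.firstScale_pos hq p)
  have hcη : ∀ p, Real.exp a * S.firstScale p ≤ Real.exp a * S.s := fun p =>
    mul_le_mul_of_nonneg_left (S.firstScale_le p) (Real.exp_pos a).le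
  filter_upwards [ae_tendsto_sum_ballInfo hT measurable_firstLetter S.measurable_proj hH,
    ae_tendsto_sum_ballInfo hT measurable_firstLetter
      (S.measurable_proj.comp S.measurable_skew) hH] with p h1 h2
  have h1 := h1 (fun n k => orbitRadius S.skew (fun p => Real.exp a * S.firstScale p) r₀ (n - k)
    (S.skew^[k] p)) r₀ _ ha hη.le (fun n k _ => orbitRadius_pos hr₀ hc _ _)
    (fun n k _ => orbitRadius_le hr₀ hc hcη _ _)
  have h2 := h2 (fun n k => orbitRadius S.skew (fun p => Real.exp a * S.firstScale p) r₀
    (n - 1 - k) (S.skew^[k + 1] p)) (r₀ / (Real.exp a * S.s)) _ ha hη.le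
    (fun n k _ => orbitRadius_pos hr₀ hc _ _)
    (fun n k hk => (orbitRadius_le hr₀ hc hcη _ _).trans_eq (by
      rw [show n - k = n - 1 - k + 1 by omega, pow_succ, div_mul_eq_mul_div, eq_div_iff hη.ne']
      ring))
  refine (h2.sub h1).congr fun n => ?_
  rw [Finset.sum_sub_distrib, sub_div]

section Radii

variable (hq : 1 ≤ q) (hB : S.BoundedDistortion) (hT : Ergodic S.skew (m ⊗ₘ κ))
  (hH : condEntropy (m ⊗ₘ κ) firstLetter (baseAlgebra Λ E) < ⊤) {ε : ℝ} (hε : 0 < ε)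

include hq hB hT hH hε

/-- Upper estimate of the information of balls, with radii that are slightly larger than the
contraction of the system along the orbit. -/
theorem exists_ae_neg_log_ballMass_le (hεs : Real.exp ε * S.s < 1) :
    ∃ r₀ > 0, ∀ᵐ p ∂(m ⊗ₘ κ), ∀ B, (condEntropy (m ⊗ₘ κ) firstLetter
          (baseAlgebra Λ E ⊔ MeasurableSpace.comap (S.proj ∘ S.skew) inferInstance)).toReal -
        (condEntropy (m ⊗ₘ κ) firstLetter
          (baseAlgebra Λ E ⊔ MeasurableSpace.comap S.proj inferInstance)).toReal < B →
      ∀ᶠ n : ℕ in atTop, -Real.log (ballMass κ S.proj (orbitRadius S.skew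
        (fun p => Real.exp ε * S.firstScale p) r₀ n p) p) ≤ n * B := by
  obtain ⟨r₀, hr₀, hdist⟩ := S.exists_radius_dist_le hq hB hε
  refine ⟨r₀, hr₀, ?_⟩
  have hc : ∀ p, 0 < Real.exp ε * S.firstScale p := fun p =>
    mul_pos (Real.exp_pos ε) (S.firstScale_pos hq p)
  have hc1 : ∀ p, Real.exp ε * S.firstScale p ≤ 1 := fun p =>
    (mul_le_mul_of_nonneg_left (S.firstScale_le p) (Real.exp_pos ε).le).trans hεs.le
  filter_upwards [S.ae_tendsto_sum_increment hq hT hH hεs hr₀, S.ae_regular hT,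
    ae_tendsto_iterate_div hT (integrable_neg_log_ballMass (m := m) (κ := κ) S.measurable_proj
      S.isCompact_X S.proj_mem_X hr₀)] with p h1 hreg h2 B hB
  have h3 := h2.add h1
  rw [zero_add] at h3
  filter_upwards [h3.eventually_lt_const hB, eventually_gt_atTop 0] with n hn hn0
  have hn0' : (0 : ℝ) < n := by exact_mod_cast hn0
  rw [← add_div, div_lt_iff₀ hn0', mul_comm] at hn
  refine le_trans (le_add_sum_orbitRadius (T := S.skew) (L := fun r p => -Real.log (ballMass κ S.proj r p))
    (I := fun r p => ballInfo κ firstLetter S.proj r p)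
    (J := fun r p => ballInfo κ firstLetter (S.proj ∘ S.skew) r p) hr₀ hc hc1 p ?_ n) hn.le
  intro k r hr hrr₀
  obtain ⟨h4, h5, h6⟩ := hreg k
  have h7 := neg_log_ballMass_add_ballInfo (h5 _ (mul_pos (hc (S.skew^[k] p)) hr))
  have h8 := neg_log_ballMass_add_ballInfo (h6 r hr)
  rw [h4] at h8
  have h9 : cellBallMass κ firstLetter (S.proj ∘ S.skew) r (S.skew^[k] p) ≤
      cellBallMass κ firstLetter S.proj (Real.exp ε * S.firstScale (S.skew^[k] p) * r)
        (S.skew^[k] p) :=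
    measureReal_mono (fun ω hω => ⟨hω.1, S.dist_proj_le hdist hrr₀ rfl hω.1 hω.2⟩)
      (measure_ne_top _ _)
  have h10 := Real.log_le_log (h6 r hr) h9
  linarith

/-- Lower estimate of the information of balls, with radii that are slightly smaller than the
contraction of the system along the orbit. -/
theorem exists_ae_le_neg_log_ballMass :
    ∃ r₀ > 0, ∀ᵐ p ∂(m ⊗ₘ κ), ∀ B, B < (condEntropy (m ⊗ₘ κ) firstLetter
          (baseAlgebra Λ E ⊔ MeasurableSpace.comap (S.proj ∘ S.skew) inferInstance)).toReal -
        (condEntropy (m ⊗ₘ κ) firstLetter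
          (baseAlgebra Λ E ⊔ MeasurableSpace.comap S.proj inferInstance)).toReal →
      ∀ᶠ n : ℕ in atTop, n * B ≤ -Real.log (ballMass κ S.proj (orbitRadius S.skew
        (fun p => Real.exp (-ε) * S.firstScale p) r₀ n p) p) := by
  obtain ⟨r₀, hr₀, hdist⟩ := S.exists_radius_dist_le_of_dist_le hq hB hε
  refine ⟨r₀, hr₀, ?_⟩
  have hs1 : (S.s : ℝ) < 1 := by exact_mod_cast S.s_lt_one
  have hεs : Real.exp (-ε) * S.s < 1 :=
    mul_lt_one_of_nonneg_of_lt_one_right (Real.exp_le_one_iff.2 (neg_nonpos.2 hε.le))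
      S.s.coe_nonneg hs1
  have hc : ∀ p, 0 < Real.exp (-ε) * S.firstScale p := fun p =>
    mul_pos (Real.exp_pos _) (S.firstScale_pos hq p)
  have hc1 : ∀ p, Real.exp (-ε) * S.firstScale p ≤ 1 := fun p =>
    (mul_le_mul_of_nonneg_left (S.firstScale_le p) (Real.exp_pos _).le).trans hεs.le
  filter_upwards [S.ae_tendsto_sum_increment hq hT hH hεs hr₀, S.ae_regular hT] with p h1 hreg B hB
  filter_upwards [h1.eventually_const_lt hB, eventually_gt_atTop 0] with n hn hn0
  have hn0' : (0 : ℝ) < n := by exact_mod_cast hn0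
  rw [lt_div_iff₀ hn0', mul_comm] at hn
  have hL : 0 ≤ -Real.log (ballMass κ S.proj r₀ (S.skew^[n] p)) :=
    neg_nonneg.2 (Real.log_nonpos measureReal_nonneg (ballMass_le_one _ _))
  -- the telescoping estimate applies to the negatives of all the functions
  have key := le_add_sum_orbitRadius (T := S.skew) (L := fun r p => Real.log (ballMass κ S.proj r p))
    (I := fun r p => -ballInfo κ firstLetter S.proj r p)
    (J := fun r p => -ballInfo κ firstLetter (S.proj ∘ S.skew) r p) hr₀ hc hc1 p ?_ n
  · have : ∀ x y : ℝ, -x - -y = -(x - y) := fun x y => by ring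
    simp only [this, Finset.sum_neg_distrib] at key
    linarith
  intro k r hr hrr₀
  obtain ⟨h4, h5, h6⟩ := hreg k
  have h5' := h5 _ (mul_pos (hc (S.skew^[k] p)) hr)
  have h7 := neg_log_ballMass_add_ballInfo h5'
  have h8 := neg_log_ballMass_add_ballInfo (h6 r hr)
  rw [h4] at h8
  have h9 : cellBallMass κ firstLetter S.proj (Real.exp (-ε) * S.firstScale (S.skew^[k] p) * r)
      (S.skew^[k] p) ≤ cellBallMass κ firstLetter (S.proj ∘ S.skew) r (S.skew^[k] p) :=
    measureReal_mono (fun ω hω => ⟨hω.1, S.dist_proj_skew_le hdist hrr₀ rfl hω.1 hω.2⟩)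
      (measure_ne_top _ _)
  have h10 := Real.log_le_log h5' h9
  linarith

end Radii

end RandomCIFS

/-! ### The Lyapunov exponent -/

namespace RandomCIFS

variable {q : ℕ} {Λ : Type*} [MeasurableSpace Λ] {m : Measure Λ} {E : Type*}
  (S : RandomCIFS q m E)

theorem neg_log_s_pos : 0 < -Real.log S.s :=
  neg_pos.2 (Real.log_neg (by exact_mod_cast S.s_pos) (by exact_mod_cast S.s_lt_one))

theorem neg_log_s_le (hq : 1 ≤ q) (p : Λ × (ℕ → E)) :
    -Real.log S.s ≤ -Real.log (S.firstScale p) :=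
  neg_le_neg (Real.log_le_log (S.firstScale_pos hq p) (S.firstScale_le p))

theorem neg_log_orbitRadius_firstScale (hq : 1 ≤ q) {a r₀ : ℝ} (hr₀ : 0 < r₀) (n : ℕ)
    (p : Λ × (ℕ → E)) :
    -Real.log (orbitRadius S.skew (fun p => Real.exp a * S.firstScale p) r₀ n p) =
      -Real.log r₀ - n * a + birkhoffSum S.skew (fun p => -Real.log (S.firstScale p)) n p := by
  have h : ∀ p, -Real.log (Real.exp a * S.firstScale p) = -a + -Real.log (S.firstScale p) :=
    fun p => by
      rw [Real.log_mul (Real.exp_pos a).ne' (S.firstScale_pos hq p).ne', Real.log_exp]; ring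
  rw [neg_log_orbitRadius hr₀ fun p => mul_pos (Real.exp_pos a) (S.firstScale_pos hq p)]
  simp only [h, birkhoffSum, Finset.sum_add_distrib, Finset.sum_const, Finset.card_range,
    nsmul_eq_mul]
  ring

variable [MeasurableSpace E]

theorem lyapunov_eq (μ : Measure (Λ × (ℕ → E))) :
    S.lyapunov μ = ∫⁻ p, ENNReal.ofReal (-Real.log (S.firstScale p)) ∂μ := rfl

variable [Countable E] [MeasurableSingletonClass E]

theorem ae_tendsto_birkhoffSum_of_lyapunov_ne_top (hq : 1 ≤ q) {μ : Measure (Λ × (ℕ → E))}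
    [IsProbabilityMeasure μ] (hT : Ergodic S.skew μ) (h : S.lyapunov μ ≠ ⊤) :
    0 < (S.lyapunov μ).toReal ∧ ∀ᵐ p ∂μ, Tendsto (fun n : ℕ =>
      birkhoffSum S.skew (fun p => -Real.log (S.firstScale p)) n p / n) atTop
        (𝓝 (S.lyapunov μ).toReal) := by
  have hm : Measurable fun p => -Real.log (S.firstScale p) := (S.measurable_firstScale hq).log.neg
  have h0 : ∀ p, 0 ≤ -Real.log (S.firstScale p) := fun p =>
    S.neg_log_s_pos.le.trans (S.neg_log_s_le hq p)
  have hint : Integrable (fun p => -Real.log (S.firstScale p)) μ :=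
    (lintegral_ofReal_ne_top_iff_integrable hm.aestronglyMeasurable (ae_of_all _ h0)).1 h
  have heq : (S.lyapunov μ).toReal = ∫ p, -Real.log (S.firstScale p) ∂μ :=
    (integral_eq_lintegral_of_nonneg_ae (ae_of_all _ h0) hm.aestronglyMeasurable).symm
  rw [heq]
  refine ⟨S.neg_log_s_pos.trans_le ?_, ae_tendsto_birkhoffSum_div hT hint⟩
  have := integral_mono (integrable_const (-Real.log (S.s : ℝ))) hint (S.neg_log_s_le hq)
  simpa using this

/-- If the Lyapunov exponent is infinite, the Birkhoff averages are unbounded: this is seen on the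
truncations of the integrand. -/
theorem ae_eventually_le_birkhoffSum_of_lyapunov_eq_top (hq : 1 ≤ q) {μ : Measure (Λ × (ℕ → E))}
    [IsProbabilityMeasure μ] (hT : Ergodic S.skew μ) (h : S.lyapunov μ = ⊤) (A : ℝ) :
    ∀ᵐ p ∂μ, ∀ᶠ n : ℕ in atTop,
      n * A ≤ birkhoffSum S.skew (fun p => -Real.log (S.firstScale p)) n p := by
  have hm : Measurable fun p => -Real.log (S.firstScale p) := (S.measurable_firstScale hq).log.neg
  have h0 : ∀ p, 0 ≤ -Real.log (S.firstScale p) := fun p =>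
    S.neg_log_s_pos.le.trans (S.neg_log_s_le hq p)
  have hmN : ∀ N : ℕ, Measurable fun p => min (-Real.log (S.firstScale p)) N := fun N =>
    hm.min measurable_const
  have h0N : ∀ (N : ℕ) p, 0 ≤ min (-Real.log (S.firstScale p)) N := fun N p =>
    le_min (h0 p) N.cast_nonneg
  have hlim : Tendsto (fun N : ℕ => ∫⁻ p, ENNReal.ofReal (min (-Real.log (S.firstScale p)) N) ∂μ)
      atTop (𝓝 ⊤) := by
    rw [← h, lyapunov_eq]
    refine lintegral_tendsto_of_tendsto_of_monotone (fun N => (hmN N).ennreal_ofReal.aemeasurable)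
      (ae_of_all _ fun p N N' hN => ENNReal.ofReal_le_ofReal
        (min_le_min_left _ (by exact_mod_cast hN))) (ae_of_all _ fun p => ?_)
    refine tendsto_const_nhds.congr' ?_
    filter_upwards [eventually_ge_atTop ⌈-Real.log (S.firstScale p)⌉₊] with N hN
    rw [min_eq_left ((Nat.le_ceil _).trans (by exact_mod_cast hN))]
  obtain ⟨N, hN⟩ := (hlim.eventually_const_lt (ENNReal.ofReal_lt_top (r := A))).exists
  have hint : Integrable (fun p => min (-Real.log (S.firstScale p)) N) μ :=
    (integrable_const (N : ℝ)).mono' (hmN N).aestronglyMeasurable (ae_of_all _ fun p => by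
      rw [Real.norm_eq_abs, abs_of_nonneg (h0N N p)]; exact min_le_right _ _)
  have hA : A < ∫ p, min (-Real.log (S.firstScale p)) N ∂μ := by
    rw [← ofReal_integral_eq_lintegral_ofReal hint (ae_of_all _ (h0N N))] at hN
    exact ENNReal.ofReal_lt_ofReal_iff'.1 hN |>.1
  filter_upwards [ae_tendsto_birkhoffSum_div hT hint] with p hp
  filter_upwards [hp.eventually_const_lt hA, eventually_gt_atTop 0] with n hn hn0
  rw [lt_div_iff₀ (by exact_mod_cast hn0), mul_comm] at hn
  exact hn.le.trans (Finset.sum_le_sum fun k _ => min_le_left _ _)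

/-! ### The local dimension of the conditional measures -/

variable {κ : Kernel Λ (ℕ → E)}

/-- The information of the open ball of radius `r` about the coding point of `p`, for the projected
conditional measure. -/
noncomputable def openBallInfo (S : RandomCIFS q m E) (κ : Kernel Λ (ℕ → E)) (p : Λ × (ℕ → E))
    (r : ℝ) : ℝ :=
  -Real.log (((κ p.1).map (S.coding p.1)).real (Metric.ball (S.coding p.1 p.2) r))

theorem real_map_coding_ball (p : Λ × (ℕ → E)) (r : ℝ) :
    ((κ p.1).map (S.coding p.1)).real (Metric.ball (S.coding p.1 p.2) r) =
      (κ p.1).real {ω | dist (S.proj (p.1, ω)) (S.proj p) < r} := by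
  have h : Measurable (S.coding p.1) := S.measurable_proj.comp measurable_prodMk_left
  rw [Measure.real, Measure.map_apply h Metric.isOpen_ball.measurableSet]
  rfl

variable [IsMarkovKernel κ]

theorem openBallInfo_nonneg (p : Λ × (ℕ → E)) (r : ℝ) : 0 ≤ S.openBallInfo κ p r := by
  rw [openBallInfo, real_map_coding_ball]
  exact neg_nonneg.2 (Real.log_nonpos measureReal_nonneg measureReal_le_one)

theorem openBallInfo_le {p : Λ × (ℕ → E)} (hp : ∀ r > 0, 0 < ballMass κ S.proj r p) {r r' : ℝ}
    (hr : 0 < r) (hrr' : r < r') :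
    S.openBallInfo κ p r' ≤ -Real.log (ballMass κ S.proj r p) := by
  rw [openBallInfo, real_map_coding_ball]
  exact neg_le_neg (Real.log_le_log (hp r hr)
    (measureReal_mono (fun ω (hω : dist _ _ ≤ r) => hω.trans_lt hrr') (measure_ne_top _ _)))

theorem le_openBallInfo {p : Λ × (ℕ → E)} (hp : ∀ r > 0, 0 < ballMass κ S.proj r p) {r r' : ℝ}
    (hr : 0 < r) (hrr' : r ≤ r') :
    -Real.log (ballMass κ S.proj r' p) ≤ S.openBallInfo κ p r := by
  rw [openBallInfo, real_map_coding_ball]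
  refine neg_le_neg (Real.log_le_log ?_ (measureReal_mono
    (fun ω (hω : dist _ _ < r) => hω.le.trans hrr') (measure_ne_top _ _)))
  exact (hp _ (half_pos hr)).trans_le (measureReal_mono
    (fun ω (hω : dist _ _ ≤ r / 2) => hω.trans_lt (half_lt_self hr)) (measure_ne_top _ _))

variable [IsProbabilityMeasure m]

/-- The local dimension is the quotient of the projectional entropy by the Lyapunov exponent. An
infinite Lyapunov exponent has real value `0`, and then the quotient is `0`, as it should be. -/
theorem ae_tendsto_openBallInfo (hq : 1 ≤ q) (hB : S.BoundedDistortion)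
    (hT : Ergodic S.skew (m ⊗ₘ κ))
    (hH : condEntropy (m ⊗ₘ κ) firstLetter (baseAlgebra Λ E) < ⊤) :
    ∀ᵐ p ∂(m ⊗ₘ κ), Tendsto (fun r => S.openBallInfo κ p r / -Real.log r) (𝓝[>] 0)
      (𝓝 (((condEntropy (m ⊗ₘ κ) firstLetter
          (baseAlgebra Λ E ⊔ MeasurableSpace.comap (S.proj ∘ S.skew) inferInstance)).toReal -
        (condEntropy (m ⊗ₘ κ) firstLetter
          (baseAlgebra Λ E ⊔ MeasurableSpace.comap S.proj inferInstance)).toReal) /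
            (S.lyapunov (m ⊗ₘ κ)).toReal)) := by
  set h : ℝ := (condEntropy (m ⊗ₘ κ) firstLetter
      (baseAlgebra Λ E ⊔ MeasurableSpace.comap (S.proj ∘ S.skew) inferInstance)).toReal -
    (condEntropy (m ⊗ₘ κ) firstLetter
      (baseAlgebra Λ E ⊔ MeasurableSpace.comap S.proj inferInstance)).toReal with hh
  have hs0 : (0 : ℝ) < S.s := by exact_mod_cast S.s_pos
  have hs1 : (S.s : ℝ) < 1 := by exact_mod_cast S.s_lt_one
  have hls := S.neg_log_s_pos
  -- a sequence of errors, small enough for `exp ε * s < 1`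
  set ε : ℕ → ℝ := fun j => -Real.log S.s / (j + 2) with hε
  have hε0 : ∀ j, 0 < ε j := fun j => by positivity
  have hεlt : ∀ j, ε j < -Real.log S.s := fun j =>
    div_lt_self hls (by linarith [(Nat.cast_nonneg j : (0 : ℝ) ≤ j)])
  have hεlim : Tendsto ε atTop (𝓝 0) :=
    tendsto_const_nhds.div_atTop
      (tendsto_atTop_add_const_right _ _ tendsto_natCast_atTop_atTop)
  have hεs : ∀ j, Real.exp (ε j) * S.s < 1 := fun j => by
    have : Real.exp (ε j) < Real.exp (-Real.log S.s) := Real.exp_lt_exp.2 (hεlt j)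
    rw [Real.exp_neg, Real.exp_log hs0] at this
    exact (lt_inv_mul_iff₀' hs0).1 (by simpa using this)
  have hεs' : ∀ j, Real.exp (-ε j) * S.s < 1 := fun j =>
    mul_lt_one_of_nonneg_of_lt_one_right (Real.exp_le_one_iff.2 (neg_nonpos.2 (hε0 j).le))
      S.s.coe_nonneg hs1
  have hRlim : ∀ a r₀ p, 0 < r₀ → Real.exp a * S.s < 1 → Tendsto (fun n =>
      orbitRadius S.skew (fun p => Real.exp a * S.firstScale p) r₀ n p) atTop (𝓝 0) := by
    intro a r₀ p hr₀ ha
    have h1 := (tendsto_pow_atTop_nhds_zero_of_lt_one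
      (mul_pos (Real.exp_pos a) hs0).le ha).const_mul r₀
    rw [mul_zero] at h1
    have hc : ∀ p, 0 < Real.exp a * S.firstScale p := fun p =>
      mul_pos (Real.exp_pos a) (S.firstScale_pos hq p)
    exact squeeze_zero (fun n => (orbitRadius_pos hr₀ hc n p).le) (fun n =>
      orbitRadius_le hr₀ hc (fun p => mul_le_mul_of_nonneg_left (S.firstScale_le p)
        (Real.exp_pos a).le) n p) h1
  have hRpos : ∀ a r₀ n p, 0 < r₀ →
      0 < orbitRadius S.skew (fun p => Real.exp a * S.firstScale p) r₀ n p := fun a r₀ n p hr₀ =>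
    orbitRadius_pos hr₀ (fun p => mul_pos (Real.exp_pos a) (S.firstScale_pos hq p)) n p
  choose r₁ hr₁ hup using fun j => S.exists_ae_neg_log_ballMass_le hq hB hT hH (hε0 j) (hεs j)
  choose r₂ hr₂ hlo using fun j => S.exists_ae_le_neg_log_ballMass hq hB hT hH (hε0 j)
  have hpos : ∀ᵐ p ∂(m ⊗ₘ κ), ∀ r > 0, 0 < ballMass κ S.proj r p := by
    filter_upwards [ae_forall_cellBallMass_pos (m := m) (κ := κ) measurable_firstLetter
      S.measurable_proj] with p hp r hr
    exact (hp r hr).trans_le (cellBallMass_le_ballMass r p)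
  have hh0 : 0 ≤ h := by
    obtain ⟨p, hp⟩ := (hup 0).exists
    refine le_of_forall_gt_imp_ge_of_dense fun B hB => ?_
    obtain ⟨n, hn, hn0⟩ := ((hp B hB).and (eventually_gt_atTop 0)).exists
    have h1 : 0 ≤ (n : ℝ) * B :=
      (neg_nonneg.2 (Real.log_nonpos measureReal_nonneg (ballMass_le_one _ _))).trans hn
    exact nonneg_of_mul_nonneg_right h1 (by exact_mod_cast hn0)
  -- the constant term of the logarithm of the radius is negligible
  have hconst : ∀ C : ℝ, Tendsto (fun n : ℕ => C / n) atTop (𝓝 0) := fun C =>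
    tendsto_const_nhds.div_atTop tendsto_natCast_atTop_atTop
  by_cases hχ : S.lyapunov (m ⊗ₘ κ) = ⊤
  · rw [hχ, ENNReal.toReal_top, div_zero]
    filter_upwards [hpos, hup 0, ae_all_iff.2 fun N : ℕ =>
      S.ae_eventually_le_birkhoffSum_of_lyapunov_eq_top hq hT hχ N] with p hpos hup hbir
    refine tendsto_order.2 ⟨fun c hc => ?_, fun c hc => ?_⟩
    · filter_upwards [Ioo_mem_nhdsGT one_pos] with r hr
      exact hc.trans_le (div_nonneg (S.openBallInfo_nonneg p r)
        (neg_nonneg.2 (Real.log_nonpos hr.1.le hr.2.le)))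
    · set A : ℝ := 2 * (h + 1) / c with hA
      have hA0 : 0 < A := by positivity
      refine eventually_div_neg_log_lt (fun n => hRpos (ε 0) (r₁ 0) n p (hr₁ 0))
        (hRlim _ _ p (hr₁ 0) (hεs 0)) (fun n r hr => S.openBallInfo_le hpos (hRpos _ _ n p (hr₁ 0))
          hr) (hup (h + 1) (lt_add_one h)) (A := A) ?_ hA0 (by positivity) ?_
      · obtain ⟨N, hN⟩ := exists_nat_gt (A + ε 0 + 1)
        filter_upwards [hbir N, (hconst (-Real.log (r₁ 0))).eventually_const_lt
          (show (-1 : ℝ) < 0 by norm_num), eventually_gt_atTop 0] with n hn1 hn2 hn3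
        have hn3' : (0 : ℝ) < n := by exact_mod_cast hn3
        rw [lt_div_iff₀ hn3'] at hn2
        rw [S.neg_log_orbitRadius_firstScale hq (hr₁ 0)]
        nlinarith [mul_lt_mul_of_pos_left hN hn3']
      · rw [hA, div_div_eq_mul_div, div_lt_iff₀ (by positivity)]
        nlinarith
  · obtain ⟨hχ0, hbir⟩ := S.ae_tendsto_birkhoffSum_of_lyapunov_ne_top hq hT hχ
    set χ := (S.lyapunov (m ⊗ₘ κ)).toReal
    filter_upwards [hpos, ae_all_iff.2 hup, ae_all_iff.2 hlo, hbir] with p hpos hup hlo hbir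
    -- errors `ε j` in the radii and in the entropy cost `2 * ε j` in the exponent
    have hSlim : ∀ a r₀, 0 < r₀ → Tendsto (fun n : ℕ => -Real.log (orbitRadius S.skew
        (fun p => Real.exp a * S.firstScale p) r₀ n p) / n) atTop (𝓝 (χ - a)) := by
      intro a r₀ hr₀
      have h1 := ((hconst (-Real.log r₀)).sub_const a).add hbir
      rw [show 0 - a + χ = χ - a by ring] at h1
      refine h1.congr' ?_
      filter_upwards [eventually_gt_atTop 0] with n hn
      have hn' : (n : ℝ) ≠ 0 := by exact_mod_cast hn.ne'
      rw [S.neg_log_orbitRadius_firstScale hq hr₀]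
      field_simp
    refine tendsto_order.2 ⟨fun c hc => ?_, fun c hc => ?_⟩
    · have h1 : Tendsto (fun j => (h - ε j) / (χ + 2 * ε j)) atTop (𝓝 (h / χ)) := by
        have := (tendsto_const_nhds (x := h)).sub hεlim |>.div
          ((tendsto_const_nhds (x := χ)).add (hεlim.const_mul 2)) (by simpa using hχ0.ne')
        rw [mul_zero, sub_zero, add_zero] at this
        exact this
      obtain ⟨j, hj⟩ := (h1.eventually_const_lt hc).exists
      refine eventually_lt_div_neg_log (fun n => hRpos (-ε j) (r₂ j) n p (hr₂ j))
        (hRlim _ _ p (hr₂ j) (hεs' j)) (fun n r hr0 hr => S.le_openBallInfo hpos hr0 hr)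
        (S.openBallInfo_nonneg p) (hlo j (h - ε j) (sub_lt_self h (hε0 j))) (A := χ + 2 * ε j)
        ?_ (by linarith [hε0 j]) hj
      filter_upwards [(hSlim (-ε j) (r₂ j) (hr₂ j)).eventually_lt_const
        (show χ - -ε j < χ + 2 * ε j by linarith [hε0 j]), eventually_gt_atTop 0] with n hn hn0
      rw [div_lt_iff₀ (by exact_mod_cast hn0), mul_comm] at hn
      exact hn.le
    · have h1 : Tendsto (fun j => (h + ε j) / (χ - 2 * ε j)) atTop (𝓝 (h / χ)) := by
        have := (tendsto_const_nhds (x := h)).add hεlim |>.div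
          ((tendsto_const_nhds (x := χ)).sub (hεlim.const_mul 2)) (by simpa using hχ0.ne')
        rw [mul_zero, add_zero, sub_zero] at this
        exact this
      have h2 : ∀ᶠ j in atTop, 2 * ε j < χ := by
        have := hεlim.const_mul 2
        rw [mul_zero] at this
        exact this.eventually_lt_const hχ0
      obtain ⟨j, hj, hj2⟩ := ((h1.eventually_lt_const hc).and h2).exists
      refine eventually_div_neg_log_lt (fun n => hRpos (ε j) (r₁ j) n p (hr₁ j))
        (hRlim _ _ p (hr₁ j) (hεs j)) (fun n r hr => S.openBallInfo_le hpos
          (hRpos _ _ n p (hr₁ j)) hr) (hup j (h + ε j) (lt_add_of_pos_right h (hε0 j)))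
        (A := χ - 2 * ε j) ?_ (by linarith) (add_nonneg hh0 (hε0 j).le) hj
      filter_upwards [(hSlim (ε j) (r₁ j) (hr₁ j)).eventually_const_lt
        (show χ - 2 * ε j < χ - ε j by linarith [hε0 j]), eventually_gt_atTop 0] with n hn hn0
      rw [lt_div_iff₀ (by exact_mod_cast hn0), mul_comm] at hn
      exact hn.le

end RandomCIFS

/-! ### Exact dimensionality -/

section PointwiseDim

variable {Y : Type*} [PseudoMetricSpace Y] [MeasurableSpace Y]

theorem measurable_measureReal_ball [SecondCountableTopology Y] [BorelSpace Y] (ν : Measure Y)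
    [IsFiniteMeasure ν] (r : ℝ) : Measurable fun x => ν.real (Metric.ball x r) := by
  have h : MeasurableSet {z : Y × Y | dist z.2 z.1 < r} :=
    measurableSet_lt (measurable_snd.dist measurable_fst) measurable_const
  exact (measurable_measure_prodMk_left h).ennreal_toReal

/-- If the balls at `x` have positive mass, the dyadic radii suffice for the pointwise
dimension. -/
theorem hasPointwiseDim_of_tendsto_dyadic {ν : Measure Y} [IsProbabilityMeasure ν] {x : Y} {d : ℝ}
    (hpos : ∀ n : ℕ, 0 < ν.real (Metric.ball x ((1 / 2) ^ n)))
    (h : Tendsto (fun n : ℕ => Real.log (ν.real (Metric.ball x ((1 / 2) ^ n))) /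
      Real.log ((1 / 2) ^ n)) atTop (𝓝 d)) : HasPointwiseDim ν x d := by
  set b : ℕ → ℝ := fun n => -Real.log (ν.real (Metric.ball x ((1 / 2) ^ n))) with hb
  set ℓ : ℝ → ℝ := fun r => -Real.log (ν.real (Metric.ball x r)) with hℓ
  have hR0 : ∀ n : ℕ, (0 : ℝ) < (1 / 2) ^ n := fun n => by positivity
  have hR : Tendsto (fun n : ℕ => ((1 : ℝ) / 2) ^ n) atTop (𝓝 0) :=
    tendsto_pow_atTop_nhds_zero_of_lt_one (by norm_num) (by norm_num)
  have hpos' : ∀ r > 0, 0 < ν.real (Metric.ball x r) := fun r hr => by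
    obtain ⟨n, hn⟩ := (hR.eventually_lt_const hr).exists
    exact (hpos n).trans_le (measureReal_mono (Metric.ball_subset_ball hn.le))
  have hℓ0 : ∀ r, 0 ≤ ℓ r := fun r =>
    neg_nonneg.2 (Real.log_nonpos measureReal_nonneg measureReal_le_one)
  have hl2 : 0 < Real.log 2 := Real.log_pos one_lt_two
  have hlog : ∀ n : ℕ, -Real.log ((1 / 2) ^ n) = n * Real.log 2 := fun n => by
    rw [Real.log_pow, one_div, Real.log_inv]; ring
  have hbn : Tendsto (fun n : ℕ => b n / n) atTop (𝓝 (d * Real.log 2)) := by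
    refine (h.mul_const (Real.log 2)).congr' ?_
    filter_upwards [eventually_gt_atTop 0] with n hn
    have hn' : (n : ℝ) ≠ 0 := by exact_mod_cast hn.ne'
    rw [← neg_div_neg_eq, hlog]
    field_simp
    rfl
  have hd : 0 ≤ d * Real.log 2 :=
    ge_of_tendsto' hbn fun n => div_nonneg (hℓ0 _) n.cast_nonneg
  have key : Tendsto (fun r => ℓ r / -Real.log r) (𝓝[>] 0) (𝓝 d) := by
    refine tendsto_order.2 ⟨fun c hc => ?_, fun c hc => ?_⟩
    · obtain ⟨c', hc1, hc2⟩ := exists_between hc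
      refine eventually_lt_div_neg_log (b := b) (B := c' * Real.log 2) (A := Real.log 2) hR0 hR
        (fun n r hr hrn => neg_le_neg (Real.log_le_log (hpos' r hr)
          (measureReal_mono (Metric.ball_subset_ball hrn)))) hℓ0 ?_
        (Eventually.of_forall fun n => (hlog n).le) hl2 (by rwa [mul_div_cancel_right₀ _ hl2.ne'])
      filter_upwards [hbn.eventually_const_lt (mul_lt_mul_of_pos_right hc2 hl2),
        eventually_gt_atTop 0] with n hn hn0
      rw [lt_div_iff₀ (by exact_mod_cast hn0), mul_comm] at hn
      exact hn.le
    · obtain ⟨c', hc1, hc2⟩ := exists_between hc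
      have hc' := mul_lt_mul_of_pos_right hc1 hl2
      refine eventually_div_neg_log_lt (b := b) (B := c' * Real.log 2) (A := Real.log 2) hR0 hR
        (fun n r hrn => neg_le_neg (Real.log_le_log (hpos n)
          (measureReal_mono (Metric.ball_subset_ball hrn.le)))) ?_
        (Eventually.of_forall fun n => (hlog n).ge) hl2 (hd.trans hc'.le)
        (by rwa [mul_div_cancel_right₀ _ hl2.ne'])
      filter_upwards [hbn.eventually_lt_const hc', eventually_gt_atTop 0] with n hn hn0
      rw [div_lt_iff₀ (by exact_mod_cast hn0), mul_comm] at hn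
      exact hn.le
  refine key.congr fun r => ?_
  rw [hℓ, neg_div_neg_eq]

/-- A pushforward is exact dimensional as soon as it has the pointwise dimension `d` at the image
of almost every point. -/
theorem isExactDimensional_map [SecondCountableTopology Y] [BorelSpace Y] {Ω : Type*}
    [MeasurableSpace Ω] {P : Measure Ω} [IsProbabilityMeasure P] {g : Ω → Y} (hg : Measurable g)
    {d : ℝ} (h : ∀ᵐ ω ∂P, HasPointwiseDim (P.map g) (g ω) d) :
    IsExactDimensional (P.map g) d := by
  have := Measure.isProbabilityMeasure_map (μ := P) hg.aemeasurable
  have hm := fun n : ℕ => measurable_measureReal_ball (P.map g) ((1 / 2) ^ n)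
  have h1 : ∀ᵐ x ∂P.map g, ∀ n : ℕ, 0 < (P.map g).real (Metric.ball x ((1 / 2) ^ n)) := by
    filter_upwards [Measure.support_mem_ae (μ := P.map g)] with x hx n
    rw [Measure.mem_support_iff_forall] at hx
    exact ENNReal.toReal_pos (hx _ (Metric.ball_mem_nhds x (by positivity))).ne'
      (measure_ne_top _ _)
  have h2 : ∀ᵐ x ∂P.map g, Tendsto (fun n : ℕ =>
      Real.log ((P.map g).real (Metric.ball x ((1 / 2) ^ n))) / Real.log ((1 / 2) ^ n))
        atTop (𝓝 d) := by
    refine (ae_map_iff hg.aemeasurable (measurableSet_tendsto_fun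
      (fun n => (hm n).log.div_const _) measurable_const)).2 ?_
    filter_upwards [h] with ω hω
    exact hω.comp (tendsto_nhdsWithin_iff.2
      ⟨tendsto_pow_atTop_nhds_zero_of_lt_one (by norm_num) (by norm_num),
        Eventually.of_forall fun n => by
          show (0 : ℝ) < (1 / 2) ^ n
          positivity⟩)
  filter_upwards [h1, h2] with x hx1 hx2 using hasPointwiseDim_of_tendsto_dyadic hx1 hx2

end PointwiseDim

theorem theorem3 {q : ℕ} (hq : 1 ≤ q) {Λ E : Type*} [MeasurableSpace Λ]
    [Countable E] [MeasurableSpace E] [MeasurableSingletonClass E]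
    (m : Measure Λ) [IsProbabilityMeasure m] [m.IsComplete]
    (S : RandomCIFS q m E) (hBDP : S.BoundedDistortion)
    (μ : Measure (Λ × (ℕ → E))) [IsProbabilityMeasure μ]
    (hμ : Ergodic S.skew μ) (hμm : μ.map Prod.fst = m)
    (κ : Kernel Λ (ℕ → E)) [IsMarkovKernel κ] (hκ : μ = m ⊗ₘ κ)
    (hH : condEntropy μ firstLetter (baseAlgebra Λ E) < ⊤) :
    ∃ d : ℝ, (d : EReal) = S.projEntropy μ / (S.lyapunov μ : EReal) ∧
      (∀ᵐ p ∂μ, HasPointwiseDim ((κ p.1).map (S.coding p.1)) (S.coding p.1 p.2) d) ∧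
      ∀ᵐ lam ∂m, IsExactDimensional ((κ lam).map (S.coding lam)) d := by
  subst hκ
  have hproj := S.measurable_proj
  have hfin1 := (exists_ballInfo_limit measurable_firstLetter hproj hH).1
  have hfin2 := (exists_ballInfo_limit measurable_firstLetter (hproj.comp S.measurable_skew) hH).1
  have hlim := S.ae_tendsto_openBallInfo hq hBDP hμ hH
  set d : ℝ := ((condEntropy (m ⊗ₘ κ) firstLetter
      (baseAlgebra Λ E ⊔ MeasurableSpace.comap (S.proj ∘ S.skew) inferInstance)).toReal -
    (condEntropy (m ⊗ₘ κ) firstLetter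
      (baseAlgebra Λ E ⊔ MeasurableSpace.comap S.proj inferInstance)).toReal) /
        (S.lyapunov (m ⊗ₘ κ)).toReal with hd
  have hdim : ∀ᵐ p ∂(m ⊗ₘ κ),
      HasPointwiseDim ((κ p.1).map (S.coding p.1)) (S.coding p.1 p.2) d := by
    filter_upwards [hlim] with p hp
    refine hp.congr fun r => ?_
    rw [RandomCIFS.openBallInfo, neg_div_neg_eq]
  refine ⟨d, ?_, hdim, ?_⟩
  · rw [hd, RandomCIFS.projEntropy, ← EReal.coe_ennreal_toReal hfin1.ne,
      ← EReal.coe_ennreal_toReal hfin2.ne]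
    by_cases hχ : S.lyapunov (m ⊗ₘ κ) = ⊤
    · rw [hχ, ENNReal.toReal_top, div_zero, EReal.coe_ennreal_top, EReal.div_top, EReal.coe_zero]
    · rw [← EReal.coe_ennreal_toReal hχ, EReal.coe_div, EReal.coe_sub]
  · filter_upwards [Measure.ae_ae_of_ae_compProd hdim] with lam hlam
    exact isExactDimensional_map (hproj.comp measurable_prodMk_left) hlam
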